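/- Consider, for $\varepsilon>0$ and $1/3\le\delta\le1$, the system $$A^{(4)}=A\,(1-A^2-(1+\delta^2)B^2),\qquad B''=\varepsilon^2B\,(-1+(1+\delta^2)A^2+B^2)$$ in $\mathbb R^6$ with coordinates $(A_0,A_1,A_2,A_3,B_0,B_1)=(A,A',A'',A''',B,B')$, the equilibrium $M_+=(0,0,0,0,1,0)$, the stable manifold $\mathcal W^{(s)}_{\varepsilon,\delta}$ of $M_+$ (the set of points whose forward orbit exists for all times and tends to $M_+$), and the 5-dimensional manifold $\mathcal W_{\varepsilon,\delta}$ given by $B_1\ge0$ and $$2\varepsilon^2A_1A_3-\varepsilon^2A_2^2-B_1^2+\tfrac{\varepsilon^2}{2}(A_0^2+B_0^2-1)^2+\varepsilon^2\delta^2A_0^2B_0^2=0 .$$ For $(1+\delta^2)B_0^2>1$ put $\widetilde\delta=((1+\delta^2)B_0^2-1)^{1/4}$ and define coordinates $X=(x_1,x_2)$, $Y=(y_1,y_2)$ by $$A_0=x_1+y_1,\quad A_1=-\tfrac{\widetilde\delta}{\sqrt2}(x_1-y_1+x_2-y_2),\quad A_2=\widetilde\delta^2(x_2+y_2),\quad A_3=\tfrac{\widetilde\delta^3}{\sqrt2}(x_1-y_1-x_2+y_2).$$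 **Lemma.** Let $0<k_1<1/\sqrt2$. There are $\nu_0,C,c_1>0$ such that for every $0<\nu_+\le\nu_0$ there is $\varepsilon_0>0$ for which the following holds. Define $\alpha_+$ by $\varepsilon=\nu_+\alpha_+^{5/2}$, put $\delta_*=\frac1{10}\delta^{2/5}$, and let $D$ be the set of all $(\varepsilon,\delta,X_0,b)\in\mathbb R\times\mathbb R\times\mathbb R^2\times\mathbb R$ with $$0<\varepsilon\le\varepsilon_0,\quad \tfrac13\le\delta\le1,\quad |X_0|\le k_1\alpha_+\delta,\quad |X_0|\le c_1(1-b),\quad \Big(\frac{1+\alpha_+^2\delta^2}{1+\delta^2}\Big)^{1/2}\le b<1 .$$ There are functions $Y^{(s)}:D\to\mathbb R^2$ and $B_1^{(s)}:D\to\mathbb R$, analytic in $(\varepsilon,\delta,X_0,b)$, such that for all $(\varepsilon,\delta,X_0,b)\in D$ the point $p$ with coordinates $X=X_0$, $Y=Y^{(s)}(\varepsilon,\delta,X_0,b)$, $B_0=b$, $B_1=B_1^{(s)}(\varepsilon,\delta,X_0,b)$ lies in $\mathcal W^{(s)}_{\varepsilon,\delta}$, and, for every initial abscissa $x_*^+\in\mathbb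 R$, the orbit with value $p$ at $x=x_*^+$ (so that $X(x_*^+)=X_0$, $B_0(x_*^+)=b$) exists on $[x_*^+,+\infty)$, tends to $M_+$, and satisfies for all $x\ge x_*^+$: 1. it lies in $\mathcal W_{\varepsilon,\delta}$; 2. $\big(\frac{1+\alpha_+^2\delta^2}{1+\delta^2}\big)^{1/2}\le B_0(x_*^+)\le B_0(x)\le1$ and $B_0'(x)>0$; 3. $|A_j(x)|\le C e^{\delta_*\varepsilon^{1/5}x_*^+}\,|X_0|\,e^{-\delta_*\varepsilon^{1/5}x}$ for $j=0,1,2,3$; in particular $A_j(x)=\mathcal O(|X_0|e^{-\delta_*\varepsilon^{1/5}x})$ uniformly in $\varepsilon$ if $x_*^+=\mathcal O(\varepsilon^{-1/5})$; 4. as $x\to+\infty$, $A_j(x)=\mathcal O(e^{-\sqrt{\delta/2}\,x})$ for $j=0,1,2,3$, while $1-B_0(x)$ and $B_1(x)$ are exactly of the order of $e^{-\sqrt2\,\varepsilon x}$. Conversely, if an orbit on $[x_*^+,+\infty)$ stays in $\mathcal W_{\varepsilon,\delta}$, tends to $M_+$ and has $X(x_*^+)=X_0$, $B_0(x_*^+)=b$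 with $(\varepsilon,\delta,X_0,b)\in D$, then its value at $x_*^+$ is the point $p$. Hence for fixed $(\varepsilon,\delta)$ this part of the stable manifold is the 3-dimensional graph of $(Y^{(s)},B_1^{(s)})$ over $(X_0,b)=(X(x_*^+),B_0(x_*^+))$. -/

import Mathlib

open Filter Topology Asymptotics

noncomputable section

namespace DomainWall

/-- The phase space `ℝ⁶`, with coordinates
`(A₀, A₁, A₂, A₃, B₀, B₁) = (A, A', A'', A''', B, B')`, numbered `0, …, 5`. -/
abbrev Phase : Type := Fin 6 → ℝ

/-- The Euclidean plane, in which the coordinates `X` and `Y` live. -/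
abbrev Plane : Type := EuclideanSpace ℝ (Fin 2)

/-- The vector field of the system
`A'''' = A (1 - A² - g B²)`, `B'' = ε² B (-1 + g A² + B²)`, `g = 1 + δ²`,
written as a first order system in `ℝ⁶`. -/
def vectorField (ε δ : ℝ) (Z : Phase) : Phase :=
  ![Z 1, Z 2, Z 3, Z 0 * (1 - Z 0 ^ 2 - (1 + δ ^ 2) * Z 4 ^ 2),
    Z 5, ε ^ 2 * Z 4 * (-1 + (1 + δ ^ 2) * Z 0 ^ 2 + Z 4 ^ 2)]

/-- `Z` solves the system on the half-line `[x₀, +∞)`. -/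
def IsSolutionFrom (ε δ x₀ : ℝ) (Z : ℝ → Phase) : Prop :=
  ∀ x, x₀ ≤ x → HasDerivWithinAt Z (vectorField ε δ (Z x)) (Set.Ici x₀) x

/-- The equilibrium `M₊`, that is `(A, B) = (0, 1)`. -/
def Mplus : Phase := ![0, 0, 0, 0, 1, 0]

/-- The stable manifold of `M₊`: all points whose forward orbit exists for all times and
tends to `M₊`. -/
def stableManifold (ε δ : ℝ) : Set Phase :=
  {p | ∃ Z : ℝ → Phase, IsSolutionFrom ε δ 0 Z ∧ Z 0 = p ∧ Tendsto Z atTop (𝓝 Mplus)}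

/-- The first integral of the system. -/
def firstIntegral (ε δ : ℝ) (Z : Phase) : ℝ :=
  2 * ε ^ 2 * Z 1 * Z 3 - ε ^ 2 * Z 2 ^ 2 - Z 5 ^ 2
    + ε ^ 2 / 2 * (Z 0 ^ 2 + Z 4 ^ 2 - 1) ^ 2 + ε ^ 2 * δ ^ 2 * Z 0 ^ 2 * Z 4 ^ 2

/-- The 5-dimensional manifold `𝒲_{ε,δ}`: the zero level of the first integral, solved for
`B₁` with the nonnegative square root. -/
def energyManifold (ε δ : ℝ) : Set Phase :=
  {Z | firstIntegral ε δ Z = 0 ∧ 0 ≤ Z 5}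

/-- `α₊`, defined by `ε = ν₊ α₊^{5/2}`. -/
def alphaPlus (ν ε : ℝ) : ℝ := (ε / ν) ^ (2 / 5 : ℝ)

/-- The lower bound `((1 + α₊² δ²) / (1 + δ²))^{1/2}` for `B₀`. -/
def lowerB (ν ε δ : ℝ) : ℝ := √((1 + alphaPlus ν ε ^ 2 * δ ^ 2) / (1 + δ ^ 2))

/-- `((1 + δ²) B₀² - 1)^{1/4}`. -/
def deltaTilde (δ b : ℝ) : ℝ := ((1 + δ ^ 2) * b ^ 2 - 1) ^ (1 / 4 : ℝ)

/-- The point of `ℝ⁶` with coordinates `X = (x₁, x₂)` and `Y = (y₁, y₂)` along the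
`B₀`-dependent stable and unstable directions of the `A`-part, and with `B₀ = b`, `B₁ = b₁`;
the four first components are those of `x₁ V_r⁻ + x₂ V_i⁻ + y₁ V_r⁺ + y₂ V_i⁺`, with
`V_r^± = (1, ± d/√2, 0, ∓ d³/√2)`, `V_i^± = (0, ± d/√2, d², ± d³/√2)`. -/
def ofCoords (δ : ℝ) (X Y : Plane) (b b₁ : ℝ) : Phase :=
  ![X 0 + Y 0,
    -(deltaTilde δ b / √2) * (X 0 - Y 0 + X 1 - Y 1),
    deltaTilde δ b ^ 2 * (X 1 + Y 1),
    deltaTilde δ b ^ 3 / √2 * (X 0 - Y 0 - X 1 + Y 1),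
    b, b₁]

/-- The rate `δ_* = δ^{2/5} / 10`. -/
def deltaStar (δ : ℝ) : ℝ := 1 / 10 * δ ^ (2 / 5 : ℝ)

/-- The set of all `(ε, δ, X₀, b)`, where `(X₀, b) = (X(x_*), B₀(x_*))` are the parameters on
the stable manifold. The condition `‖X₀‖ ≤ c₁ (1 - b)` says that the `A`-part is small with
respect to `1 - B₀`; for `b` bounded away from `1` and `ε` small it follows from the condition
`‖X₀‖ ≤ k₁ α₊ δ`. -/
def paramDomain (k₁ c₁ ν ε₀ : ℝ) : Set (ℝ × ℝ × Plane × ℝ) :=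
  {q | match q with
    | (ε, δ, X₀, b) =>
      (0 < ε ∧ ε ≤ ε₀) ∧ (1 / 3 ≤ δ ∧ δ ≤ 1) ∧
      (‖X₀‖ ≤ k₁ * alphaPlus ν ε * δ ∧ ‖X₀‖ ≤ c₁ * (1 - b)) ∧
      (lowerB ν ε δ ≤ b ∧ b < 1)}

end DomainWall

end

/-! ### Calculus on the half-line: monotonicity, first exit, interpolation. -/

open Filter Topology Asymptotics

noncomputable section

namespace DomainWall

/-! The system couples a fast part A, with A'''' = -Q A and Q = (1 + δ²)B² - 1 + A², to a slow part
B. While Q ≥ 0, the boundary form A A''' - A' A'' has derivative -Q A² - A''² and tends to 0, so it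
is nonnegative on a decaying orbit. At the start it equals |X|² - |Y|² + 2(x₁y₂ - y₁x₂) up to a
positive factor, so X controls Y (`coords_sq_le`). When Q is bounded below, a refined Lyapunov
functional gives exponential decay of A with absolute constants (`abs_A_le`).

The first integral vanishes at M₊, hence on the orbit: B'² is ε²(1 - B²)²/2 plus ε² times a term
quadratic in A. Since A is initially tiny compared with 1 - b and decays much faster than e^{-√2 ε
x}, this expression cannot vanish. Thus B' keeps its sign and B follows the law B' ≈ ε(1 - B²)/√2
(`ratio_bounds`, `B₁_pos`, `B_bounds`).

Uniqueness and nondegeneracy have the same cause. The difference of two orbits over one pair (X, b),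
and any element of the kernel of the linearized problem, solve a weakly coupled linear system with X
= 0 and vanishing slow component at the start. A functional built from the boundary form and z z'/ε²
then starts nonnegative, is nondecreasing and tends to 0, so it vanishes identically, and the
solution with it (`eq_zero_of_weakly_coupled`).

Existence is by continuation along tX, 0 ≤ t ≤ 1, from the explicit heteroclinic orbit at t = 0.
Openness comes from the analytic implicit function theorem: for A = e^{-εx/4} v and B = 1 +
e^{-εx/4} w the problem is an integral equation on bounded functions, whose linearization is the
identity minus a compact operator because the nonlinearity retains a decaying factor; a trivial
kernel therefore means invertibility (`exists_analytic_solution`, `GoodOrbit.linearized_trivial`).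
Closedness follows from bounds uniform in t (`isClosed_setOf_goodOrbit`). The local branches are
analytic in all parameters, and uniqueness glues them together (`analyticOn_of_regime`). The sharp
rate √(δ/2) of A comes from comparison with the limit equation A'''' = -δ² A (`exact_decay`). -/

/-- `f` has derivative `f'` on the half-line `[0, +∞)`. -/
def HasDerivOnHalfLine {E : Type*} [NormedAddCommGroup E] [NormedSpace ℝ E] (f f' : ℝ → E) : Prop :=
  ∀ x, 0 ≤ x → HasDerivWithinAt f (f' x) (Set.Ici 0) x

namespace HasDerivOnHalfLine

variable {f f' g g' : ℝ → ℝ}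

theorem continuousOn {E : Type*} [NormedAddCommGroup E] [NormedSpace ℝ E] {f f' : ℝ → E}
    (hf : HasDerivOnHalfLine f f') : ContinuousOn f (Set.Ici 0) :=
  fun x hx => (hf x hx).continuousWithinAt

theorem hasDerivAt {E : Type*} [NormedAddCommGroup E] [NormedSpace ℝ E] {f f' : ℝ → E}
    (hf : HasDerivOnHalfLine f f') {x : ℝ} (hx : 0 < x) : HasDerivAt f (f' x) x :=
  (hf x hx.le).hasDerivAt (Ici_mem_nhds hx)

theorem congr_deriv {E : Type*} [NormedAddCommGroup E] [NormedSpace ℝ E] {f f' g' : ℝ → E}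
    (hf : HasDerivOnHalfLine f f') (h : ∀ x, 0 ≤ x → f' x = g' x) : HasDerivOnHalfLine f g' :=
  fun x hx => h x hx ▸ hf x hx

theorem congr {E : Type*} [NormedAddCommGroup E] [NormedSpace ℝ E] {f f' g : ℝ → E}
    (hf : HasDerivOnHalfLine f f') (h : ∀ x, 0 ≤ x → g x = f x) : HasDerivOnHalfLine g f' :=
  fun x hx => (hf x hx).congr (fun y hy => h y hy) (h x hx)

protected theorem add (hf : HasDerivOnHalfLine f f') (hg : HasDerivOnHalfLine g g') :
    HasDerivOnHalfLine (fun x => f x + g x) fun x => f' x + g' x :=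
  fun x hx => (hf x hx).add (hg x hx)

protected theorem sub (hf : HasDerivOnHalfLine f f') (hg : HasDerivOnHalfLine g g') :
    HasDerivOnHalfLine (fun x => f x - g x) fun x => f' x - g' x :=
  fun x hx => (hf x hx).sub (hg x hx)

protected theorem mul (hf : HasDerivOnHalfLine f f') (hg : HasDerivOnHalfLine g g') :
    HasDerivOnHalfLine (fun x => f x * g x) fun x => f' x * g x + f x * g' x :=
  fun x hx => (hf x hx).mul (hg x hx)

protected theorem neg (hf : HasDerivOnHalfLine f f') :
    HasDerivOnHalfLine (fun x => -f x) fun x => -f' x :=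
  fun x hx => (hf x hx).neg

theorem const_mul (c : ℝ) (hf : HasDerivOnHalfLine f f') :
    HasDerivOnHalfLine (fun x => c * f x) fun x => c * f' x :=
  fun x hx => (hf x hx).const_mul c

theorem sq (hf : HasDerivOnHalfLine f f') :
    HasDerivOnHalfLine (fun x => f x ^ 2) fun x => 2 * f x * f' x :=
  fun y hy => by simpa using (hf y hy).fun_pow 2

theorem exp_mul (κ : ℝ) :
    HasDerivOnHalfLine (fun x => Real.exp (κ * x)) fun x => κ * Real.exp (κ * x) := by
  intro y _
  have := ((hasDerivAt_id y).const_mul κ).exp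
  simp only [id, mul_one] at this
  rw [mul_comm] at this
  exact this.hasDerivWithinAt

/-- Monotonicity up to an abscissa below which the derivative is nonnegative. -/
theorem monotoneOn_Icc (hf : HasDerivOnHalfLine f f') {T : ℝ}
    (h : ∀ x, 0 < x → x < T → 0 ≤ f' x) : MonotoneOn f (Set.Icc 0 T) := by
  refine monotoneOn_of_deriv_nonneg (convex_Icc 0 T)
    (hf.continuousOn.mono Set.Icc_subset_Ici_self) ?_ ?_
  · intro x hx
    rw [interior_Icc] at hx
    exact (hf.hasDerivAt hx.1).differentiableAt.differentiableWithinAt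
  · intro x hx
    rw [interior_Icc] at hx
    rw [(hf.hasDerivAt hx.1).deriv]
    exact h x hx.1 hx.2

theorem monotoneOn (hf : HasDerivOnHalfLine f f') (h : ∀ x, 0 < x → 0 ≤ f' x) :
    MonotoneOn f (Set.Ici 0) := by
  intro x hx y hy hxy
  exact hf.monotoneOn_Icc (T := y) (fun z hz _ => h z hz) ⟨hx, hxy⟩ ⟨hy, le_rfl⟩ hxy

theorem antitoneOn (hf : HasDerivOnHalfLine f f') (h : ∀ x, 0 < x → f' x ≤ 0) :
    AntitoneOn f (Set.Ici 0) := by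
  have hn := hf.neg
  intro x hx y hy hxy
  exact neg_le_neg_iff.1 (hn.monotoneOn (fun z hz => neg_nonneg.2 (h z hz)) hx hy hxy)

/-- A function with nonpositive derivative that tends to `0` is nonnegative. -/
theorem nonneg_of_tendsto (hf : HasDerivOnHalfLine f f') (h : ∀ x, 0 < x → f' x ≤ 0)
    (h0 : Tendsto f atTop (𝓝 0)) {x : ℝ} (hx : 0 ≤ x) : 0 ≤ f x := by
  refine le_of_tendsto h0 ?_
  filter_upwards [eventually_ge_atTop x] with y hy
  exact hf.antitoneOn h hx (hx.trans hy) hy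

/-- `f' ≤ -κ f` implies exponential decay. -/
theorem le_exp_of_deriv_le (hf : HasDerivOnHalfLine f f') {κ : ℝ}
    (h : ∀ x, 0 < x → f' x ≤ -κ * f x) {x : ℝ} (hx : 0 ≤ x) :
    f x ≤ f 0 * Real.exp (-(κ * x)) := by
  have he := hf.mul (exp_mul κ)
  have := he.antitoneOn (fun y hy => by
    have h1 := h y hy
    have h2 := Real.exp_pos (κ * y)
    nlinarith) (Set.self_mem_Ici) (Set.mem_Ici.2 hx) hx
  simp only [mul_zero, Real.exp_zero, mul_one] at this
  rw [Real.exp_neg]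
  rw [← div_eq_mul_inv, le_div_iff₀ (Real.exp_pos _)]
  exact this

end HasDerivOnHalfLine

/-- First exit argument: a continuous function that is positive at `0` and cannot vanish for the
first time is positive on `[0, +∞)`. -/
theorem pos_of_first_exit {φ : ℝ → ℝ} (hφ : ContinuousOn φ (Set.Ici 0)) (h0 : 0 < φ 0)
    (h : ∀ T, 0 < T → (∀ x, 0 ≤ x → x < T → 0 < φ x) → 0 < φ T) {x : ℝ} (hx : 0 ≤ x) :
    0 < φ x := by
  by_contra hneg
  push Not at hneg
  set S : Set ℝ := Set.Icc 0 x ∩ φ ⁻¹' Set.Iic 0 with hS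
  have hSc : IsClosed S :=
    (hφ.mono Set.Icc_subset_Ici_self).preimage_isClosed_of_isClosed isClosed_Icc isClosed_Iic
  have hne : S.Nonempty := ⟨x, ⟨hx, le_rfl⟩, hneg⟩
  have hbd : BddBelow S := ⟨0, fun y hy => hy.1.1⟩
  have hmem := hSc.csInf_mem hne hbd
  set T := sInf S
  have hT0 : 0 < T := by
    rcases hmem.1.1.eq_or_lt with h1 | h1
    · have := hmem.2
      rw [← h1] at this
      exact absurd h0 (not_lt.2 this)
    · exact h1
  have := h T hT0 (fun y hy hyT => by
    by_contra hc
    push Not at hc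
    exact absurd (csInf_le hbd ⟨⟨hy, hyT.le.trans hmem.1.2⟩, hc⟩) (not_le.2 hyT))
  exact absurd this (not_lt.2 hmem.2)

/-- Interpolation: bounds of `f` and `f'''` on `[x, x + 3]` bound `f'` and `f''` at `x`. -/
theorem abs_deriv_le_of_abs_le {f₁ f₂ f₃ f₄ : ℝ → ℝ} (h₁ : HasDerivOnHalfLine f₁ f₂)
    (h₂ : HasDerivOnHalfLine f₂ f₃) (h₃ : HasDerivOnHalfLine f₃ f₄) {x S M : ℝ} (hx : 0 ≤ x)
    (hS : ∀ t, x ≤ t → |f₁ t| ≤ S) (hM : ∀ t, x ≤ t → |f₄ t| ≤ M) :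
    |f₃ x| ≤ 4 * S + 3 * M ∧ |f₂ x| ≤ 6 * S + 6 * M := by
  have hS0 : 0 ≤ S := (abs_nonneg _).trans (hS x le_rfl)
  have hM0 : 0 ≤ M := (abs_nonneg _).trans (hM x le_rfl)
  have mvt : ∀ {u u' : ℝ → ℝ}, HasDerivOnHalfLine u u' → ∀ {a b : ℝ}, x ≤ a → a < b →
      ∃ c, a < c ∧ c < b ∧ u b - u a = u' c * (b - a) := by
    intro u u' hu a b ha hab
    obtain ⟨c, hc, hc'⟩ := exists_hasDerivAt_eq_slope u u' hab
      (hu.continuousOn.mono (fun y hy => (hx.trans ha).trans hy.1))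
      (fun y hy => hu.hasDerivAt (lt_of_le_of_lt (hx.trans ha) hy.1))
    refine ⟨c, hc.1, hc.2, ?_⟩
    rw [hc', div_mul_cancel₀]
    exact (sub_pos.2 hab).ne'
  -- ξ lies in the first and ζ in the last unit interval of [x, x + 3], with |f₂| ≤ 2S at both. As ζ
  -- - ξ ≥ 1, the slope of f₂ between them, which is f₃ at some τ, is at most 4S; the bound on f₄
  -- carries this back from τ to x.
  obtain ⟨ξ, hξ1, hξ2, hξ⟩ := mvt h₁ (le_refl x) (show x < x + 1 by linarith)
  obtain ⟨ζ, hζ1, hζ2, hζ⟩ := mvt h₁ (show x ≤ x + 2 by linarith) (show x + 2 < x + 3 by linarith)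
  have a1 := abs_le.1 (hS x le_rfl)
  have a2 := abs_le.1 (hS (x + 1) (by linarith))
  have a3 := abs_le.1 (hS (x + 2) (by linarith))
  have a4 := abs_le.1 (hS (x + 3) (by linarith))
  obtain ⟨τ, hτ1, hτ2, hτ⟩ := mvt h₂ hξ1.le (show ξ < ζ by linarith)
  have b1 : |f₃ τ| ≤ 4 * S := by
    have hb : |f₃ τ| * (ζ - ξ) ≤ 4 * S := by
      rw [← abs_of_pos (show (0 : ℝ) < ζ - ξ by linarith), ← abs_mul, ← hτ]
      rw [abs_le]; constructor <;> linarith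
    have : |f₃ τ| * 1 ≤ |f₃ τ| * (ζ - ξ) :=
      mul_le_mul_of_nonneg_left (by linarith) (abs_nonneg _)
    linarith
  have b2 : ∀ t, x ≤ t → t < τ → |f₃ t| ≤ 4 * S + 3 * M := by
    intro t ht htτ
    obtain ⟨c, hc1, hc2, hc⟩ := mvt h₃ ht htτ
    have h4 := hM c (by linarith)
    have : |f₄ c * (τ - t)| ≤ 3 * M := by
      rw [abs_mul, abs_of_pos (show (0 : ℝ) < τ - t by linarith)]
      nlinarith [abs_nonneg (f₄ c)]
    rw [← hc] at this
    have := abs_le.1 this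
    have := abs_le.1 b1
    rw [abs_le]; constructor <;> linarith
  refine ⟨b2 x le_rfl (by linarith), ?_⟩
  obtain ⟨c, hc1, hc2, hc⟩ := mvt h₂ (le_refl x) hξ1
  have h3 := b2 c hc1.le (by linarith)
  have : |f₃ c * (ξ - x)| ≤ 4 * S + 3 * M := by
    rw [abs_mul, abs_of_pos (show (0 : ℝ) < ξ - x by linarith)]
    nlinarith [abs_nonneg (f₃ c)]
  rw [← hc] at this
  have := abs_le.1 this
  rw [abs_le]; constructor <;> linarith

end DomainWall

end

/-! ### The fourth order equation: Lyapunov functionals and stable/unstable coordinates. -/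

open Filter Topology Asymptotics

noncomputable section

namespace DomainWall

section FourthOrder

variable {A₀ A₁ A₂ A₃ Q : ℝ → ℝ}

/-- For `A'''' = -Q A` with `Q ≥ 0`, the boundary form `A A''' - A' A''` of a decaying solution is
nonnegative. -/
theorem boundary_form_nonneg (h₀ : HasDerivOnHalfLine A₀ A₁) (h₁ : HasDerivOnHalfLine A₁ A₂)
    (h₂ : HasDerivOnHalfLine A₂ A₃) (h₃ : HasDerivOnHalfLine A₃ fun x => -Q x * A₀ x)
    (hQ : ∀ x, 0 ≤ x → 0 ≤ Q x)
    (t₀ : Tendsto A₀ atTop (𝓝 0)) (t₁ : Tendsto A₁ atTop (𝓝 0))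
    (t₂ : Tendsto A₂ atTop (𝓝 0)) (t₃ : Tendsto A₃ atTop (𝓝 0)) {x : ℝ} (hx : 0 ≤ x) :
    0 ≤ A₀ x * A₃ x - A₁ x * A₂ x := by
  -- The terms A' A''' cancel and leave -Q A² - A''², so the form decreases to its limit 0.
  have hP : HasDerivOnHalfLine (fun x => A₀ x * A₃ x - A₁ x * A₂ x)
      (fun x => (A₁ x * A₃ x + A₀ x * (-Q x * A₀ x)) - (A₂ x * A₂ x + A₁ x * A₃ x)) :=
    fun y hy => ((h₀ y hy).mul (h₃ y hy)).sub ((h₁ y hy).mul (h₂ y hy))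
  refine hP.nonneg_of_tendsto (fun y hy => ?_) (by simpa using (t₀.mul t₃).sub (t₁.mul t₂)) hx
  nlinarith [mul_nonneg (hQ y hy.le) (sq_nonneg (A₀ y)), sq_nonneg (A₂ y)]

/-- Exponential decay of the decaying solutions of `A'''' = -Q A` with `Q ≥ d⁴ / 4`. -/
theorem sq_le_exp_of_fourth_order {d : ℝ} (hd : 0 < d)
    (h₀ : HasDerivOnHalfLine A₀ A₁) (h₁ : HasDerivOnHalfLine A₁ A₂)
    (h₂ : HasDerivOnHalfLine A₂ A₃) (h₃ : HasDerivOnHalfLine A₃ fun x => -Q x * A₀ x)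
    (hQ : ∀ x, 0 ≤ x → d ^ 4 / 4 ≤ Q x)
    (t₀ : Tendsto A₀ atTop (𝓝 0)) (t₁ : Tendsto A₁ atTop (𝓝 0))
    (t₂ : Tendsto A₂ atTop (𝓝 0)) (t₃ : Tendsto A₃ atTop (𝓝 0)) {E : ℝ}
    (hE : A₀ 0 * A₃ 0 - A₁ 0 * A₂ 0 - d ^ 2 / 2 * (A₀ 0 * A₁ 0)
      + d / 2 * (A₁ 0 ^ 2 - A₀ 0 * A₂ 0 + d ^ 2 / 4 * A₀ 0 ^ 2) ≤ E) {x : ℝ} (hx : 0 ≤ x) :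
    d ^ 3 / 4 * A₀ x ^ 2 ≤ E * Real.exp (-(d / 2 * x)) ∧
      d / 2 * A₁ x ^ 2 ≤ E * Real.exp (-(d / 2 * x)) := by
  -- The correction -(d²/2) A A' makes V dissipate A'² as well as A² and A''². Φ is chosen so that
  -- Φ' = -V; both V and Φ are nonincreasing with limit 0, hence nonnegative.
  set V : ℝ → ℝ := fun x => A₀ x * A₃ x - A₁ x * A₂ x - d ^ 2 / 2 * (A₀ x * A₁ x) with hV
  set V' : ℝ → ℝ := fun x => (A₁ x * A₃ x + A₀ x * (-Q x * A₀ x))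
    - (A₂ x * A₂ x + A₁ x * A₃ x) - d ^ 2 / 2 * (A₁ x * A₁ x + A₀ x * A₂ x) with hV'
  set Φ : ℝ → ℝ := fun x => A₁ x ^ 2 - A₀ x * A₂ x + d ^ 2 / 4 * A₀ x ^ 2 with hΦ
  have dA0 := h₀.sq
  have dA1 := h₁.sq
  have dV : HasDerivOnHalfLine V V' := fun y hy =>
    (((h₀ y hy).mul (h₃ y hy)).sub ((h₁ y hy).mul (h₂ y hy))).sub
      (((h₀ y hy).mul (h₁ y hy)).const_mul _)
  have dΦ : HasDerivOnHalfLine Φ (fun x => -V x) :=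
    ((dA1.sub (h₀.mul h₂)).add (dA0.const_mul (d ^ 2 / 4))).congr_deriv fun y _ => by
      simp only [hV]; ring
  have tV : Tendsto V atTop (𝓝 0) := by
    simpa using ((t₀.mul t₃).sub (t₁.mul t₂)).sub ((t₀.mul t₁).const_mul (d ^ 2 / 2))
  have tΦ : Tendsto Φ atTop (𝓝 0) := by
    simpa using ((t₁.pow 2).sub (t₀.mul t₂)).add ((t₀.pow 2).const_mul (d ^ 2 / 4))
  have hV'le : ∀ y, 0 ≤ y →
      V' y ≤ -(d ^ 4 / 8 * A₀ y ^ 2 + A₂ y ^ 2 / 2 + d ^ 2 / 2 * A₁ y ^ 2) := by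
    intro y hy
    have h1 := mul_le_mul_of_nonneg_right (hQ y hy) (sq_nonneg (A₀ y))
    simp only [hV']
    nlinarith [sq_nonneg (d ^ 2 / 2 * A₀ y + A₂ y)]
  have e0 : ∀ y, 0 ≤ d ^ 4 / 8 * A₀ y ^ 2 + A₂ y ^ 2 / 2 + d ^ 2 / 2 * A₁ y ^ 2 :=
    fun y => by positivity
  have V0 : ∀ y, 0 ≤ y → 0 ≤ V y := fun y hy =>
    dV.nonneg_of_tendsto (fun z hz => (hV'le z hz.le).trans (neg_nonpos.2 (e0 z))) tV hy
  have Φ0 : ∀ y, 0 ≤ y → 0 ≤ Φ y := fun y hy =>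
    dΦ.nonneg_of_tendsto (fun z hz => neg_nonpos.2 (V0 z hz.le)) tΦ hy
  have key : ∀ y, 0 ≤ y → V' y ≤ -(d ^ 2 / 4) * Φ y := by
    intro y hy
    refine (hV'le y hy).trans ?_
    simp only [hΦ]
    nlinarith [sq_nonneg (d ^ 2 / 4 * A₀ y - A₂ y), sq_nonneg (d ^ 2 * A₀ y), sq_nonneg (A₂ y),
      sq_nonneg (d * A₁ y)]
  -- With L = V + (d/2)Φ, the bound V' ≤ -(d²/4)Φ gives L' ≤ -(d²/4)Φ - (d/2)V = -(d/2)L, a closed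
  -- decay inequality.
  have dL : HasDerivOnHalfLine (fun x => V x + d / 2 * Φ x) (fun x => V' x + d / 2 * -V x) :=
    fun y hy => (dV y hy).add ((dΦ y hy).const_mul _)
  have hL := dL.le_exp_of_deriv_le (κ := d / 2) (fun y hy => by
    have := key y hy.le
    linarith) hx
  have hVle : V x ≤ E * Real.exp (-(d / 2 * x)) := by
    have h1 : (V 0 + d / 2 * Φ 0) * Real.exp (-(d / 2 * x)) ≤ E * Real.exp (-(d / 2 * x)) :=
      mul_le_mul_of_nonneg_right hE (Real.exp_pos _).le
    have h2 := mul_nonneg (half_pos hd).le (Φ0 x hx)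
    linarith
  constructor
  · refine le_trans ?_ hVle
    -- Subtracting this multiple of A² from V still leaves a nonincreasing function with limit 0, so
    -- V dominates it pointwise. The same device serves for A'².
    have dW : HasDerivOnHalfLine (fun x => V x - d ^ 3 / 4 * A₀ x ^ 2)
        (fun x => V' x - d ^ 3 / 4 * (2 * A₀ x * A₁ x)) :=
      fun y hy => (dV y hy).sub ((dA0 y hy).const_mul _)
    have := dW.nonneg_of_tendsto (fun y hy => ?_)
      (by simpa using tV.sub ((t₀.pow 2).const_mul (d ^ 3 / 4))) hx
    · linarith
    · have := hV'le y hy.le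
      nlinarith [sq_nonneg (d ^ 2 * A₀ y + 2 * d * A₁ y), sq_nonneg (A₂ y)]
  · refine le_trans ?_ hVle
    have dW : HasDerivOnHalfLine (fun x => V x - d / 2 * A₁ x ^ 2)
        (fun x => V' x - d / 2 * (2 * A₁ x * A₂ x)) :=
      fun y hy => (dV y hy).sub ((dA1 y hy).const_mul _)
    have := dW.nonneg_of_tendsto (fun y hy => ?_)
      (by simpa using tV.sub ((t₁.pow 2).const_mul (d / 2))) hx
    · linarith
    · have := hV'le y hy.le
      nlinarith [sq_nonneg (d * A₁ y + A₂ y), sq_nonneg (d ^ 2 * A₀ y)]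

end FourthOrder

section Coordinates

theorem plane_norm_sq (X : Plane) : ‖X‖ ^ 2 = X 0 ^ 2 + X 1 ^ 2 := by
  rw [EuclideanSpace.norm_sq_eq]; simp

/-- The boundary form in the coordinates `(X, Y)`. -/
theorem boundary_form_coords {d A₀ A₁ A₂ A₃ x₁ x₂ y₁ y₂ : ℝ} (h₀ : A₀ = x₁ + y₁)
    (h₁ : A₁ = -(d / √2) * (x₁ - y₁ + x₂ - y₂)) (h₂ : A₂ = d ^ 2 * (x₂ + y₂))
    (h₃ : A₃ = d ^ 3 / √2 * (x₁ - y₁ - x₂ + y₂)) :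
    A₀ * A₃ - A₁ * A₂ =
      d ^ 3 / √2 * (x₁ ^ 2 + x₂ ^ 2 - (y₁ ^ 2 + y₂ ^ 2) + 2 * (x₁ * y₂ - y₁ * x₂)) := by
  subst h₀ h₁ h₂ h₃
  ring

/-- A nonnegative boundary form bounds `Y` in terms of `X`. -/
theorem coords_sq_le {d A₀ A₁ A₂ A₃ x₁ x₂ y₁ y₂ : ℝ} (hd : 0 < d) (h₀ : A₀ = x₁ + y₁)
    (h₁ : A₁ = -(d / √2) * (x₁ - y₁ + x₂ - y₂)) (h₂ : A₂ = d ^ 2 * (x₂ + y₂))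
    (h₃ : A₃ = d ^ 3 / √2 * (x₁ - y₁ - x₂ + y₂)) (hP : 0 ≤ A₀ * A₃ - A₁ * A₂) :
    y₁ ^ 2 + y₂ ^ 2 ≤ 9 * (x₁ ^ 2 + x₂ ^ 2) := by
  rw [boundary_form_coords h₀ h₁ h₂ h₃] at hP
  have h : 0 ≤ x₁ ^ 2 + x₂ ^ 2 - (y₁ ^ 2 + y₂ ^ 2) + 2 * (x₁ * y₂ - y₁ * x₂) :=
    nonneg_of_mul_nonneg_right hP (by positivity)
  -- The two squares bound 2(x₁y₂ - y₁x₂) by |Y|²/2 + 2|X|², which gives |Y|² ≤ 6|X|²; the constant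
  -- 9 is kept so that |Y| ≤ 3|X|.
  nlinarith [sq_nonneg (y₂ - 2 * x₁), sq_nonneg (y₁ + 2 * x₂)]

/-- With `X = 0` the boundary form is nonpositive. -/
theorem boundary_form_nonpos {d A₀ A₁ A₂ A₃ y₁ y₂ : ℝ} (hd : 0 < d) (h₀ : A₀ = y₁)
    (h₁ : A₁ = -(d / √2) * (-y₁ - y₂)) (h₂ : A₂ = d ^ 2 * y₂)
    (h₃ : A₃ = d ^ 3 / √2 * (-y₁ + y₂)) : A₀ * A₃ - A₁ * A₂ ≤ 0 := by
  have := boundary_form_coords (d := d) (A₀ := A₀) (A₁ := A₁) (A₂ := A₂) (A₃ := A₃) (x₁ := 0)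
    (x₂ := 0) (y₁ := y₁) (y₂ := y₂) (by rw [h₀]; ring) (by rw [h₁]; ring) (by rw [h₂]; ring)
    (by rw [h₃]; ring)
  rw [this]
  have h2 : 0 < d ^ 3 / √2 := by positivity
  nlinarith [mul_nonneg h2.le (sq_nonneg y₁), mul_nonneg h2.le (sq_nonneg y₂)]

/-- Size of the boundary functional in the coordinates. -/
theorem boundary_energy_le {d A₀ A₁ A₂ A₃ x₁ x₂ y₁ y₂ r : ℝ} (hd : 0 < d) (hr : 0 ≤ r)
    (h₀ : A₀ = x₁ + y₁)
    (h₁ : A₁ = -(d / √2) * (x₁ - y₁ + x₂ - y₂)) (h₂ : A₂ = d ^ 2 * (x₂ + y₂))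
    (h₃ : A₃ = d ^ 3 / √2 * (x₁ - y₁ - x₂ + y₂))
    (hx : x₁ ^ 2 + x₂ ^ 2 ≤ r ^ 2) (hy : y₁ ^ 2 + y₂ ^ 2 ≤ 9 * (x₁ ^ 2 + x₂ ^ 2)) :
    |A₀| ≤ 4 * r ∧ |A₁| ≤ 4 * r * d ∧ A₀ * A₃ - A₁ * A₂ - d ^ 2 / 2 * (A₀ * A₁)
      + d / 2 * (A₁ ^ 2 - A₀ * A₂ + d ^ 2 / 4 * A₀ ^ 2) ≤ 58 * d ^ 3 * r ^ 2 := by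
  have hs : 0 < √2 := by positivity
  have hs2 : √2 ^ 2 = 2 := Real.sq_sqrt (by norm_num)
  have hx1 : |x₁| ≤ r := abs_le_of_sq_le_sq (by nlinarith [sq_nonneg x₂]) hr
  have hx2 : |x₂| ≤ r := abs_le_of_sq_le_sq (by nlinarith [sq_nonneg x₁]) hr
  have hy1 : |y₁| ≤ 3 * r := abs_le_of_sq_le_sq (by nlinarith [sq_nonneg y₂]) (by positivity)
  have hy2 : |y₂| ≤ 3 * r := abs_le_of_sq_le_sq (by nlinarith [sq_nonneg y₁]) (by positivity)
  have k1 : |(x₁ + x₂) / √2| ≤ r := by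
    refine abs_le_of_sq_le_sq ?_ hr
    rw [div_pow, hs2]; nlinarith [sq_nonneg (x₁ - x₂)]
  have k2 : |(y₁ + y₂) / √2| ≤ 3 * r := by
    refine abs_le_of_sq_le_sq ?_ (by positivity)
    rw [div_pow, hs2]; nlinarith [sq_nonneg (y₁ - y₂)]
  have k3 : |(x₁ - x₂) / √2| ≤ r := by
    refine abs_le_of_sq_le_sq ?_ hr
    rw [div_pow, hs2]; nlinarith [sq_nonneg (x₁ + x₂)]
  have k4 : |(y₁ - y₂) / √2| ≤ 3 * r := by
    refine abs_le_of_sq_le_sq ?_ (by positivity)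
    rw [div_pow, hs2]; nlinarith [sq_nonneg (y₁ + y₂)]
  obtain ⟨u1, hu1, e1⟩ : ∃ u, |u| ≤ 4 * r ∧ A₁ = d * u := by
    refine ⟨(y₁ + y₂) / √2 - (x₁ + x₂) / √2, ?_, by rw [h₁]; ring⟩
    have := abs_sub ((y₁ + y₂) / √2) ((x₁ + x₂) / √2)
    linarith
  obtain ⟨u3, hu3, e3⟩ : ∃ u, |u| ≤ 4 * r ∧ A₃ = d ^ 3 * u := by
    refine ⟨(x₁ - x₂) / √2 - (y₁ - y₂) / √2, ?_, by rw [h₃]; ring⟩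
    have := abs_sub ((x₁ - x₂) / √2) ((y₁ - y₂) / √2)
    linarith
  obtain ⟨u0, hu0, e0⟩ : ∃ u, |u| ≤ 4 * r ∧ A₀ = u :=
    ⟨x₁ + y₁, by have := abs_add_le x₁ y₁; linarith, h₀⟩
  obtain ⟨u2, hu2, e2⟩ : ∃ u, |u| ≤ 4 * r ∧ A₂ = d ^ 2 * u :=
    ⟨x₂ + y₂, by have := abs_add_le x₂ y₂; linarith, h₂⟩
  have m : ∀ {u v : ℝ}, |u| ≤ 4 * r → |v| ≤ 4 * r → |u * v| ≤ 16 * r ^ 2 := by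
    intro u v hu hv
    rw [abs_mul]
    calc |u| * |v| ≤ 4 * r * (4 * r) :=
          mul_le_mul hu hv (abs_nonneg _) (by positivity)
      _ = 16 * r ^ 2 := by ring
  refine ⟨e0 ▸ hu0, ?_, ?_⟩
  · rw [e1, abs_mul, abs_of_pos hd, mul_comm]
    exact mul_le_mul_of_nonneg_right hu1 hd.le
  · have q1 := abs_le.1 (m hu0 hu3)
    have q2 := abs_le.1 (m hu1 hu2)
    have q3 := abs_le.1 (m hu0 hu1)
    have q4 := abs_le.1 (m hu1 hu1)
    have q5 := abs_le.1 (m hu0 hu2)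
    have q6 := abs_le.1 (m hu0 hu0)
    -- After scaling out d³, every product uᵢuⱼ is at most 16 r², and 58 = 16 (1 + 1 + 1/2 + 1/2 +
    -- 1/2 + 1/8).
    have : A₀ * A₃ - A₁ * A₂ - d ^ 2 / 2 * (A₀ * A₁)
        + d / 2 * (A₁ ^ 2 - A₀ * A₂ + d ^ 2 / 4 * A₀ ^ 2) =
        d ^ 3 * (u0 * u3 - u1 * u2 - u0 * u1 / 2 + (u1 * u1 - u0 * u2 + u0 * u0 / 4) / 2) := by
      rw [e0, e1, e2, e3]; ring
    rw [this, mul_comm 58, mul_assoc]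
    refine mul_le_mul_of_nonneg_left ?_ (by positivity)
    linarith

end Coordinates

end DomainWall

end

/-! ### Uniqueness for weakly coupled fast–slow linear systems. -/

open Filter Topology Asymptotics

noncomputable section

namespace DomainWall

theorem HasDerivOnHalfLine.deriv_eq_zero {f f' : ℝ → ℝ} (hf : HasDerivOnHalfLine f f')
    (h : ∀ x, 0 ≤ x → f x = 0) : ∀ x, 0 ≤ x → f' x = 0 := by
  intro x hx
  have h0 : HasDerivWithinAt f 0 (Set.Ici 0) x :=
    (hasDerivWithinAt_const x (Set.Ici 0) (0 : ℝ)).congr (fun y hy => h y hy) (h x hx)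
  exact ((uniqueDiffOn_Ici (0 : ℝ)) x hx).eq_deriv _ (hf x hx) h0

/-- Uniqueness for the decaying solutions of a weakly coupled system of a fourth order and a slow
second order equation, with dissipative boundary conditions at `0`. -/
theorem eq_zero_of_weakly_coupled {w₀ w₁ w₂ w₃ z₀ z₁ a p p' e : ℝ → ℝ} {ε m M κ : ℝ}
    (hε : 0 < ε) (hm : 0 < m) (hκ : 0 < κ) (hM : 0 ≤ M) (hεκ : 4 * M * ε ^ 2 ≤ κ ^ 2)
    (hw₀ : HasDerivOnHalfLine w₀ w₁) (hw₁ : HasDerivOnHalfLine w₁ w₂)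
    (hw₂ : HasDerivOnHalfLine w₂ w₃)
    (hw₃ : HasDerivOnHalfLine w₃ fun x => -a x * w₀ x - p x * z₀ x)
    (hz₀ : HasDerivOnHalfLine z₀ z₁)
    (hz₁ : HasDerivOnHalfLine z₁ fun x => ε ^ 2 * (e x * z₀ x + p' x * w₀ x))
    (tw₀ : Tendsto w₀ atTop (𝓝 0)) (tw₁ : Tendsto w₁ atTop (𝓝 0))
    (tw₂ : Tendsto w₂ atTop (𝓝 0)) (tw₃ : Tendsto w₃ atTop (𝓝 0))
    (tz₀ : Tendsto z₀ atTop (𝓝 0)) (tz₁ : Tendsto z₁ atTop (𝓝 0))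
    (ha : ∀ x, 0 ≤ x → m ≤ a x) (he : ∀ x, 0 ≤ x → 1 / 2 ≤ e x)
    (hp : ∀ x, 0 ≤ x → (p x + p' x) ^ 2 ≤ M * m * Real.exp (-κ * x))
    (hb : w₀ 0 * w₃ 0 - w₁ 0 * w₂ 0 ≤ 0) (hz : z₀ 0 = 0) :
    ∀ x, 0 ≤ x → w₀ x = 0 ∧ w₁ x = 0 ∧ w₂ x = 0 ∧ w₃ x = 0 ∧ z₀ x = 0 ∧ z₁ x = 0 := by
  set E : ℝ → ℝ := fun x => Real.exp (-κ * x) with hE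
  have dE : HasDerivOnHalfLine E fun x => -κ * E x := HasDerivOnHalfLine.exp_mul (-κ)
  have E0 : ∀ x, 0 < E x := fun x => Real.exp_pos _
  have E1 : ∀ x, 0 ≤ x → E x ≤ 1 := fun x hx =>
    Real.exp_le_one_iff.2 (by nlinarith)
  have tE : Tendsto E atTop (𝓝 0) := by
    have : Tendsto (fun x : ℝ => -κ * x) atTop atBot :=
      tendsto_id.const_mul_atTop_of_neg (neg_lt_zero.2 hκ)
    exact Real.tendsto_exp_atBot.comp this
  -- The boundary form with reversed sign and z z'/ε² have good derivatives, but the coupling may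
  -- exceed e z² where x is small. The last term of J repairs this: its derivative supplies M
  -- e^{-κx} z², at the price of a cross term in z z' that z'²/ε² absorbs because 4Mε² ≤ κ², the
  -- coupling being short-lived on the slow scale.
  set J : ℝ → ℝ := fun x => w₁ x * w₂ x - w₀ x * w₃ x + 1 / ε ^ 2 * (z₀ x * z₁ x)
    - M / κ * (E x * z₀ x ^ 2) with hJ
  set J' : ℝ → ℝ := fun x => a x * w₀ x ^ 2 + (p x + p' x) * (w₀ x * z₀ x) + w₂ x ^ 2
    + 1 / ε ^ 2 * z₁ x ^ 2 + e x * z₀ x ^ 2 + M * E x * z₀ x ^ 2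
    - 2 * (M / κ) * (E x * (z₀ x * z₁ x)) with hJ'
  have dJ : HasDerivOnHalfLine J J' := by
    refine ((((hw₁.mul hw₂).sub (hw₀.mul hw₃)).add ((hz₀.mul hz₁).const_mul _)).sub
      ((dE.mul hz₀.sq).const_mul _)).congr_deriv fun x hx => ?_
    simp only [hJ']
    field_simp
    ring
  have tJ : Tendsto J atTop (𝓝 0) := by
    simpa using (((tw₁.mul tw₂).sub (tw₀.mul tw₃)).add ((tz₀.mul tz₁).const_mul (1 / ε ^ 2))).sub
      ((tE.mul (tz₀.pow 2)).const_mul (M / κ))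
  have hJ'ge : ∀ x, 0 ≤ x → m / 2 * w₀ x ^ 2 + 1 / 2 * z₀ x ^ 2 ≤ J' x := by
    intro x hx
    have h1 : m * w₀ x ^ 2 ≤ a x * w₀ x ^ 2 := mul_le_mul_of_nonneg_right (ha x hx) (sq_nonneg _)
    have h2 : 1 / 2 * z₀ x ^ 2 ≤ e x * z₀ x ^ 2 :=
      mul_le_mul_of_nonneg_right (he x hx) (sq_nonneg _)
    -- Young's inequality with weight m: half of the available m w² is spent on the coupling.
    have h3 : -(m / 2 * w₀ x ^ 2) - M / 2 * E x * z₀ x ^ 2 ≤ (p x + p' x) * (w₀ x * z₀ x) := by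
      have h4 := mul_le_mul_of_nonneg_right (hp x hx) (sq_nonneg (z₀ x))
      have h5 : 0 ≤ m * (m / 2 * w₀ x ^ 2 + (p x + p' x) * (w₀ x * z₀ x)
          + M / 2 * E x * z₀ x ^ 2) := by
        nlinarith [sq_nonneg (m * w₀ x + (p x + p' x) * z₀ x)]
      have := nonneg_of_mul_nonneg_right h5 hm
      linarith
    have h6 : 2 * (M / κ) * (E x * (z₀ x * z₁ x)) ≤
        M / 2 * E x * z₀ x ^ 2 + 1 / ε ^ 2 * z₁ x ^ 2 := by
      have h7 : 2 * (M / κ) * (E x * (z₀ x * z₁ x)) ≤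
          M / 2 * E x * z₀ x ^ 2 + 2 * M / κ ^ 2 * E x * z₁ x ^ 2 := by
        have : M / 2 * E x * z₀ x ^ 2 + 2 * M / κ ^ 2 * E x * z₁ x ^ 2
            - 2 * (M / κ) * (E x * (z₀ x * z₁ x)) =
            M / 2 * E x * (z₀ x - 2 / κ * z₁ x) ^ 2 := by
          field_simp; ring
        have h8 : 0 ≤ M / 2 * E x * (z₀ x - 2 / κ * z₁ x) ^ 2 :=
          mul_nonneg (mul_nonneg (by linarith) (E0 x).le) (sq_nonneg _)
        linarith
      have h9 : 2 * M / κ ^ 2 * E x ≤ 1 / ε ^ 2 := by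
        have : 2 * M / κ ^ 2 ≤ 1 / ε ^ 2 := by
          rw [div_le_div_iff₀ (by positivity) (by positivity)]
          nlinarith [mul_nonneg hM (sq_nonneg ε)]
        calc 2 * M / κ ^ 2 * E x ≤ 2 * M / κ ^ 2 * 1 :=
              mul_le_mul_of_nonneg_left (E1 x hx) (by positivity)
          _ ≤ 1 / ε ^ 2 := by linarith
      have := mul_le_mul_of_nonneg_right h9 (sq_nonneg (z₁ x))
      linarith
    simp only [hJ']
    nlinarith [sq_nonneg (w₂ x)]
  have hJ'0 : ∀ x, 0 ≤ x → 0 ≤ J' x := fun x hx =>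
    le_trans (by positivity) (hJ'ge x hx)
  -- J is nondecreasing with limit 0, hence J ≤ 0; the conditions at 0 give J(0) ≥ 0. So J is
  -- constant and its coercive derivative vanishes.
  have J0 : ∀ x, 0 ≤ x → J x = 0 := by
    intro x hx
    apply le_antisymm
    · have := dJ.neg.nonneg_of_tendsto (fun y hy => neg_nonpos.2 (hJ'0 y hy.le))
        (by simpa using tJ.neg) hx
      linarith
    · refine le_trans ?_ (dJ.monotoneOn (fun y hy => hJ'0 y hy.le) Set.self_mem_Ici hx hx)
      simp only [hJ, hz]
      linarith
  have hz' : ∀ x, 0 ≤ x → w₀ x = 0 ∧ z₀ x = 0 := by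
    intro x hx
    have h1 := hJ'ge x hx
    rw [dJ.deriv_eq_zero J0 x hx] at h1
    have h2 : 0 ≤ m / 2 * w₀ x ^ 2 := by positivity
    have h3 : 0 ≤ 1 / 2 * z₀ x ^ 2 := by positivity
    constructor
    · have : m / 2 * w₀ x ^ 2 = 0 := by linarith
      have := (mul_eq_zero.1 this).resolve_left (by positivity)
      exact pow_eq_zero_iff (two_ne_zero) |>.1 this
    · have : 1 / 2 * z₀ x ^ 2 = 0 := by linarith
      have := (mul_eq_zero.1 this).resolve_left (by positivity)
      exact pow_eq_zero_iff (two_ne_zero) |>.1 this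
  have e1 := hw₀.deriv_eq_zero fun x hx => (hz' x hx).1
  have e2 := hw₁.deriv_eq_zero e1
  have e3 := hw₂.deriv_eq_zero e2
  have e4 := hz₀.deriv_eq_zero fun x hx => (hz' x hx).2
  exact fun x hx => ⟨(hz' x hx).1, e1 x hx, e2 x hx, e3 x hx, (hz' x hx).2, e4 x hx⟩

end DomainWall

end

/-! ### The first integral and the parameter regime. -/

open Filter Topology Asymptotics

noncomputable section

namespace DomainWall

section Components

variable {ε δ : ℝ} {Z : ℝ → Phase}

theorem IsSolutionFrom.component (hZ : IsSolutionFrom ε δ 0 Z) (j : Fin 6) :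
    HasDerivOnHalfLine (fun x => Z x j) fun x => vectorField ε δ (Z x) j :=
  fun x hx => (hasDerivWithinAt_pi.1 (hZ x hx)) j

theorem IsSolutionFrom.deriv_zero (hZ : IsSolutionFrom ε δ 0 Z) :
    HasDerivOnHalfLine (fun x => Z x 0) fun x => Z x 1 := hZ.component 0

theorem IsSolutionFrom.deriv_one (hZ : IsSolutionFrom ε δ 0 Z) :
    HasDerivOnHalfLine (fun x => Z x 1) fun x => Z x 2 := hZ.component 1

theorem IsSolutionFrom.deriv_two (hZ : IsSolutionFrom ε δ 0 Z) :
    HasDerivOnHalfLine (fun x => Z x 2) fun x => Z x 3 := hZ.component 2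

theorem IsSolutionFrom.deriv_three (hZ : IsSolutionFrom ε δ 0 Z) :
    HasDerivOnHalfLine (fun x => Z x 3)
      fun x => Z x 0 * (1 - Z x 0 ^ 2 - (1 + δ ^ 2) * Z x 4 ^ 2) := hZ.component 3

theorem IsSolutionFrom.deriv_four (hZ : IsSolutionFrom ε δ 0 Z) :
    HasDerivOnHalfLine (fun x => Z x 4) fun x => Z x 5 := hZ.component 4

theorem IsSolutionFrom.deriv_five (hZ : IsSolutionFrom ε δ 0 Z) :
    HasDerivOnHalfLine (fun x => Z x 5)
      fun x => ε ^ 2 * Z x 4 * (-1 + (1 + δ ^ 2) * Z x 0 ^ 2 + Z x 4 ^ 2) := hZ.component 5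

theorem tendsto_component (hZ : Tendsto Z atTop (𝓝 Mplus)) (j : Fin 6) :
    Tendsto (fun x => Z x j) atTop (𝓝 (Mplus j)) :=
  (tendsto_pi_nhds.1 hZ) j

theorem tendsto_A (hZ : Tendsto Z atTop (𝓝 Mplus)) :
    Tendsto (fun x => Z x 0) atTop (𝓝 0) ∧ Tendsto (fun x => Z x 1) atTop (𝓝 0) ∧
    Tendsto (fun x => Z x 2) atTop (𝓝 0) ∧ Tendsto (fun x => Z x 3) atTop (𝓝 0) :=
  ⟨tendsto_component hZ 0, tendsto_component hZ 1, tendsto_component hZ 2, tendsto_component hZ 3⟩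

theorem tendsto_B (hZ : Tendsto Z atTop (𝓝 Mplus)) :
    Tendsto (fun x => Z x 4) atTop (𝓝 1) ∧ Tendsto (fun x => Z x 5) atTop (𝓝 0) :=
  ⟨tendsto_component hZ 4, tendsto_component hZ 5⟩

/-- The part of the first integral that involves `A`, divided by `ε²`. -/
def transverseEnergy (δ : ℝ) (Z : Phase) : ℝ :=
  2 * Z 1 * Z 3 - Z 2 ^ 2 + ((1 + δ ^ 2) * Z 4 ^ 2 - 1) * Z 0 ^ 2 + Z 0 ^ 4 / 2

theorem firstIntegral_eq (ε δ : ℝ) (Z : Phase) :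
    firstIntegral ε δ Z =
      ε ^ 2 * ((1 - Z 4 ^ 2) ^ 2 / 2 + transverseEnergy δ Z) - Z 5 ^ 2 := by
  unfold firstIntegral transverseEnergy
  ring

/-- The first integral vanishes on every orbit that tends to `M₊`. -/
theorem firstIntegral_eq_zero (hZ : IsSolutionFrom ε δ 0 Z) (ht : Tendsto Z atTop (𝓝 Mplus))
    {x : ℝ} (hx : 0 ≤ x) : firstIntegral ε δ (Z x) = 0 := by
  have hd : HasDerivOnHalfLine (fun x => firstIntegral ε δ (Z x)) fun _ => 0 := by
    have h0 := hZ.deriv_zero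
    have h1 := hZ.deriv_one
    have h2 := hZ.deriv_two
    have h3 := hZ.deriv_three
    have h4 := hZ.deriv_four
    have h5 := hZ.deriv_five
    have h1' : HasDerivOnHalfLine (fun _ : ℝ => (1 : ℝ)) fun _ => 0 :=
      fun x _ => hasDerivWithinAt_const x _ _
    have := (((((h1.mul h3).const_mul (2 * ε ^ 2)).sub (h2.sq.const_mul (ε ^ 2))).sub h5.sq).add
      ((((h0.sq.add h4.sq).sub h1').sq).const_mul (ε ^ 2 / 2))).add
      ((h0.sq.mul h4.sq).const_mul (ε ^ 2 * δ ^ 2))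
    refine (this.congr (fun y _ => ?_)).congr_deriv (fun y _ => ?_)
    · unfold firstIntegral; ring
    · ring
  have hc : Tendsto (fun x => firstIntegral ε δ (Z x)) atTop (𝓝 0) := by
    have hcont : Continuous (firstIntegral ε δ) := by unfold firstIntegral; fun_prop
    have h := (hcont.tendsto Mplus).comp ht
    have h0 : firstIntegral ε δ Mplus = 0 := by simp [firstIntegral, Mplus]
    rwa [h0] at h
  have hmono := hd.monotoneOn (fun _ _ => le_rfl)
  have hanti := hd.antitoneOn (fun _ _ => le_rfl)
  refine tendsto_nhds_unique (tendsto_const_nhds.congr' ?_) hc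
  filter_upwards [eventually_ge_atTop x] with y hy
  exact le_antisymm (hmono hx (Set.mem_Ici.2 (hx.trans hy)) hy)
    (hanti hx (Set.mem_Ici.2 (hx.trans hy)) hy)

/-- Conservation of the first integral replaces any direct analysis of the slow second order
equation: up to the transverse energy, it is a first order law for B. -/
theorem sq_component_five (hZ : IsSolutionFrom ε δ 0 Z) (ht : Tendsto Z atTop (𝓝 Mplus))
    {x : ℝ} (hx : 0 ≤ x) :
    Z x 5 ^ 2 = ε ^ 2 * ((1 - Z x 4 ^ 2) ^ 2 / 2 + transverseEnergy δ (Z x)) := by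
  have := firstIntegral_eq_zero hZ ht hx
  rw [firstIntegral_eq] at this
  linarith

end Components

/-- The smallness conditions on the parameters `(ε, δ, X₀, b)` that are used below. -/
structure Regime (ε δ : ℝ) (X : Plane) (b : ℝ) : Prop where
  ε_pos : 0 < ε
  δ_ge : 1 / 3 ≤ δ
  δ_le : δ ≤ 1
  b_pos : 0 < b
  b_lt : b < 1
  one_lt : 1 < (1 + δ ^ 2) * b ^ 2
  -- The first bound separates the scales: the rate `deltaTilde δ b / 4` of A is much larger than
  -- the rate √2 ε of 1 - B. The second makes the squared coupling coefficients comparable to the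
  -- lower bound `deltaTilde δ b ^ 4` of Q. The third keeps the transverse energy far below (1 -
  -- b)².
  ε_le : 1000 * ε ≤ deltaTilde δ b
  X_le : ‖X‖ ≤ deltaTilde δ b ^ 2
  X_le' : 100000000 * ‖X‖ ≤ 1 - b

theorem deltaTilde_pos {δ b : ℝ} (h : 1 < (1 + δ ^ 2) * b ^ 2) : 0 < deltaTilde δ b :=
  Real.rpow_pos_of_pos (by linarith) _

theorem deltaTilde_pow_four {δ b : ℝ} (h : 1 < (1 + δ ^ 2) * b ^ 2) :
    deltaTilde δ b ^ 4 = (1 + δ ^ 2) * b ^ 2 - 1 := by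
  unfold deltaTilde
  rw [← Real.rpow_natCast, ← Real.rpow_mul (by linarith)]
  norm_num

namespace Regime

variable {ε δ b : ℝ} {X : Plane}

theorem d_pos (R : Regime ε δ X b) : 0 < deltaTilde δ b := deltaTilde_pos R.one_lt

theorem d_pow (R : Regime ε δ X b) : deltaTilde δ b ^ 4 = (1 + δ ^ 2) * b ^ 2 - 1 :=
  deltaTilde_pow_four R.one_lt

theorem δ_sq_le (R : Regime ε δ X b) : δ ^ 2 ≤ 1 := by
  have := R.δ_ge; have := R.δ_le
  nlinarith

theorem d_le (R : Regime ε δ X b) : deltaTilde δ b ≤ 1 := by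
  have h : deltaTilde δ b ^ 4 ≤ 1 := by
    rw [R.d_pow]
    have hb : b ^ 2 ≤ 1 := by have := R.b_lt; have := R.b_pos; nlinarith
    have := R.δ_sq_le
    nlinarith [sq_nonneg δ]
  exact (pow_le_one_iff_of_nonneg R.d_pos.le (by norm_num)).1 h

theorem half_le_b_sq (R : Regime ε δ X b) : 1 / 2 ≤ b ^ 2 := by
  have := R.one_lt
  have := R.δ_sq_le
  nlinarith [sq_nonneg b]

/-- Needed for the continuation in t along tX from the plane A = 0. -/
theorem smul (R : Regime ε δ X b) {t : ℝ} (h0 : 0 ≤ t) (h1 : t ≤ 1) : Regime ε δ (t • X) b := by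
  have h : ‖t • X‖ ≤ ‖X‖ := by
    rw [norm_smul, Real.norm_of_nonneg h0]
    exact mul_le_of_le_one_left (norm_nonneg _) h1
  exact { R with
    X_le := h.trans R.X_le
    X_le' := by have := R.X_le'; linarith }

end Regime

/-- The bounds on `B` under which the decay of `A` is controlled. -/
def Confined (δ b : ℝ) (Z : ℝ → Phase) : Prop :=
  -- The factor 1/4 and the upper bound 2 leave room: they hold for curves close to a known orbit
  -- before B' ≥ 0 or B ≤ 1 has been established for them.
  ∀ x, 0 ≤ x → deltaTilde δ b ^ 4 / 4 ≤ (1 + δ ^ 2) * Z x 4 ^ 2 - 1 ∧ 0 < Z x 4 ∧ Z x 4 ≤ 2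

section Estimates

variable {ε δ b b₁ : ℝ} {X Y : Plane} {Z : ℝ → Phase}

theorem ofCoords_components (h : Z 0 = ofCoords δ X Y b b₁) :
    Z 0 0 = X 0 + Y 0 ∧ Z 0 1 = -(deltaTilde δ b / √2) * (X 0 - Y 0 + X 1 - Y 1) ∧
    Z 0 2 = deltaTilde δ b ^ 2 * (X 1 + Y 1) ∧
    Z 0 3 = deltaTilde δ b ^ 3 / √2 * (X 0 - Y 0 - X 1 + Y 1) ∧ Z 0 4 = b ∧ Z 0 5 = b₁ := by
  rw [h]
  exact ⟨rfl, rfl, rfl, rfl, rfl, rfl⟩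

theorem fourth_order_form (hZ : IsSolutionFrom ε δ 0 Z) :
    HasDerivOnHalfLine (fun x => Z x 3)
      fun x => -((1 + δ ^ 2) * Z x 4 ^ 2 - 1 + Z x 0 ^ 2) * Z x 0 :=
  hZ.deriv_three.congr_deriv fun x _ => by ring

/-- Decay at infinity makes the boundary form nonnegative at 0, and this one-sided condition bounds
the unstable coordinates by the stable ones. -/
theorem norm_Y_le (R : Regime ε δ X b) (hZ : IsSolutionFrom ε δ 0 Z)
    (ht : Tendsto Z atTop (𝓝 Mplus)) (hc : Confined δ b Z) (h0 : Z 0 = ofCoords δ X Y b b₁) :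
    Y 0 ^ 2 + Y 1 ^ 2 ≤ 9 * (X 0 ^ 2 + X 1 ^ 2) := by
  obtain ⟨t0, t1, t2, t3⟩ := tendsto_A ht
  obtain ⟨e0, e1, e2, e3, -, -⟩ := ofCoords_components h0
  refine coords_sq_le R.d_pos e0 e1 e2 e3 ?_
  refine boundary_form_nonneg hZ.deriv_zero hZ.deriv_one hZ.deriv_two (fourth_order_form hZ)
    (fun x hx => ?_) t0 t1 t2 t3 le_rfl
  have := (hc x hx).1
  have := R.d_pos
  have : 0 < deltaTilde δ b ^ 4 / 4 := by positivity
  nlinarith [sq_nonneg (Z x 0)]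

end Estimates

end DomainWall

end

/-! ### Decay of A and the approximate first order law for B. -/

open Filter Topology Asymptotics

noncomputable section

namespace DomainWall

variable {ε δ b b₁ : ℝ} {X Y : Plane} {Z : ℝ → Phase}

theorem Confined.coeff_le (hc : Confined δ b Z) (hδ : δ ^ 2 ≤ 1) {x : ℝ} (hx : 0 ≤ x) :
    (1 + δ ^ 2) * Z x 4 ^ 2 ≤ 8 := by
  obtain ⟨-, c2, c3⟩ := hc x hx
  have hB : Z x 4 ^ 2 ≤ 2 ^ 2 := pow_le_pow_left₀ c2.le c3 2
  calc (1 + δ ^ 2) * Z x 4 ^ 2 ≤ 2 * 2 ^ 2 :=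
        mul_le_mul (by linarith) hB (sq_nonneg _) (by norm_num)
    _ = 8 := by norm_num

/-- Exponential decay of the `A`-part, with constants independent of the parameters. -/
theorem abs_A_le (R : Regime ε δ X b) (hZ : IsSolutionFrom ε δ 0 Z)
    (ht : Tendsto Z atTop (𝓝 Mplus)) (hc : Confined δ b Z) (h0 : Z 0 = ofCoords δ X Y b b₁)
    {x : ℝ} (hx : 0 ≤ x) :
    |Z x 0| ≤ 16 * (‖X‖ * Real.exp (-(deltaTilde δ b / 4 * x))) ∧
    |Z x 1| ≤ 16 * (‖X‖ * Real.exp (-(deltaTilde δ b / 4 * x))) ∧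
    |Z x 2| ≤ 30000 * (‖X‖ * Real.exp (-(deltaTilde δ b / 4 * x))) ∧
    |Z x 3| ≤ 30000 * (‖X‖ * Real.exp (-(deltaTilde δ b / 4 * x))) := by
  obtain ⟨t0, t1, t2, t3⟩ := tendsto_A ht
  obtain ⟨e0, e1, e2, e3, -, -⟩ := ofCoords_components h0
  set d := deltaTilde δ b with hd
  have d0 : 0 < d := R.d_pos
  have d1 : d ≤ 1 := R.d_le
  obtain ⟨-, -, hE⟩ := boundary_energy_le d0 (norm_nonneg X) e0 e1 e2 e3 (plane_norm_sq X).ge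
    (norm_Y_le R hZ ht hc h0)
  have hu : ∀ y, 0 ≤ ‖X‖ * Real.exp (-(d / 4 * y)) := fun y => by positivity
  have hu2 : ∀ y, (‖X‖ * Real.exp (-(d / 4 * y))) ^ 2 = ‖X‖ ^ 2 * Real.exp (-(d / 2 * y)) := by
    intro y
    rw [mul_pow, ← Real.exp_nat_mul]
    congr 2
    push_cast; ring
  have key : ∀ y, 0 ≤ y → |Z y 0| ≤ 16 * (‖X‖ * Real.exp (-(d / 4 * y))) ∧
      |Z y 1| ≤ 16 * (‖X‖ * Real.exp (-(d / 4 * y))) := by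
    intro y hy
    obtain ⟨k0, k1⟩ := sq_le_exp_of_fourth_order d0 hZ.deriv_zero hZ.deriv_one hZ.deriv_two
      (fourth_order_form hZ) (fun x hx => by
        have := (hc x hx).1
        nlinarith [sq_nonneg (Z x 0)]) t0 t1 t2 t3 hE hy
    have hW := hu2 y
    set W := ‖X‖ ^ 2 * Real.exp (-(d / 2 * y)) with hWdef
    have hW0 : 0 ≤ W := by positivity
    constructor
    · refine abs_le_of_sq_le_sq ?_ (by positivity)
      rw [mul_pow, hW]
      have h3 : 0 < d ^ 3 / 4 := by positivity
      -- Here 232 = 4 · 58, and below 116 = 2 · 58; both are less than 16². The powers of d cancel,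
      -- so the constants do not degenerate as d tends to 0.
      have : d ^ 3 / 4 * Z y 0 ^ 2 ≤ d ^ 3 / 4 * (232 * W) := by rw [hWdef]; linarith
      have := le_of_mul_le_mul_left this h3
      linarith
    · refine abs_le_of_sq_le_sq ?_ (by positivity)
      rw [mul_pow, hW]
      have h3 : 0 < d / 2 := by positivity
      have : d / 2 * Z y 1 ^ 2 ≤ d / 2 * (116 * d ^ 2 * W) := by rw [hWdef]; linarith
      have := le_of_mul_le_mul_left this h3
      have hd2 : d ^ 2 ≤ 1 := by nlinarith
      nlinarith [mul_nonneg (sub_nonneg.2 hd2) hW0]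
  obtain ⟨k0, k1⟩ := key x hx
  set u := ‖X‖ * Real.exp (-(d / 4 * x)) with hudef
  have hmono : ∀ y, x ≤ y → ‖X‖ * Real.exp (-(d / 4 * y)) ≤ u := fun y hy => by
    refine mul_le_mul_of_nonneg_left (Real.exp_le_exp.2 ?_) (norm_nonneg X)
    nlinarith
  have hX1 : ‖X‖ ≤ 1 := R.X_le.trans (by rw [← hd]; nlinarith)
  have hu1 : ∀ y, 0 ≤ y → ‖X‖ * Real.exp (-(d / 4 * y)) ≤ 1 := fun y hy => by
    have : Real.exp (-(d / 4 * y)) ≤ 1 := Real.exp_le_one_iff.2 (by nlinarith)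
    nlinarith [norm_nonneg X, Real.exp_pos (-(d / 4 * y))]
  have hS : ∀ t, x ≤ t → |Z t 1| ≤ 16 * u := fun t ht =>
    (key t (hx.trans ht)).2.trans (mul_le_mul_of_nonneg_left (hmono t ht) (by norm_num))
  -- 263 = 7 + 16² bounds |(1 + δ²)B² - 1 + A²|. Interpolation between A' and A'''' then gives at
  -- most (6 + 6 · 263) · 16 = 25344, below 30000.
  have hM : ∀ t, x ≤ t →
      |-((1 + δ ^ 2) * Z t 4 ^ 2 - 1 + Z t 0 ^ 2) * Z t 0| ≤ 263 * (16 * u) := by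
    intro t htx
    have ht0 := hx.trans htx
    obtain ⟨c1, c2, c3⟩ := hc t ht0
    have ha := (key t ht0).1
    have ha1 : |Z t 0| ≤ 16 := ha.trans (by linarith [hu1 t ht0])
    have ha2 : Z t 0 ^ 2 ≤ 256 := by
      rw [← sq_abs]
      calc |Z t 0| ^ 2 ≤ 16 ^ 2 := pow_le_pow_left₀ (abs_nonneg _) ha1 2
        _ = 256 := by norm_num
    have hq := hc.coeff_le R.δ_sq_le ht0
    have hpos : 0 < d ^ 4 / 4 := by positivity
    rw [abs_mul, abs_neg]
    refine mul_le_mul ?_ (ha.trans (mul_le_mul_of_nonneg_left (hmono t htx) (by norm_num)))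
      (abs_nonneg _) (by norm_num)
    rw [abs_le]
    constructor <;> linarith [sq_nonneg (Z t 0)]
  obtain ⟨m3, m2⟩ := abs_deriv_le_of_abs_le hZ.deriv_one hZ.deriv_two (fourth_order_form hZ) hx
    hS hM
  have hu0 : 0 ≤ u := hu x
  exact ⟨k0, k1, by linarith, by linarith⟩

/-- The transverse energy is quadratically small. -/
theorem abs_transverseEnergy_le (R : Regime ε δ X b) (hZ : IsSolutionFrom ε δ 0 Z)
    (ht : Tendsto Z atTop (𝓝 Mplus)) (hc : Confined δ b Z) (h0 : Z 0 = ofCoords δ X Y b b₁)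
    {x : ℝ} (hx : 0 ≤ x) :
    |transverseEnergy δ (Z x)| ≤
      (100000 * (‖X‖ * Real.exp (-(deltaTilde δ b / 4 * x)))) ^ 2 := by
  obtain ⟨k0, k1, k2, k3⟩ := abs_A_le R hZ ht hc h0 hx
  have d0 := R.d_pos
  set u := ‖X‖ * Real.exp (-(deltaTilde δ b / 4 * x)) with hudef
  have hu0 : 0 ≤ u := by positivity
  have hX1 : ‖X‖ ≤ 1 := R.X_le.trans (by have := R.d_le; nlinarith)
  have hu1 : u ≤ 1 := by
    have : Real.exp (-(deltaTilde δ b / 4 * x)) ≤ 1 := Real.exp_le_one_iff.2 (by nlinarith)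
    nlinarith [norm_nonneg X, Real.exp_pos (-(deltaTilde δ b / 4 * x))]
  obtain ⟨c1, c2, c3⟩ := hc x hx
  have s0 : Z x 0 ^ 2 ≤ 256 * u ^ 2 := by
    rw [← sq_abs]
    calc |Z x 0| ^ 2 ≤ (16 * u) ^ 2 := pow_le_pow_left₀ (abs_nonneg _) k0 2
      _ = 256 * u ^ 2 := by ring
  have s2 : Z x 2 ^ 2 ≤ 900000000 * u ^ 2 := by
    rw [← sq_abs]
    calc |Z x 2| ^ 2 ≤ (30000 * u) ^ 2 := pow_le_pow_left₀ (abs_nonneg _) k2 2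
      _ = 900000000 * u ^ 2 := by ring
  have s13 : |Z x 1 * Z x 3| ≤ 480000 * u ^ 2 := by
    rw [abs_mul]
    calc |Z x 1| * |Z x 3| ≤ 16 * u * (30000 * u) :=
          mul_le_mul k1 k3 (abs_nonneg _) (by positivity)
      _ = 480000 * u ^ 2 := by ring
  have s13' := abs_le.1 s13
  have hq := hc.coeff_le R.δ_sq_le hx
  have hpos : 0 < deltaTilde δ b ^ 4 / 4 := by positivity
  have q0 : 0 ≤ ((1 + δ ^ 2) * Z x 4 ^ 2 - 1) * Z x 0 ^ 2 :=
    mul_nonneg (by linarith) (sq_nonneg _)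
  have q1 : ((1 + δ ^ 2) * Z x 4 ^ 2 - 1) * Z x 0 ^ 2 ≤ 7 * (256 * u ^ 2) :=
    mul_le_mul (by linarith) s0 (sq_nonneg _) (by norm_num)
  have q4 : Z x 0 ^ 4 ≤ 256 * 256 * u ^ 2 := by
    have : u ^ 2 ≤ 1 := by nlinarith
    have h4 : Z x 0 ^ 4 = Z x 0 ^ 2 * Z x 0 ^ 2 := by ring
    rw [h4]
    calc Z x 0 ^ 2 * Z x 0 ^ 2 ≤ 256 * u ^ 2 * (256 * 1) :=
          mul_le_mul s0 (s0.trans (by linarith)) (sq_nonneg _) (by positivity)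
      _ = 256 * 256 * u ^ 2 := by ring
  have q4' : 0 ≤ Z x 0 ^ 4 := by positivity
  unfold transverseEnergy
  rw [abs_le]
  constructor <;> linarith [sq_nonneg u, sq_nonneg (Z x 2)]

/-- `B₁` is close to `ε (1 - B²) / √2`. -/
theorem abs_B₁_sub_le (R : Regime ε δ X b) (hZ : IsSolutionFrom ε δ 0 Z)
    (ht : Tendsto Z atTop (𝓝 Mplus)) (hc : Confined δ b Z) (h0 : Z 0 = ofCoords δ X Y b b₁)
    {x : ℝ} (hx : 0 ≤ x) (h4 : Z x 4 ≤ 1) (h5 : 0 ≤ Z x 5) :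
    |Z x 5 - ε * ((1 - Z x 4 ^ 2) / √2)| ≤
      ε * (100000 * (‖X‖ * Real.exp (-(deltaTilde δ b / 4 * x)))) := by
  have hq := abs_le.1 (abs_transverseEnergy_le R hZ ht hc h0 hx)
  have hs := sq_component_five hZ ht hx
  have ε0 := R.ε_pos
  set u := 100000 * (‖X‖ * Real.exp (-(deltaTilde δ b / 4 * x))) with hu
  have hu0 : 0 ≤ u := by positivity
  have hB0 := (hc x hx).2.1
  set q := ε * ((1 - Z x 4 ^ 2) / √2) with hqd
  have hq0 : 0 ≤ q := by
    have : 0 ≤ 1 - Z x 4 ^ 2 := by nlinarith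
    positivity
  have hq2 : q ^ 2 = ε ^ 2 * ((1 - Z x 4 ^ 2) ^ 2 / 2) := by
    rw [hqd, mul_pow, div_pow, Real.sq_sqrt (by norm_num)]
  have hdiff : |Z x 5 ^ 2 - q ^ 2| ≤ (ε * u) ^ 2 := by
    rw [hs, hq2, mul_pow, abs_le]
    have := sq_nonneg ε
    constructor <;> nlinarith
  -- For nonnegative numbers |B' - q|² ≤ |B'² - q²|. This bounds the defect without dividing by q,
  -- which becomes exponentially small.
  have h1 : |Z x 5 - q| ≤ |Z x 5 + q| := by
    rw [abs_of_nonneg (add_nonneg h5 hq0), abs_le]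
    constructor <;> linarith
  have h2 : |Z x 5 - q| ^ 2 ≤ (ε * u) ^ 2 := by
    refine le_trans ?_ hdiff
    have : Z x 5 ^ 2 - q ^ 2 = (Z x 5 - q) * (Z x 5 + q) := by ring
    rw [this, abs_mul, pow_two]
    exact mul_le_mul_of_nonneg_left h1 (abs_nonneg _)
  exact (pow_le_pow_iff_left₀ (abs_nonneg _) (by positivity) two_ne_zero).1 h2

/-- While `B' ≥ 0` and `B ≤ 1`, the quantity `(1 - B) / (1 + B)` is comparable to
`e^{-√2 ε x}`. -/
theorem ratio_bounds (R : Regime ε δ X b) (hZ : IsSolutionFrom ε δ 0 Z)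
    (ht : Tendsto Z atTop (𝓝 Mplus)) (hc : Confined δ b Z) (h0 : Z 0 = ofCoords δ X Y b b₁)
    {T : ℝ} (hT : 0 ≤ T) (h : ∀ x, 0 ≤ x → x < T → 0 ≤ Z x 5 ∧ Z x 4 ≤ 1) :
    (1 - b) / 4 ≤ (1 - Z T 4) / (1 + Z T 4) * Real.exp (√2 * ε * T) ∧
      (1 - Z T 4) / (1 + Z T 4) * Real.exp (√2 * ε * T) ≤ 2 * (1 - b) := by
  have ε0 := R.ε_pos
  have d0 := R.d_pos
  have hb4 : Z 0 4 = b := (ofCoords_components h0).2.2.2.2.1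
  have hs2 : √2 ^ 2 = 2 := Real.sq_sqrt (by norm_num)
  have hs0 : 0 < √2 := by positivity
  have hs3 : √2 ≤ 3 / 2 := by nlinarith
  set d := deltaTilde δ b with hd
  have hεd := R.ε_le
  set K := 200000 * (ε * ‖X‖) with hK
  have hK0 : 0 ≤ K := by positivity
  have hpos : ∀ x, 0 ≤ x → 0 < 1 + Z x 4 := fun x hx => by linarith [(hc x hx).2.1]
  -- Under the exact law B' = ε(1 - B²)/√2 the function f is constant; in general f' is the defect
  -- of this law times a bounded factor and e^{√2 ε x}. The defect decays at rate d/4, of which √2 ε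
  -- ≤ d/8 is lost.
  set f : ℝ → ℝ := fun x => (1 - Z x 4) / (1 + Z x 4) * Real.exp (√2 * ε * x) with hf
  set f' : ℝ → ℝ := fun x => (-2 / (1 + Z x 4) ^ 2 * (Z x 5 - ε * ((1 - Z x 4 ^ 2) / √2)))
    * Real.exp (√2 * ε * x) with hf'
  have df : HasDerivOnHalfLine f f' := by
    have hw : HasDerivOnHalfLine (fun x => (1 - Z x 4) / (1 + Z x 4))
        (fun x => -2 * Z x 5 / (1 + Z x 4) ^ 2) := by
      intro x hx
      have h1 := (hZ.deriv_four x hx).const_sub 1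
      have h2 := (hZ.deriv_four x hx).const_add 1
      have := h1.div h2 (hpos x hx).ne'
      convert! this using 1
      ring
    refine (hw.mul (HasDerivOnHalfLine.exp_mul (√2 * ε))).congr_deriv fun x hx => ?_
    have := (hpos x hx).ne'
    simp only [hf']
    field_simp
    ring_nf
    rw [hs2]; ring
  have hf'le : ∀ x, 0 ≤ x → x < T → |f' x| ≤ K * Real.exp (-(d / 8) * x) := by
    intro x hx hxT
    obtain ⟨h5, h4⟩ := h x hx hxT
    have h1 := abs_B₁_sub_le R hZ ht hc h0 hx h4 h5
    simp only [hf']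
    rw [abs_mul, abs_mul, abs_of_pos (Real.exp_pos _)]
    have h2 : |-2 / (1 + Z x 4) ^ 2| ≤ 2 := by
      rw [abs_div, abs_of_pos (a := (1 + Z x 4) ^ 2) (by have := hpos x hx; positivity)]
      rw [div_le_iff₀ (by have := hpos x hx; positivity)]
      have := (hc x hx).2.1
      rw [abs_neg, abs_of_pos (by norm_num : (0 : ℝ) < 2)]
      nlinarith
    calc |-2 / (1 + Z x 4) ^ 2| * |Z x 5 - ε * ((1 - Z x 4 ^ 2) / √2)| * Real.exp (√2 * ε * x)
        ≤ 2 * (ε * (100000 * (‖X‖ * Real.exp (-(d / 4 * x))))) * Real.exp (√2 * ε * x) := by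
          gcongr
      _ = K * (Real.exp (-(d / 4 * x)) * Real.exp (√2 * ε * x)) := by rw [hK]; ring
      _ ≤ K * Real.exp (-(d / 8) * x) := by
          rw [← Real.exp_add]
          refine mul_le_mul_of_nonneg_left (Real.exp_le_exp.2 ?_) hK0
          have : √2 * ε ≤ d / 8 := by nlinarith
          nlinarith
  -- The function c e^{-dx/8} has derivative -K e^{-dx/8}, so f minus it increases and f plus it
  -- decreases on [0, T]. Hence f varies by at most c, which is negligible against f(0) ≥ (1 - b)/2.
  set c := K / (d / 8) with hcdef
  have hcd : c * (d / 8) = K := by rw [hcdef]; field_simp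
  have hc0 : 0 ≤ c := by positivity
  have hcle : c ≤ (1 - b) / 100 := by
    rw [hcdef, div_le_iff₀ (by positivity), hK]
    have h1 := R.X_le'
    have h2 := norm_nonneg X
    have h3 : ε * ‖X‖ ≤ d / 1000 * ((1 - b) / 100000000) :=
      mul_le_mul (by linarith) (by linarith) h2 (by positivity)
    have h4 : 0 < (1 - b) := by linarith [R.b_lt]
    nlinarith [mul_pos d0 h4]
  have dexp := (HasDerivOnHalfLine.exp_mul (-(d / 8))).const_mul c
  have hlow := (df.sub dexp).monotoneOn_Icc (T := T) (fun x hx hxT => by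
    have := (abs_le.1 (hf'le x hx.le hxT)).1
    have h2 : c * (-(d / 8) * Real.exp (-(d / 8) * x)) = -(K * Real.exp (-(d / 8) * x)) := by
      rw [← hcd]; ring
    rw [h2]; linarith) ⟨le_rfl, hT⟩ ⟨hT, le_rfl⟩ hT
  have hup := ((df.add dexp).neg).monotoneOn_Icc (T := T) (fun x hx hxT => by
    have := (abs_le.1 (hf'le x hx.le hxT)).2
    have h2 : c * (-(d / 8) * Real.exp (-(d / 8) * x)) = -(K * Real.exp (-(d / 8) * x)) := by
      rw [← hcd]; ring
    rw [h2]; linarith) ⟨le_rfl, hT⟩ ⟨hT, le_rfl⟩ hT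
  simp only [mul_zero, Real.exp_zero, mul_one] at hlow hup
  have hexp : 0 < Real.exp (-(d / 8) * T) := Real.exp_pos _
  have hexp' : 0 ≤ c * Real.exp (-(d / 8) * T) := by positivity
  have hf0 : f 0 = (1 - b) / (1 + b) := by simp [hf, hb4]
  have hb0 := R.b_pos
  have hb1 := R.b_lt
  have hf0l : (1 - b) / 2 ≤ f 0 := by
    rw [hf0, div_le_div_iff₀ (by norm_num) (by linarith)]; nlinarith
  have hf0u : f 0 ≤ 1 - b := by
    rw [hf0, div_le_iff₀ (by linarith)]; nlinarith
  change (1 - b) / 4 ≤ f T ∧ f T ≤ 2 * (1 - b)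
  constructor <;> linarith

end DomainWall

end

/-! ### Positivity of B', two-sided bounds for B, and good orbits. -/

open Filter Topology Asymptotics

noncomputable section

namespace DomainWall

variable {ε δ b b₁ : ℝ} {X Y : Plane} {Z : ℝ → Phase}

/-- The A-part is small compared with 1 - b at the start and decays faster than the slow part, so it
is negligible at every abscissa. The factor 1/1000 comes from the third smallness condition of
`Regime`. -/
theorem exp_comparison (R : Regime ε δ X b) {x : ℝ} (hx : 0 ≤ x) :
    100000 * (‖X‖ * Real.exp (-(deltaTilde δ b / 4 * x))) ≤
      (1 - b) / 1000 * Real.exp (-(√2 * ε * x)) := by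
  have hs2 : √2 ^ 2 = 2 := Real.sq_sqrt (by norm_num)
  have hs0 : 0 < √2 := by positivity
  have hs3 : √2 ≤ 3 / 2 := by nlinarith
  have h1 : Real.exp (-(deltaTilde δ b / 4 * x)) ≤ Real.exp (-(√2 * ε * x)) := by
    refine Real.exp_le_exp.2 (neg_le_neg ?_)
    refine mul_le_mul_of_nonneg_right ?_ hx
    have := R.ε_le
    have := R.ε_pos
    nlinarith
  have h2 := R.X_le'
  rw [← mul_assoc]
  exact mul_le_mul (by linarith) h1 (Real.exp_pos _).le (by linarith [R.b_lt])

theorem transverseEnergy_ge (R : Regime ε δ X b) (hZ : IsSolutionFrom ε δ 0 Z)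
    (ht : Tendsto Z atTop (𝓝 Mplus)) (hc : Confined δ b Z) (h0 : Z 0 = ofCoords δ X Y b b₁)
    {x : ℝ} (hx : 0 ≤ x) :
    -((1 - b) / 1000 * Real.exp (-(√2 * ε * x))) ^ 2 ≤ transverseEnergy δ (Z x) := by
  have h1 := (abs_le.1 (abs_transverseEnergy_le R hZ ht hc h0 hx)).1
  have h2 : (100000 * (‖X‖ * Real.exp (-(deltaTilde δ b / 4 * x)))) ^ 2 ≤
      ((1 - b) / 1000 * Real.exp (-(√2 * ε * x))) ^ 2 :=
    pow_le_pow_left₀ (by positivity) (exp_comparison R hx) 2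
  linarith

/-- An orbit of the stable manifold that starts with `B' > 0` keeps `B' > 0` and `B < 1`. -/
theorem B₁_pos (R : Regime ε δ X b) (hZ : IsSolutionFrom ε δ 0 Z)
    (ht : Tendsto Z atTop (𝓝 Mplus)) (hc : Confined δ b Z) (h0 : Z 0 = ofCoords δ X Y b b₁)
    (hb₁ : 0 < b₁) {x : ℝ} (hx : 0 ≤ x) : 0 < Z x 5 ∧ Z x 4 < 1 := by
  have hb4 : Z 0 4 = b := (ofCoords_components h0).2.2.2.2.1
  have hb5 : Z 0 5 = b₁ := (ofCoords_components h0).2.2.2.2.2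
  have c4 := hZ.deriv_four.continuousOn
  have c5 := hZ.deriv_five.continuousOn
  have ε0 := R.ε_pos
  have hφ : ContinuousOn (fun x => min (Z x 5) (1 - Z x 4)) (Set.Ici 0) :=
    c5.inf (continuousOn_const.sub c4)
  -- Up to a first zero T of min(B', 1 - B), `ratio_bounds` applies and keeps 1 - B(T) above (1 -
  -- b)/4 · e^{-√2 ε T}. The transverse energy is at least minus the square of (1 - b)/1000 times
  -- the same exponential, so the energy identity forces B'(T)² > 0: no first zero exists.
  have key := pos_of_first_exit hφ
    (by simp only [hb4, hb5]; exact lt_min hb₁ (by linarith [R.b_lt]))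
    (fun T hT h => by
      have hT' : ∀ x, 0 ≤ x → x < T → 0 ≤ Z x 5 ∧ Z x 4 ≤ 1 := fun x hx hxT => by
        obtain ⟨h1, h2⟩ := lt_min_iff.1 (h x hx hxT)
        exact ⟨h1.le, by linarith⟩
      have hr := (ratio_bounds R hZ ht hc h0 hT.le hT').1
      have hB := (hc T hT.le).2.1
      have hb : 0 < 1 - b := by linarith [R.b_lt]
      have hr' : (1 - b) / 4 * Real.exp (-(√2 * ε * T)) ≤ (1 - Z T 4) / (1 + Z T 4) := by
        rw [Real.exp_neg, ← div_eq_mul_inv, div_le_iff₀ (Real.exp_pos _)]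
        exact hr
      have hE := Real.exp_pos (-(√2 * ε * T))
      have hw : (1 - b) / 4 * Real.exp (-(√2 * ε * T)) ≤ 1 - Z T 4 := by
        rw [le_div_iff₀ (by linarith)] at hr'
        have : 0 < (1 - b) / 4 * Real.exp (-(√2 * ε * T)) := by positivity
        nlinarith
      have hB1 : Z T 4 < 1 := by
        have : 0 < (1 - b) / 4 * Real.exp (-(√2 * ε * T)) := by positivity
        linarith
      have h5 : 0 ≤ Z T 5 := by
        by_contra hneg
        push Not at hneg
        have hcont : ContinuousWithinAt (fun x => Z x 5) (Set.Icc 0 T) T :=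
          (c5 T hT.le).mono Set.Icc_subset_Ici_self
        have hev := hcont.eventually (gt_mem_nhds hneg)
        rw [eventually_nhdsWithin_iff, Metric.eventually_nhds_iff] at hev
        obtain ⟨r, hr0, hr⟩ := hev
        have hm : 0 ≤ max 0 (T - r / 2) := le_max_left _ _
        have hmT : max 0 (T - r / 2) < T := max_lt hT (by linarith)
        have := hr (y := max 0 (T - r / 2)) (by
          rw [Real.dist_eq, abs_lt]
          constructor
          · linarith [le_max_right 0 (T - r / 2)]
          · linarith) ⟨hm, hmT.le⟩
        exact absurd (hT' _ hm hmT).1 (not_le.2 this)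
      have hsq := sq_component_five hZ ht hT.le
      have hTE := transverseEnergy_ge R hZ ht hc h0 hT.le
      have hpos : 0 < Z T 5 ^ 2 := by
        rw [hsq]
        refine mul_pos (by positivity) ?_
        have h1 : ((1 - b) / 4 * Real.exp (-(√2 * ε * T))) ^ 2 ≤ (1 - Z T 4 ^ 2) ^ 2 :=
          pow_le_pow_left₀ (by positivity) (by nlinarith) 2
        have h2 : 0 < ((1 - b) * Real.exp (-(√2 * ε * T))) ^ 2 := by positivity
        nlinarith
      refine lt_min (lt_of_le_of_ne h5 fun h => ?_) (by linarith)
      rw [← h] at hpos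
      norm_num at hpos) hx
  obtain ⟨h1, h2⟩ := lt_min_iff.1 key
  exact ⟨h1, by linarith⟩

/-- Two-sided exponential bounds of `1 - B` and `B'`. -/
theorem B_bounds (R : Regime ε δ X b) (hZ : IsSolutionFrom ε δ 0 Z)
    (ht : Tendsto Z atTop (𝓝 Mplus)) (hc : Confined δ b Z) (h0 : Z 0 = ofCoords δ X Y b b₁)
    (hb₁ : 0 < b₁) {x : ℝ} (hx : 0 ≤ x) :
    ((1 - b) / 4 * Real.exp (-(√2 * ε * x)) ≤ 1 - Z x 4 ∧
      1 - Z x 4 ≤ 4 * (1 - b) * Real.exp (-(√2 * ε * x))) ∧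
    (ε * ((1 - b) / 10 * Real.exp (-(√2 * ε * x))) ≤ Z x 5 ∧
      Z x 5 ≤ ε * (9 * (1 - b) * Real.exp (-(√2 * ε * x)))) := by
  have hs2 : √2 ^ 2 = 2 := Real.sq_sqrt (by norm_num)
  have hs0 : 0 < √2 := by positivity
  have hs3 : √2 ≤ 3 / 2 := by nlinarith
  have hs1 : 1 ≤ √2 := by nlinarith
  have ε0 := R.ε_pos
  obtain ⟨h5, h4⟩ := B₁_pos R hZ ht hc h0 hb₁ hx
  obtain ⟨r1, r2⟩ := ratio_bounds R hZ ht hc h0 hx fun y hy _ =>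
    ⟨(B₁_pos R hZ ht hc h0 hb₁ hy).1.le, (B₁_pos R hZ ht hc h0 hb₁ hy).2.le⟩
  have hB := (hc x hx).2.1
  have hb : 0 < 1 - b := by linarith [R.b_lt]
  have hE0 := Real.exp_pos (-(√2 * ε * x))
  have hinv : Real.exp (√2 * ε * x) = (Real.exp (-(√2 * ε * x)))⁻¹ := by
    rw [Real.exp_neg, inv_inv]
  rw [hinv, ← div_eq_mul_inv, le_div_iff₀ hE0] at r1
  rw [hinv, ← div_eq_mul_inv, div_le_iff₀ hE0] at r2
  rw [le_div_iff₀ (by linarith)] at r1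
  rw [div_le_iff₀ (by linarith)] at r2
  have hd := abs_le.1 (abs_B₁_sub_le R hZ ht hc h0 hx h4.le h5.le)
  have hcmp := mul_le_mul_of_nonneg_left (exp_comparison R hx) ε0.le
  set e := Real.exp (-(√2 * ε * x)) with he
  have hbe : 0 < (1 - b) * e := by positivity
  have hlow : (1 - b) / 4 * e ≤ 1 - Z x 4 := by nlinarith
  have hup : 1 - Z x 4 ≤ 4 * (1 - b) * e := by nlinarith
  refine ⟨⟨hlow, hup⟩, ?_, ?_⟩
  · have h1 : (1 - b) / 4 * e * (2 / 3) ≤ (1 - Z x 4 ^ 2) / √2 := by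
      rw [le_div_iff₀ hs0]
      nlinarith
    have h2 := mul_le_mul_of_nonneg_left h1 ε0.le
    have h3 : 0 < ε * ((1 - b) * e) := by positivity
    nlinarith
  · have h1 : (1 - Z x 4 ^ 2) / √2 ≤ 8 * ((1 - b) * e) := by
      rw [div_le_iff₀ hs0]
      nlinarith
    have h2 := mul_le_mul_of_nonneg_left h1 ε0.le
    have h3 : 0 < ε * ((1 - b) * e) := by positivity
    nlinarith

/-- An orbit in the part of the stable manifold that lies in `𝒲_{ε,δ}`, over the parameters
`(X, b)`. -/
structure GoodOrbit (ε δ : ℝ) (X : Plane) (b : ℝ) (Z : ℝ → Phase) : Prop where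
  sol : IsSolutionFrom ε δ 0 Z
  tends : Tendsto Z atTop (𝓝 Mplus)
  nonneg : ∀ x, 0 ≤ x → 0 ≤ Z x 5
  start : ∃ (Y : Plane) (b₁ : ℝ), Z 0 = ofCoords δ X Y b b₁

namespace GoodOrbit

theorem start_four (G : GoodOrbit ε δ X b Z) : Z 0 4 = b := by
  obtain ⟨Y, b₁, h⟩ := G.start
  exact (ofCoords_components h).2.2.2.2.1

theorem le_B (G : GoodOrbit ε δ X b Z) {x : ℝ} (hx : 0 ≤ x) : b ≤ Z x 4 := by
  rw [← G.start_four]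
  exact G.sol.deriv_four.monotoneOn (fun y hy => G.nonneg y hy.le) Set.self_mem_Ici hx hx

theorem B_le (G : GoodOrbit ε δ X b Z) {x : ℝ} (hx : 0 ≤ x) : Z x 4 ≤ 1 := by
  refine ge_of_tendsto (tendsto_B G.tends).1 ?_
  filter_upwards [eventually_ge_atTop x] with y hy
  exact G.sol.deriv_four.monotoneOn (fun y hy => G.nonneg y hy.le) hx (hx.trans hy) hy

theorem coeff_ge (R : Regime ε δ X b) (G : GoodOrbit ε δ X b Z) {x : ℝ} (hx : 0 ≤ x) :
    deltaTilde δ b ^ 4 ≤ (1 + δ ^ 2) * Z x 4 ^ 2 - 1 := by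
  rw [R.d_pow]
  have : b ^ 2 ≤ Z x 4 ^ 2 := pow_le_pow_left₀ R.b_pos.le (G.le_B hx) 2
  nlinarith [sq_nonneg δ]

theorem confined (R : Regime ε δ X b) (G : GoodOrbit ε δ X b Z) : Confined δ b Z := by
  intro x hx
  have h1 := G.coeff_ge R hx
  have h2 := R.d_pos
  have h3 : 0 < deltaTilde δ b ^ 4 := by positivity
  exact ⟨by linarith, R.b_pos.trans_le (G.le_B hx), (G.B_le hx).trans (by norm_num)⟩

/-- Membership in the manifold only gives B' ≥ 0; strictness at the start is the energy identity,
where the transverse energy cannot cancel (1 - b²)²/2. -/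
theorem pos (R : Regime ε δ X b) (G : GoodOrbit ε δ X b Z) : 0 < Z 0 5 := by
  obtain ⟨Y, b₁, h0⟩ := G.start
  have hsq := sq_component_five G.sol G.tends le_rfl
  have hTE := transverseEnergy_ge R G.sol G.tends (G.confined R) h0 le_rfl
  have ε0 := R.ε_pos
  have hb : 0 < 1 - b := by linarith [R.b_lt]
  have hb0 := R.b_pos
  have hpos : 0 < Z 0 5 ^ 2 := by
    rw [hsq, G.start_four]
    refine mul_pos (by positivity) ?_
    simp only [mul_zero, neg_zero, Real.exp_zero, mul_one] at hTE
    have h1 : (1 - b) ^ 2 ≤ (1 - b ^ 2) ^ 2 := pow_le_pow_left₀ hb.le (by nlinarith) 2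
    have h2 : 0 < (1 - b) ^ 2 := by positivity
    nlinarith
  refine lt_of_le_of_ne (G.nonneg 0 le_rfl) fun h => ?_
  rw [← h] at hpos
  norm_num at hpos

theorem mem_energyManifold (G : GoodOrbit ε δ X b Z) {x : ℝ} (hx : 0 ≤ x) :
    Z x ∈ energyManifold ε δ :=
  ⟨firstIntegral_eq_zero G.sol G.tends hx, G.nonneg x hx⟩

theorem B₁_pos (R : Regime ε δ X b) (G : GoodOrbit ε δ X b Z) {x : ℝ} (hx : 0 ≤ x) :
    0 < Z x 5 := by
  obtain ⟨Y, b₁, h0⟩ := G.start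
  exact (DomainWall.B₁_pos R G.sol G.tends (G.confined R) h0
    ((ofCoords_components h0).2.2.2.2.2 ▸ G.pos R) hx).1

theorem bounds (R : Regime ε δ X b) (G : GoodOrbit ε δ X b Z) {x : ℝ} (hx : 0 ≤ x) :
    ((1 - b) / 4 * Real.exp (-(√2 * ε * x)) ≤ 1 - Z x 4 ∧
      1 - Z x 4 ≤ 4 * (1 - b) * Real.exp (-(√2 * ε * x))) ∧
    (ε * ((1 - b) / 10 * Real.exp (-(√2 * ε * x))) ≤ Z x 5 ∧
      Z x 5 ≤ ε * (9 * (1 - b) * Real.exp (-(√2 * ε * x)))) := by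
  obtain ⟨Y, b₁, h0⟩ := G.start
  exact B_bounds R G.sol G.tends (G.confined R) h0
    ((ofCoords_components h0).2.2.2.2.2 ▸ G.pos R) hx

theorem A_bounds (R : Regime ε δ X b) (G : GoodOrbit ε δ X b Z) {x : ℝ} (hx : 0 ≤ x) :
    |Z x 0| ≤ 16 * (‖X‖ * Real.exp (-(deltaTilde δ b / 4 * x))) ∧
    |Z x 1| ≤ 16 * (‖X‖ * Real.exp (-(deltaTilde δ b / 4 * x))) ∧
    |Z x 2| ≤ 30000 * (‖X‖ * Real.exp (-(deltaTilde δ b / 4 * x))) ∧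
    |Z x 3| ≤ 30000 * (‖X‖ * Real.exp (-(deltaTilde δ b / 4 * x))) := by
  obtain ⟨Y, b₁, h0⟩ := G.start
  exact abs_A_le R G.sol G.tends (G.confined R) h0 hx

theorem isTheta_B (R : Regime ε δ X b) (G : GoodOrbit ε δ X b Z) :
    (fun x => 1 - Z x 4) =Θ[atTop] fun x => Real.exp (-(√2 * ε * x)) := by
  have hb : 0 < 1 - b := by linarith [R.b_lt]
  constructor
  · refine IsBigO.of_bound (4 * (1 - b)) ?_
    filter_upwards [eventually_ge_atTop 0] with x hx
    obtain ⟨⟨h1, h2⟩, -⟩ := G.bounds R hx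
    rw [Real.norm_of_nonneg (le_trans (by positivity) h1), Real.norm_of_nonneg (by positivity)]
    exact h2
  · refine IsBigO.of_bound (4 / (1 - b)) ?_
    filter_upwards [eventually_ge_atTop 0] with x hx
    obtain ⟨⟨h1, h2⟩, -⟩ := G.bounds R hx
    rw [Real.norm_of_nonneg (le_trans (by positivity) h1), Real.norm_of_nonneg (by positivity),
      div_mul_eq_mul_div, le_div_iff₀ hb]
    linarith

theorem isTheta_B₁ (R : Regime ε δ X b) (G : GoodOrbit ε δ X b Z) :
    (fun x => Z x 5) =Θ[atTop] fun x => Real.exp (-(√2 * ε * x)) := by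
  have hb : 0 < 1 - b := by linarith [R.b_lt]
  have ε0 := R.ε_pos
  constructor
  · refine IsBigO.of_bound (ε * (9 * (1 - b))) ?_
    filter_upwards [eventually_ge_atTop 0] with x hx
    obtain ⟨-, h1, h2⟩ := G.bounds R hx
    rw [Real.norm_of_nonneg (le_trans (by positivity) h1), Real.norm_of_nonneg (by positivity)]
    linarith
  · refine IsBigO.of_bound (10 / (ε * (1 - b))) ?_
    filter_upwards [eventually_ge_atTop 0] with x hx
    obtain ⟨-, h1, h2⟩ := G.bounds R hx
    rw [Real.norm_of_nonneg (le_trans (by positivity) h1), Real.norm_of_nonneg (by positivity),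
      div_mul_eq_mul_div, le_div_iff₀ (by positivity)]
    linarith

end GoodOrbit

end DomainWall

end

/-! ### Uniqueness of good orbits and the sharp decay rate of A. -/

open Filter Topology Asymptotics

noncomputable section

namespace DomainWall

variable {ε δ b b₁ : ℝ} {X Y : Plane} {Z : ℝ → Phase}

/-- The coordinates `(x₁, x₂, y₁, y₂)` of `(A₀, A₁, A₂, A₃)` with respect to `d`. -/
def coordX₁ (d A₀ A₁ A₃ : ℝ) : ℝ := (A₀ + (A₃ / d ^ 3 - A₁ / d) / √2) / 2

/-- See `coordX₁`. -/
def coordX₂ (d A₁ A₂ A₃ : ℝ) : ℝ := (A₂ / d ^ 2 - (A₁ / d + A₃ / d ^ 3) / √2) / 2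

/-- See `coordX₁`. -/
def coordY₁ (d A₀ A₁ A₃ : ℝ) : ℝ := (A₀ - (A₃ / d ^ 3 - A₁ / d) / √2) / 2

/-- See `coordX₁`. -/
def coordY₂ (d A₁ A₂ A₃ : ℝ) : ℝ := (A₂ / d ^ 2 + (A₁ / d + A₃ / d ^ 3) / √2) / 2

/-- The scale d is left free because two frames occur: `deltaTilde δ b` at the starting point and
√δ, the frame of the limit equation at M₊. -/
theorem coords_spec {d : ℝ} (hd : 0 < d) (A₀ A₁ A₂ A₃ : ℝ) :
    A₀ = coordX₁ d A₀ A₁ A₃ + coordY₁ d A₀ A₁ A₃ ∧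
    A₁ = -(d / √2) * (coordX₁ d A₀ A₁ A₃ - coordY₁ d A₀ A₁ A₃
      + coordX₂ d A₁ A₂ A₃ - coordY₂ d A₁ A₂ A₃) ∧
    A₂ = d ^ 2 * (coordX₂ d A₁ A₂ A₃ + coordY₂ d A₁ A₂ A₃) ∧
    A₃ = d ^ 3 / √2 * (coordX₁ d A₀ A₁ A₃ - coordY₁ d A₀ A₁ A₃
      - coordX₂ d A₁ A₂ A₃ + coordY₂ d A₁ A₂ A₃) := by
  have hs2 : √2 ^ 2 = 2 := Real.sq_sqrt (by norm_num)
  have hs0 : √2 ≠ 0 := by positivity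
  unfold coordX₁ coordX₂ coordY₁ coordY₂
  refine ⟨by ring, ?_, by field_simp; ring, ?_⟩
  · field_simp; rw [hs2]; ring
  · field_simp; rw [hs2]; ring

theorem coords_ofCoords {d x₁ x₂ y₁ y₂ A₀ A₁ A₂ A₃ : ℝ} (hd : 0 < d) (h₀ : A₀ = x₁ + y₁)
    (h₁ : A₁ = -(d / √2) * (x₁ - y₁ + x₂ - y₂)) (h₂ : A₂ = d ^ 2 * (x₂ + y₂))
    (h₃ : A₃ = d ^ 3 / √2 * (x₁ - y₁ - x₂ + y₂)) :
    coordX₁ d A₀ A₁ A₃ = x₁ ∧ coordX₂ d A₁ A₂ A₃ = x₂ ∧ coordY₁ d A₀ A₁ A₃ = y₁ ∧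
      coordY₂ d A₁ A₂ A₃ = y₂ := by
  have hs2 : √2 ^ 2 = 2 := Real.sq_sqrt (by norm_num)
  have hs0 : √2 ≠ 0 := by positivity
  subst h₀ h₁ h₂ h₃
  unfold coordX₁ coordX₂ coordY₁ coordY₂
  refine ⟨?_, ?_, ?_, ?_⟩ <;> · field_simp; rw [hs2]; ring

theorem ofCoords_injective {Y Y' : Plane} {b₁' : ℝ} (hd : 0 < deltaTilde δ b)
    (h : ofCoords δ X Y b b₁ = ofCoords δ X Y' b b₁') : Y = Y' ∧ b₁ = b₁' := by
  obtain ⟨-, -, u1, u2⟩ := coords_ofCoords (d := deltaTilde δ b) (x₁ := X 0) (x₂ := X 1)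
    (y₁ := Y 0) (y₂ := Y 1) hd rfl rfl rfl rfl
  obtain ⟨-, -, v1, v2⟩ := coords_ofCoords (d := deltaTilde δ b) (x₁ := X 0) (x₂ := X 1)
    (y₁ := Y' 0) (y₂ := Y' 1) hd rfl rfl rfl rfl
  have k1 : coordY₁ (deltaTilde δ b) (ofCoords δ X Y b b₁ 0) (ofCoords δ X Y b b₁ 1)
        (ofCoords δ X Y b b₁ 3) = coordY₁ (deltaTilde δ b) (ofCoords δ X Y' b b₁' 0)
        (ofCoords δ X Y' b b₁' 1) (ofCoords δ X Y' b b₁' 3) := by rw [h]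
  have k2 : coordY₂ (deltaTilde δ b) (ofCoords δ X Y b b₁ 1) (ofCoords δ X Y b b₁ 2)
        (ofCoords δ X Y b b₁ 3) = coordY₂ (deltaTilde δ b) (ofCoords δ X Y' b b₁' 1)
        (ofCoords δ X Y' b b₁' 2) (ofCoords δ X Y' b b₁' 3) := by rw [h]
  refine ⟨?_, congrFun h 5⟩
  ext i
  fin_cases i
  · exact (u1.symm.trans k1).trans v1
  · exact (u2.symm.trans k2).trans v2

/-- A bound for the coupling coefficients. -/
theorem coupling_sq_le (R : Regime ε δ X b) {x q : ℝ}
    (hq : |q| ≤ 128 * (‖X‖ * Real.exp (-(deltaTilde δ b / 4 * x)))) :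
    q ^ 2 ≤ 16384 * deltaTilde δ b ^ 4 * Real.exp (-(deltaTilde δ b / 2) * x) := by
  have hu2 : (‖X‖ * Real.exp (-(deltaTilde δ b / 4 * x))) ^ 2 =
      ‖X‖ ^ 2 * Real.exp (-(deltaTilde δ b / 2) * x) := by
    rw [mul_pow, ← Real.exp_nat_mul]
    congr 2
    push_cast; ring
  have hX : ‖X‖ ^ 2 ≤ deltaTilde δ b ^ 4 := by
    calc ‖X‖ ^ 2 ≤ (deltaTilde δ b ^ 2) ^ 2 := pow_le_pow_left₀ (norm_nonneg _) R.X_le 2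
      _ = deltaTilde δ b ^ 4 := by ring
  calc q ^ 2 = |q| ^ 2 := (sq_abs q).symm
    _ ≤ (128 * (‖X‖ * Real.exp (-(deltaTilde δ b / 4 * x)))) ^ 2 :=
        pow_le_pow_left₀ (abs_nonneg _) hq 2
    _ = 16384 * (‖X‖ ^ 2 * Real.exp (-(deltaTilde δ b / 2) * x)) := by rw [mul_pow, hu2]; norm_num
    _ ≤ 16384 * (deltaTilde δ b ^ 4 * Real.exp (-(deltaTilde δ b / 2) * x)) :=
        mul_le_mul_of_nonneg_left (mul_le_mul_of_nonneg_right hX (Real.exp_pos _).le)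
          (by norm_num)
    _ = _ := by ring

/-- Amounts to 512 ε ≤ `deltaTilde δ b`, with 16384 = 128² the constant of `coupling_sq_le` and
`deltaTilde δ b / 2` the decay rate of the squared coupling. -/
theorem Regime.coupling_small (R : Regime ε δ X b) :
    4 * 16384 * ε ^ 2 ≤ (deltaTilde δ b / 2) ^ 2 := by
  have h1 := R.ε_le
  have h2 := R.ε_pos
  have h3 : (1000 * ε) ^ 2 ≤ deltaTilde δ b ^ 2 := pow_le_pow_left₀ (by positivity) h1 2
  nlinarith

/-- The orbits of the stable manifold in `𝒲_{ε,δ}` are determined by the parameters `(X, b)`. -/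
theorem GoodOrbit.unique {Z' : ℝ → Phase} (R : Regime ε δ X b) (G : GoodOrbit ε δ X b Z)
    (G' : GoodOrbit ε δ X b Z') {x : ℝ} (hx : 0 ≤ x) : Z x = Z' x := by
  obtain ⟨t0, t1, t2, t3⟩ := tendsto_A G.tends
  obtain ⟨t4, t5⟩ := tendsto_B G.tends
  obtain ⟨s0, s1, s2, s3⟩ := tendsto_A G'.tends
  obtain ⟨s4, s5⟩ := tendsto_B G'.tends
  obtain ⟨Y, b₁, h0⟩ := G.start
  obtain ⟨Y', b₁', h0'⟩ := G'.start
  obtain ⟨e0, e1, e2, e3, e4, -⟩ := ofCoords_components h0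
  obtain ⟨f0, f1, f2, f3, f4, -⟩ := ofCoords_components h0'
  have d0 := R.d_pos
  have hg := R.δ_sq_le
  -- The difference of the orbits solves a linear system, with coefficients obtained by factoring
  -- differences of monomials. The slow coefficient is at least 3b² - 1 ≥ 1/2.
  have main := eq_zero_of_weakly_coupled (w₀ := fun x => Z x 0 - Z' x 0)
    (w₁ := fun x => Z x 1 - Z' x 1) (w₂ := fun x => Z x 2 - Z' x 2)
    (w₃ := fun x => Z x 3 - Z' x 3) (z₀ := fun x => Z x 4 - Z' x 4)
    (z₁ := fun x => Z x 5 - Z' x 5)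
    (a := fun x => (1 + δ ^ 2) * Z' x 4 ^ 2 - 1 + (Z x 0 ^ 2 + Z x 0 * Z' x 0 + Z' x 0 ^ 2))
    (p := fun x => (1 + δ ^ 2) * Z x 0 * (Z x 4 + Z' x 4))
    (p' := fun x => (1 + δ ^ 2) * Z' x 4 * (Z x 0 + Z' x 0))
    (e := fun x => Z x 4 ^ 2 + Z x 4 * Z' x 4 + Z' x 4 ^ 2 - 1 + (1 + δ ^ 2) * Z x 0 ^ 2)
    (ε := ε) (m := deltaTilde δ b ^ 4) (M := 16384) (κ := deltaTilde δ b / 2)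
    R.ε_pos (by positivity) (by positivity) (by norm_num) R.coupling_small
    (G.sol.deriv_zero.sub G'.sol.deriv_zero) (G.sol.deriv_one.sub G'.sol.deriv_one)
    (G.sol.deriv_two.sub G'.sol.deriv_two)
    ((G.sol.deriv_three.sub G'.sol.deriv_three).congr_deriv fun x _ => by ring)
    (G.sol.deriv_four.sub G'.sol.deriv_four)
    ((G.sol.deriv_five.sub G'.sol.deriv_five).congr_deriv fun x _ => by ring)
    (by simpa using t0.sub s0) (by simpa using t1.sub s1) (by simpa using t2.sub s2)
    (by simpa using t3.sub s3) (by simpa using t4.sub s4) (by simpa using t5.sub s5)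
    (fun x hx => by
      have := G'.coeff_ge R hx
      nlinarith [sq_nonneg (Z x 0 + Z' x 0), sq_nonneg (Z x 0), sq_nonneg (Z' x 0)])
    (fun x hx => by
      have h1 := G.le_B hx
      have h2 := G'.le_B hx
      have h3 := R.half_le_b_sq
      have h4 := R.b_pos
      have h5 : b ^ 2 ≤ Z x 4 ^ 2 := pow_le_pow_left₀ h4.le h1 2
      have h6 : b ^ 2 ≤ Z' x 4 ^ 2 := pow_le_pow_left₀ h4.le h2 2
      have h7 : b * b ≤ Z x 4 * Z' x 4 := mul_le_mul h1 h2 h4.le (h4.le.trans h1)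
      have h8 : 0 ≤ (1 + δ ^ 2) * Z x 0 ^ 2 := by positivity
      nlinarith)
    (fun x hx => by
      -- Each of the two coupling coefficients is at most 64 u, hence the 128.
      refine coupling_sq_le R ?_
      have a1 := (G.A_bounds R hx).1
      have a2 := (G'.A_bounds R hx).1
      set u := ‖X‖ * Real.exp (-(deltaTilde δ b / 4 * x))
      have hu : 0 ≤ u := by positivity
      have b1 := G.B_le hx
      have b2 := G'.B_le hx
      have b3 := R.b_pos.trans_le (G.le_B hx)
      have b4 := R.b_pos.trans_le (G'.le_B hx)
      have k1 : |(1 + δ ^ 2) * Z x 0 * (Z x 4 + Z' x 4)| ≤ 2 * (16 * u) * 2 := by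
        rw [abs_mul, abs_mul, abs_of_pos (show 0 < 1 + δ ^ 2 by positivity),
          abs_of_pos (show 0 < Z x 4 + Z' x 4 by linarith)]
        exact mul_le_mul (mul_le_mul (by linarith) a1 (abs_nonneg _) (by norm_num))
          (by linarith) (by linarith) (by positivity)
      have k2 : |(1 + δ ^ 2) * Z' x 4 * (Z x 0 + Z' x 0)| ≤ 2 * 1 * (16 * u + 16 * u) := by
        rw [abs_mul, abs_mul, abs_of_pos (show 0 < 1 + δ ^ 2 by positivity), abs_of_pos b4]
        exact mul_le_mul (mul_le_mul (by linarith) b2 b4.le (by norm_num))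
          ((abs_add_le _ _).trans (by linarith)) (abs_nonneg _) (by norm_num)
      exact (abs_add_le _ _).trans (by linarith))
    -- Both orbits have the same X, so the difference starts in the purely unstable directions,
    -- where the boundary form has the sign opposite to the one imposed by decay.
    (boundary_form_nonpos (y₁ := Y 0 - Y' 0) (y₂ := Y 1 - Y' 1) d0
      (by rw [e0, f0]; ring) (by rw [e1, f1]; ring) (by rw [e2, f2]; ring)
      (by rw [e3, f3]; ring))
    (by simp [e4, f4])
  obtain ⟨m0, m1, m2, m3, m4, m5⟩ := main x hx
  ext j
  fin_cases j
  exacts [sub_eq_zero.1 m0, sub_eq_zero.1 m1, sub_eq_zero.1 m2, sub_eq_zero.1 m3, sub_eq_zero.1 m4,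
    sub_eq_zero.1 m5]

/-- For `A'''' = -(D⁴ + r) A` with `r` exponentially small, decaying solutions have the exact
rate `D / √2`. -/
theorem exact_decay {A₀ A₁ A₂ A₃ r : ℝ → ℝ} {D c κ : ℝ} (hD : 0 < D) (hD1 : D ≤ 1) (hκ : 0 < κ)
    (h₀ : HasDerivOnHalfLine A₀ A₁) (h₁ : HasDerivOnHalfLine A₁ A₂)
    (h₂ : HasDerivOnHalfLine A₂ A₃) (h₃ : HasDerivOnHalfLine A₃ fun x => -(D ^ 4 + r x) * A₀ x)
    (hQ : ∀ x, 0 ≤ x → 0 ≤ D ^ 4 + r x) (hr : ∀ x, 0 ≤ x → |r x| ≤ c * Real.exp (-κ * x))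
    (t₀ : Tendsto A₀ atTop (𝓝 0)) (t₁ : Tendsto A₁ atTop (𝓝 0))
    (t₂ : Tendsto A₂ atTop (𝓝 0)) (t₃ : Tendsto A₃ atTop (𝓝 0)) :
    ∃ C, ∀ x, 0 ≤ x → |A₀ x| ≤ C * Real.exp (-(D / √2 * x)) ∧
      |A₁ x| ≤ C * Real.exp (-(D / √2 * x)) ∧ |A₂ x| ≤ C * Real.exp (-(D / √2 * x)) ∧
      |A₃ x| ≤ C * Real.exp (-(D / √2 * x)) := by
  have hs2 : √2 ^ 2 = 2 := Real.sq_sqrt (by norm_num)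
  have hs0 : 0 < √2 := by positivity
  set x₁ : ℝ → ℝ := fun x => coordX₁ D (A₀ x) (A₁ x) (A₃ x) with hx₁
  set x₂ : ℝ → ℝ := fun x => coordX₂ D (A₁ x) (A₂ x) (A₃ x) with hx₂
  set y₁ : ℝ → ℝ := fun x => coordY₁ D (A₀ x) (A₁ x) (A₃ x) with hy₁
  set y₂ : ℝ → ℝ := fun x => coordY₂ D (A₁ x) (A₂ x) (A₃ x) with hy₂
  have d₁ : HasDerivOnHalfLine x₁
      fun x => -(D / √2) * (x₁ x + x₂ x) - r x * A₀ x / (2 * √2 * D ^ 3) := by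
    refine (((h₀.add (((h₃.const_mul (1 / D ^ 3)).sub (h₁.const_mul (1 / D))).const_mul
      (1 / √2))).const_mul (1 / 2)).congr fun x _ => ?_).congr_deriv fun x _ => ?_
    · simp only [hx₁, coordX₁]; ring
    · simp only [hx₁, hx₂, coordX₁, coordX₂]; field_simp; ring_nf; rw [hs2]; ring
  have d₂ : HasDerivOnHalfLine x₂
      fun x => D / √2 * (x₁ x - x₂ x) + r x * A₀ x / (2 * √2 * D ^ 3) := by
    refine ((((h₂.const_mul (1 / D ^ 2)).sub (((h₃.const_mul (1 / D ^ 3)).add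
      (h₁.const_mul (1 / D))).const_mul (1 / √2))).const_mul (1 / 2)).congr
      fun x _ => ?_).congr_deriv fun x _ => ?_
    · simp only [hx₂, coordX₂]; ring
    · simp only [hx₁, hx₂, coordX₁, coordX₂]; field_simp; ring_nf; rw [hs2]; ring
  -- In the frame of the limit equation X rotates and contracts, so N' = -√2 D N apart from the term
  -- in r. That term contains Y, which is not followed by its own equation: the boundary form gives
  -- |Y|² ≤ 9N at every x, so the perturbation is O(e^{-κx} N).
  set N : ℝ → ℝ := fun x => x₁ x ^ 2 + x₂ x ^ 2 with hN
  have hN0 : ∀ x, 0 ≤ N x := fun x => by positivity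
  have dN : HasDerivOnHalfLine N fun x => -(√2 * D) * N x
      + r x * (A₀ x * (x₂ x - x₁ x)) / (√2 * D ^ 3) := by
    refine (d₁.sq.add d₂.sq).congr_deriv fun x _ => ?_
    simp only [hN]
    field_simp
    ring_nf
    rw [hs2]
  have hspec := fun x => coords_spec hD (A₀ x) (A₁ x) (A₂ x) (A₃ x)
  have hy : ∀ x, 0 ≤ x → y₁ x ^ 2 + y₂ x ^ 2 ≤ 9 * N x := fun x hx => by
    obtain ⟨s0, s1, s2, s3⟩ := hspec x
    refine coords_sq_le hD s0 s1 s2 s3 ?_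
    exact boundary_form_nonneg h₀ h₁ h₂ h₃ hQ t₀ t₁ t₂ t₃ hx
  have hA : ∀ x, 0 ≤ x → (|x₁ x| ≤ √(N x) ∧ |x₂ x| ≤ √(N x)) ∧
      |y₁ x| ≤ 3 * √(N x) ∧ |y₂ x| ≤ 3 * √(N x) := fun x hx => by
    have hn := Real.sq_sqrt (hN0 x)
    have hn' := Real.sqrt_nonneg (N x)
    have h := hy x hx
    have hNx : N x = x₁ x ^ 2 + x₂ x ^ 2 := rfl
    refine ⟨⟨abs_le_of_sq_le_sq ?_ hn', abs_le_of_sq_le_sq ?_ hn'⟩,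
      abs_le_of_sq_le_sq ?_ (by positivity), abs_le_of_sq_le_sq ?_ (by positivity)⟩ <;>
    nlinarith [sq_nonneg (x₁ x), sq_nonneg (x₂ x), sq_nonneg (y₁ x), sq_nonneg (y₂ x)]
  set k := 8 * c / D ^ 3 with hk
  have hNle : ∀ x, 0 ≤ x → r x * (A₀ x * (x₂ x - x₁ x)) / (√2 * D ^ 3) ≤
      k * Real.exp (-κ * x) * N x := by
    intro x hx
    obtain ⟨⟨a1, a2⟩, a3, a4⟩ := hA x hx
    have hn := Real.sq_sqrt (hN0 x)
    have hn' := Real.sqrt_nonneg (N x)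
    have b0 : |A₀ x| ≤ 4 * √(N x) := by
      rw [(hspec x).1]
      exact (abs_add_le _ _).trans (by linarith)
    have b1 : |x₂ x - x₁ x| ≤ 2 * √(N x) := (abs_sub _ _).trans (by linarith)
    have hs1 : 1 ≤ √2 := by nlinarith
    have hD3 : 0 < D ^ 3 := by positivity
    have b2 : |r x * (A₀ x * (x₂ x - x₁ x))| ≤ c * Real.exp (-κ * x) * (8 * N x) := by
      rw [abs_mul, abs_mul]
      refine mul_le_mul (hr x hx) ?_ (by positivity) ((abs_nonneg _).trans (hr x hx))
      calc |A₀ x| * |x₂ x - x₁ x| ≤ 4 * √(N x) * (2 * √(N x)) :=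
            mul_le_mul b0 b1 (abs_nonneg _) (by positivity)
        _ = 8 * (√(N x)) ^ 2 := by ring
        _ = 8 * N x := by rw [hn]
    rw [div_le_iff₀ (by positivity)]
    have hc0 : 0 ≤ c * Real.exp (-κ * x) := (abs_nonneg _).trans (hr x hx)
    calc r x * (A₀ x * (x₂ x - x₁ x)) ≤ c * Real.exp (-κ * x) * (8 * N x) :=
          (le_abs_self _).trans b2
      _ ≤ c * Real.exp (-κ * x) * (8 * N x) * √2 :=
          le_mul_of_one_le_right (mul_nonneg hc0 (mul_nonneg (by norm_num) (hN0 x))) hs1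
      _ = k * Real.exp (-κ * x) * N x * (√2 * D ^ 3) := by rw [hk]; field_simp
  have hc0 : 0 ≤ c := by
    have := (abs_nonneg _).trans (hr 0 le_rfl)
    simpa using this
  have hk0 : 0 ≤ k := by positivity
  -- Integrating factor for N' ≤ (-√2 D + k e^{-κx}) N. As k e^{-κx} is integrable, it costs a
  -- constant and nothing in the rate.
  set φ : ℝ → ℝ := fun x => Real.exp (√2 * D * x + k / κ * Real.exp (-κ * x)) with hφ
  have dφ : HasDerivOnHalfLine φ fun x => (√2 * D - k * Real.exp (-κ * x)) * φ x := by
    intro x hx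
    have h1 : HasDerivWithinAt (fun x : ℝ => √2 * D * x) (√2 * D) (Set.Ici 0) x := by
      simpa using ((hasDerivAt_id x).const_mul (√2 * D)).hasDerivWithinAt
    have h2 := ((HasDerivOnHalfLine.exp_mul (-κ)) x hx).const_mul (k / κ)
    have := (h1.add h2).exp
    convert! this using 1
    simp only [hφ, Pi.add_apply]
    rw [mul_comm]
    congr 1
    field_simp
    ring
  have hG := (dN.mul dφ).antitoneOn fun x hx => by
    have h1 := hNle x hx.le
    have h2 : 0 < φ x := Real.exp_pos _
    nlinarith
  have hNexp : ∀ x, 0 ≤ x → √(N x) ≤ √(N 0 * φ 0) * Real.exp (-(D / √2 * x)) := by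
    intro x hx
    have h1 : N x * φ x ≤ N 0 * φ 0 := hG Set.self_mem_Ici hx hx
    have h2 : Real.exp (√2 * D * x) ≤ φ x := by
      refine Real.exp_le_exp.2 ?_
      have : 0 ≤ k / κ * Real.exp (-κ * x) := by positivity
      linarith
    have h3 : N x ≤ N 0 * φ 0 * Real.exp (-(√2 * D * x)) := by
      rw [Real.exp_neg, ← div_eq_mul_inv, le_div_iff₀ (Real.exp_pos _)]
      exact (mul_le_mul_of_nonneg_left h2 (hN0 x)).trans h1
    have h4 : Real.exp (-(√2 * D * x)) = Real.exp (-(D / √2 * x)) ^ 2 := by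
      rw [← Real.exp_nat_mul]
      congr 1
      push_cast
      field_simp
      rw [hs2]; ring
    calc √(N x) ≤ √(N 0 * φ 0 * Real.exp (-(√2 * D * x))) := Real.sqrt_le_sqrt h3
      _ = √(N 0 * φ 0) * Real.exp (-(D / √2 * x)) := by
        rw [h4, Real.sqrt_mul (mul_nonneg (hN0 0) (Real.exp_pos _).le),
          Real.sqrt_sq (Real.exp_pos _).le]
  refine ⟨8 * √(N 0 * φ 0), fun x hx => ?_⟩
  obtain ⟨⟨a1, a2⟩, a3, a4⟩ := hA x hx
  have hn := hNexp x hx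
  have hn' := Real.sqrt_nonneg (N x)
  obtain ⟨s0, s1, s2, s3⟩ := hspec x
  have hs1 : 1 ≤ √2 := by nlinarith
  have f1 : |-(D / √2)| ≤ 1 := by
    rw [abs_neg, abs_of_pos (by positivity), div_le_one hs0]; linarith
  have f2 : |D ^ 2| ≤ 1 := by
    rw [abs_of_pos (by positivity)]; exact pow_le_one₀ hD.le hD1
  have f3 : |D ^ 3 / √2| ≤ 1 := by
    rw [abs_of_pos (by positivity), div_le_one hs0]
    exact (pow_le_one₀ hD.le hD1).trans hs1
  have fin : ∀ {A q s : ℝ}, A = q * s → |q| ≤ 1 → |s| ≤ 8 * √(N x) →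
      |A| ≤ 8 * √(N 0 * φ 0) * Real.exp (-(D / √2 * x)) := by
    intro A q s hA hq hs
    rw [hA, abs_mul]
    calc |q| * |s| ≤ 1 * (8 * √(N x)) := mul_le_mul hq hs (abs_nonneg _) (by norm_num)
      _ ≤ _ := by linarith
  have a1' := abs_le.1 a1
  have a2' := abs_le.1 a2
  have a3' := abs_le.1 a3
  have a4' := abs_le.1 a4
  refine ⟨fin ((s0.trans (one_mul _).symm)) (by simp) ?_, fin s1 f1 ?_, fin s2 f2 ?_,
    fin s3 f3 ?_⟩ <;>
  · rw [abs_le]; constructor <;> linarith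

/-- At B = 1 the coefficient (1 + δ²)B² - 1 equals δ² = (√δ)⁴, so the limit frame has D = √δ and
rate √δ/√2. The earlier, weaker bounds on A and 1 - B show that the coefficient converges
exponentially, which is all that `exact_decay` requires. -/
theorem GoodOrbit.isBigO_A (R : Regime ε δ X b) (G : GoodOrbit ε δ X b Z) :
    ∀ j : Fin 6, (j : ℕ) < 4 →
      (fun x => Z x j) =O[atTop] fun x => Real.exp (-(√(δ / 2) * x)) := by
  obtain ⟨t0, t1, t2, t3⟩ := tendsto_A G.tends
  have δ0 : 0 < δ := by linarith [R.δ_ge]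
  have hD4 : √δ ^ 4 = δ ^ 2 := by
    calc √δ ^ 4 = (√δ ^ 2) ^ 2 := by ring
      _ = δ ^ 2 := by rw [Real.sq_sqrt δ0.le]
  have ε0 := R.ε_pos
  have d0 := R.d_pos
  have hs2 : √2 ^ 2 = 2 := Real.sq_sqrt (by norm_num)
  have hs0 : 0 < √2 := by positivity
  have hs3 : √2 ≤ 3 / 2 := by nlinarith
  have hX1 : ‖X‖ ≤ 1 := R.X_le.trans (by have := R.d_le; nlinarith)
  -- In the remainder A² contributes at most 256 and (1 + δ²)(1 - B²) at most 16, times e^{-√2 ε x};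
  -- 300 covers both.
  obtain ⟨C, hC⟩ := exact_decay (D := √δ) (κ := √2 * ε) (c := 300)
    (r := fun x => (1 + δ ^ 2) * Z x 4 ^ 2 - 1 + Z x 0 ^ 2 - √δ ^ 4) (Real.sqrt_pos.2 δ0)
    (Real.sqrt_le_one.2 R.δ_le) (by positivity) G.sol.deriv_zero G.sol.deriv_one G.sol.deriv_two
    ((fourth_order_form G.sol).congr_deriv fun x _ => by ring)
    (fun x hx => by
      have h1 := G.coeff_ge R hx
      have h3 : 0 < deltaTilde δ b ^ 4 := by positivity
      nlinarith [sq_nonneg (Z x 0)])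
    (fun x hx => by
      have h1 := (G.A_bounds R hx).1
      obtain ⟨⟨h2, h3⟩, -⟩ := G.bounds R hx
      have h4 : Real.exp (-(deltaTilde δ b / 4 * x)) ^ 2 ≤ Real.exp (-(√2 * ε) * x) := by
        rw [← Real.exp_nat_mul]
        refine Real.exp_le_exp.2 ?_
        push_cast
        have := R.ε_le
        have : √2 * ε ≤ deltaTilde δ b / 2 := by nlinarith
        nlinarith
      have h5 : Z x 0 ^ 2 ≤ 256 * Real.exp (-(√2 * ε) * x) := by
        rw [← sq_abs]
        calc |Z x 0| ^ 2 ≤ (16 * (‖X‖ * Real.exp (-(deltaTilde δ b / 4 * x)))) ^ 2 :=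
              pow_le_pow_left₀ (abs_nonneg _) h1 2
          _ = 256 * (‖X‖ ^ 2 * Real.exp (-(deltaTilde δ b / 4 * x)) ^ 2) := by ring
          _ ≤ 256 * (1 * Real.exp (-(√2 * ε) * x)) := by
              refine mul_le_mul_of_nonneg_left ?_ (by norm_num)
              exact mul_le_mul (pow_le_one₀ (norm_nonneg _) hX1) h4 (by positivity) (by norm_num)
          _ = _ := by ring
      have hB := G.B_le hx
      have hB0 := R.b_pos.trans_le (G.le_B hx)
      have hb0 := R.b_pos
      rw [← neg_mul] at h3 h2
      set e := Real.exp (-(√2 * ε) * x)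
      have he : 0 < e := Real.exp_pos _
      have h6 : 1 - Z x 4 ≤ 4 * e := by
        have : 4 * (1 - b) * e ≤ 4 * 1 * e := by
          refine mul_le_mul_of_nonneg_right ?_ he.le; linarith
        linarith
      have hg := R.δ_sq_le
      have h7 : 0 ≤ (1 + δ ^ 2) * (1 - Z x 4 ^ 2) := mul_nonneg (by positivity) (by nlinarith)
      have h8 : (1 + δ ^ 2) * (1 - Z x 4 ^ 2) ≤ 2 * (2 * (4 * e)) :=
        mul_le_mul (by linarith) (by nlinarith) (by nlinarith) (by norm_num)
      rw [hD4, abs_le]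
      constructor <;> nlinarith [sq_nonneg (Z x 0)])
    t0 t1 t2 t3
  have hrate : √(δ / 2) = √δ / √2 := Real.sqrt_div δ0.le 2
  have fin : ∀ j : Fin 6, (∀ x, 0 ≤ x → |Z x j| ≤ C * Real.exp (-(√δ / √2 * x))) →
      (fun x => Z x j) =O[atTop] fun x => Real.exp (-(√(δ / 2) * x)) := by
    intro j hj
    rw [hrate]
    refine IsBigO.of_bound C ?_
    filter_upwards [eventually_ge_atTop 0] with x hx
    rw [Real.norm_eq_abs, Real.norm_of_nonneg (Real.exp_pos _).le]
    exact hj x hx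
  intro j hj
  fin_cases j
  · exact fin 0 fun x hx => (hC x hx).1
  · exact fin 1 fun x hx => (hC x hx).2.1
  · exact fin 2 fun x hx => (hC x hx).2.2.1
  · exact fin 3 fun x hx => (hC x hx).2.2.2
  · exact absurd hj (by norm_num)
  · exact absurd hj (by norm_num)

end DomainWall

end

/-! ### A compactness criterion on the half-line. -/

open Filter Topology Asymptotics

noncomputable section

namespace DomainWall

open BoundedContinuousFunction in
/-- A family of uniformly Lipschitz and uniformly decaying functions on the half-line is compact. -/
theorem isCompactOperator_of_lipschitz_of_decay {V : Type*} [NormedAddCommGroup V]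
    [NormedSpace ℝ V] (T : V →L[ℝ] BoundedContinuousFunction ℝ ℂ) {L C η : ℝ} (hC : 0 ≤ C)
    (hη : 0 < η)
    (hlip : ∀ f x y, ‖T f x - T f y‖ ≤ L * ‖f‖ * |x - y|)
    (hdec : ∀ f x, 0 ≤ x → ‖T f x‖ ≤ C * ‖f‖ * Real.exp (-η * x))
    (hneg : ∀ f x, x ≤ 0 → T f x = T f 0) : IsCompactOperator T := by
  -- restriction to and extension from `[0, n]`
  let res : ∀ n : ℕ, BoundedContinuousFunction ℝ ℂ →L[ℝ]
      BoundedContinuousFunction (Set.Icc (0 : ℝ) n) ℂ := fun n =>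
    LinearMap.mkContinuous
      { toFun := fun f => f.compContinuous ⟨Subtype.val, continuous_subtype_val⟩
        map_add' := fun _ _ => rfl
        map_smul' := fun _ _ => rfl } 1
      (fun f => by rw [one_mul]; exact norm_compContinuous_le f _)
  let ext : ∀ n : ℕ, BoundedContinuousFunction (Set.Icc (0 : ℝ) n) ℂ →L[ℝ]
      BoundedContinuousFunction ℝ ℂ := fun n =>
    LinearMap.mkContinuous
      { toFun := fun f => f.compContinuous ⟨Set.projIcc 0 (n : ℝ) n.cast_nonneg, by fun_prop⟩
        map_add' := fun _ _ => rfl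
        map_smul' := fun _ _ => rfl } 1
      (fun f => by rw [one_mul]; exact norm_compContinuous_le f _)
  have hres : ∀ n, IsCompactOperator (res n ∘L T) := by
    intro n
    set A : Set (BoundedContinuousFunction (Set.Icc (0 : ℝ) n) ℂ) :=
      (fun f => res n (T f)) '' Metric.ball 0 1 with hA
    have hL : ∀ f : V, ‖f‖ < 1 → ∀ x y, ‖T f x - T f y‖ ≤ |L| * |x - y| := fun f hf x y => by
      refine (hlip f x y).trans (mul_le_mul_of_nonneg_right ?_ (abs_nonneg _))
      calc L * ‖f‖ ≤ |L| * 1 := mul_le_mul (le_abs_self L) hf.le (norm_nonneg _) (abs_nonneg _)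
        _ = |L| := mul_one _
    refine ⟨closure A, arzela_ascoli (Metric.closedBall 0 ‖T‖) (isCompact_closedBall 0 ‖T‖) A
      ?_ ?_, ?_⟩
    · rintro g x ⟨f, hf, rfl⟩
      rw [mem_closedBall_zero_iff]
      rw [mem_ball_zero_iff] at hf
      calc ‖T f x‖ ≤ ‖T f‖ := norm_coe_le_norm _ _
        _ ≤ ‖T‖ * ‖f‖ := T.le_opNorm f
        _ ≤ ‖T‖ * 1 := mul_le_mul_of_nonneg_left hf.le (norm_nonneg _)
        _ = ‖T‖ := mul_one _
    · refine Metric.equicontinuous_of_continuity_modulus (fun t => |L| * t) ?_ _ ?_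
      · simpa using (continuous_const_mul |L|).tendsto (0 : ℝ)
      · rintro x y ⟨g, f, hf, rfl⟩
        rw [dist_eq_norm]
        rw [mem_ball_zero_iff] at hf
        exact hL f hf x y
    · refine mem_of_superset (Metric.ball_mem_nhds 0 one_pos) fun f hf => ?_
      exact subset_closure ⟨f, hf, rfl⟩
  -- On [0, n] Arzelà–Ascoli gives compactness. Freezing the value at n beyond n changes T f by at
  -- most 2C e^{-ηn}‖f‖, so T is a limit in operator norm of compact operators.
  refine isCompactOperator_of_tendsto (l := atTop) (F := fun n : ℕ => ext n ∘L (res n ∘L T)) ?_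
    (Eventually.of_forall fun n => (hres n).clm_comp (ext n))
  rw [tendsto_iff_norm_sub_tendsto_zero]
  have hlim : Tendsto (fun n : ℕ => 2 * C * Real.exp (-η * n)) atTop (𝓝 0) := by
    have h1 : Tendsto (fun n : ℕ => -η * (n : ℝ)) atTop atBot :=
      tendsto_natCast_atTop_atTop.const_mul_atTop_of_neg (neg_lt_zero.2 hη)
    simpa using (Real.tendsto_exp_atBot.comp h1).const_mul (2 * C)
  refine squeeze_zero (fun _ => norm_nonneg _) (fun n => ?_) hlim
  refine ContinuousLinearMap.opNorm_le_bound _ (by positivity) fun f => ?_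
  rw [norm_le (by positivity)]
  intro x
  change ‖T f (Set.projIcc 0 (n : ℝ) n.cast_nonneg x) - T f x‖ ≤ _
  rcases le_total x 0 with hx | hx
  · rw [Set.projIcc_of_le_left _ hx, hneg f x hx]
    simp only [sub_self, norm_zero]
    positivity
  rcases le_total x n with hxn | hxn
  · rw [Set.projIcc_of_mem _ ⟨hx, hxn⟩]
    simp only [sub_self, norm_zero]
    positivity
  · rw [Set.projIcc_of_right_le _ hxn]
    have h1 := hdec f n n.cast_nonneg
    have h2 := hdec f x hx
    have h3 : C * ‖f‖ * Real.exp (-η * x) ≤ C * ‖f‖ * Real.exp (-η * n) :=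
      mul_le_mul_of_nonneg_left (Real.exp_le_exp.2 (by nlinarith)) (by positivity)
    calc ‖T f n - T f x‖ ≤ ‖T f n‖ + ‖T f x‖ := norm_sub_le _ _
      _ ≤ 2 * C * Real.exp (-η * n) * ‖f‖ := by linarith

end DomainWall

end

/-! ### Variation of constants as bounded and compact operators. -/

open Filter Topology Asymptotics

noncomputable section

namespace DomainWall

/-- The solution of `u' = -a u + f`, `u 0 = 0`. -/
def forwardIntegral (a : ℂ) (f : ℝ → ℝ) (x : ℝ) : ℂ :=
  Complex.exp (-a * x) * ∫ t in (0 : ℝ)..x, Complex.exp (a * t) * f t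

/-- The bounded solution of `u' = a u - f`. -/
def backwardIntegral (a : ℂ) (f : ℝ → ℝ) (x : ℝ) : ℂ :=
  Complex.exp (a * x) * ∫ t : ℝ in Set.Ioi x, Complex.exp (-a * t) * f t

section Integrals

variable {a : ℂ} {f : ℝ → ℝ}

theorem hasDerivAt_cexp (a : ℂ) (x : ℝ) :
    HasDerivAt (fun x : ℝ => Complex.exp (a * x)) (a * Complex.exp (a * x)) x := by
  have h1 : HasDerivAt (fun x : ℝ => a * (x : ℂ)) a x := by
    simpa using (Complex.ofRealCLM.hasDerivAt (x := x)).const_mul a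
  simpa [mul_comm] using h1.cexp

theorem continuous_kernel (a : ℂ) (hf : Continuous f) :
    Continuous fun t : ℝ => Complex.exp (a * t) * (f t : ℂ) := by fun_prop

theorem hasDerivAt_forwardIntegral (hf : Continuous f) (x : ℝ) :
    HasDerivAt (forwardIntegral a f) (-a * forwardIntegral a f x + f x) x := by
  have h1 := hasDerivAt_cexp (-a) x
  have h2 : HasDerivAt (fun x => ∫ t in (0 : ℝ)..x, Complex.exp (a * t) * (f t : ℂ))
      (Complex.exp (a * x) * f x) x :=
    intervalIntegral.integral_hasDerivAt_right ((continuous_kernel a hf).intervalIntegrable _ _)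
      ((continuous_kernel a hf).stronglyMeasurableAtFilter _ _) (continuous_kernel a hf).continuousAt
  have h3 := h1.mul h2
  convert! h3 using 1
  have : Complex.exp (-a * x) * (Complex.exp (a * x) * f x) = f x := by
    rw [← mul_assoc, ← Complex.exp_add]; simp
  rw [this, forwardIntegral]
  ring

theorem integrableOn_kernel (ha : 0 < a.re) (hf : Continuous f) {M : ℝ} (hM : ∀ t, |f t| ≤ M)
    (x : ℝ) :
    MeasureTheory.IntegrableOn (fun t : ℝ => Complex.exp (-a * t) * (f t : ℂ)) (Set.Ioi x) := by
  have h1 := (integrableOn_exp_mul_Ioi (a := -a.re) (by linarith) x).const_mul M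
  refine MeasureTheory.Integrable.mono' h1
    (continuous_kernel (-a) hf).aestronglyMeasurable (Eventually.of_forall fun t => ?_)
  rw [norm_mul, Complex.norm_exp, Complex.norm_real, mul_comm]
  simp only [Complex.mul_re, Complex.neg_re, Complex.ofReal_re, Complex.ofReal_im, mul_zero,
    sub_zero]
  exact mul_le_mul_of_nonneg_right (hM t) (Real.exp_pos _).le

theorem hasDerivAt_backwardIntegral (ha : 0 < a.re) (hf : Continuous f) {M : ℝ}
    (hM : ∀ t, |f t| ≤ M) (x : ℝ) :
    HasDerivAt (backwardIntegral a f) (a * backwardIntegral a f x - f x) x := by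
  have h1 := hasDerivAt_cexp a x
  have h2 : HasDerivAt (fun x => ∫ t in (0 : ℝ)..x, Complex.exp (-a * t) * (f t : ℂ))
      (Complex.exp (-a * x) * f x) x :=
    intervalIntegral.integral_hasDerivAt_right
      ((continuous_kernel (-a) hf).intervalIntegrable _ _)
      ((continuous_kernel (-a) hf).stronglyMeasurableAtFilter _ _)
      (continuous_kernel (-a) hf).continuousAt
  have h2' : HasDerivAt (fun x => ∫ t : ℝ in Set.Ioi x, Complex.exp (-a * t) * (f t : ℂ))
      (-(Complex.exp (-a * x) * f x)) x := by
    have := h2.const_sub (∫ t : ℝ in Set.Ioi (0 : ℝ), Complex.exp (-a * t) * (f t : ℂ))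
    refine this.congr_of_eventuallyEq (Eventually.of_forall fun y => ?_)
    have := intervalIntegral.integral_interval_add_Ioi (integrableOn_kernel ha hf hM 0)
      (integrableOn_kernel ha hf hM y)
    exact eq_sub_of_add_eq' this
  have h3 := h1.mul h2'
  convert! h3 using 1
  have : Complex.exp (a * x) * -(Complex.exp (-a * x) * f x) = -f x := by
    rw [mul_neg, ← mul_assoc, ← Complex.exp_add]; simp
  rw [this, backwardIntegral]
  ring

/-- Convolution with the stable exponential preserves every decay rate η < Re a. The case η = 0
gives boundedness of the operator, the case η > 0 its compactness after a decaying multiplier. -/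
theorem norm_forwardIntegral_le {η M : ℝ} (hη : η < a.re)
    (hM : ∀ t, 0 ≤ t → |f t| ≤ M * Real.exp (-η * t)) {x : ℝ} (hx : 0 ≤ x) :
    ‖forwardIntegral a f x‖ ≤ M / (a.re - η) * Real.exp (-η * x) := by
  have hc : 0 < a.re - η := by linarith
  have hM0 : 0 ≤ M := by simpa using (abs_nonneg _).trans (hM 0 le_rfl)
  have h1 : ‖∫ t in (0 : ℝ)..x, Complex.exp (a * t) * (f t : ℂ)‖ ≤
      ∫ t in (0 : ℝ)..x, M * Real.exp ((a.re - η) * t) := by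
    refine intervalIntegral.norm_integral_le_of_norm_le hx (Eventually.of_forall fun t ht => ?_)
      (by apply Continuous.intervalIntegrable; fun_prop)
    rw [norm_mul, Complex.norm_exp, Complex.norm_real]
    simp only [Complex.mul_re, Complex.ofReal_re, Complex.ofReal_im, mul_zero, sub_zero]
    calc Real.exp (a.re * t) * ‖f t‖ ≤ Real.exp (a.re * t) * (M * Real.exp (-η * t)) :=
          mul_le_mul_of_nonneg_left (hM t ht.1.le) (Real.exp_pos _).le
      _ = M * (Real.exp (a.re * t) * Real.exp (-η * t)) := by ring
      _ = M * Real.exp ((a.re - η) * t) := by rw [← Real.exp_add]; congr 2; ring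
  have h2 : ∫ t in (0 : ℝ)..x, M * Real.exp ((a.re - η) * t) =
      M * ((Real.exp ((a.re - η) * x) - 1) / (a.re - η)) := by
    rw [intervalIntegral.integral_const_mul,
      intervalIntegral.integral_comp_mul_left (fun t => Real.exp t) hc.ne', integral_exp]
    simp [div_eq_inv_mul]
  rw [h2] at h1
  unfold forwardIntegral
  rw [norm_mul, Complex.norm_exp]
  simp only [Complex.mul_re, Complex.neg_re, Complex.neg_im, Complex.ofReal_re,
    Complex.ofReal_im, mul_zero, sub_zero]
  calc Real.exp (-a.re * x) * ‖∫ t in (0 : ℝ)..x, Complex.exp (a * t) * (f t : ℂ)‖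
      ≤ Real.exp (-a.re * x) * (M * (Real.exp ((a.re - η) * x) / (a.re - η))) := by
        refine mul_le_mul_of_nonneg_left (h1.trans ?_) (Real.exp_pos _).le
        refine mul_le_mul_of_nonneg_left ?_ hM0
        exact div_le_div_of_nonneg_right (by linarith) hc.le
    _ = M / (a.re - η) * (Real.exp (-a.re * x) * Real.exp ((a.re - η) * x)) := by ring
    _ = M / (a.re - η) * Real.exp (-η * x) := by rw [← Real.exp_add]; congr 2; ring

theorem norm_backwardIntegral_le {η M : ℝ} (ha : 0 < a.re) (hη : 0 ≤ η)
    (hM : ∀ t, 0 ≤ t → |f t| ≤ M * Real.exp (-η * t)) {x : ℝ} (hx : 0 ≤ x) :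
    ‖backwardIntegral a f x‖ ≤ M / a.re * Real.exp (-η * x) := by
  have hM0 : 0 ≤ M := by simpa using (abs_nonneg _).trans (hM 0 le_rfl)
  have h1 : ‖∫ t : ℝ in Set.Ioi x, Complex.exp (-a * t) * (f t : ℂ)‖ ≤
      ∫ t : ℝ in Set.Ioi x, M * Real.exp (-η * x) * Real.exp (-a.re * t) := by
    refine MeasureTheory.norm_integral_le_of_norm_le
      ((integrableOn_exp_mul_Ioi (by linarith) x).const_mul _) ?_
    refine (MeasureTheory.ae_restrict_mem measurableSet_Ioi).mono fun t ht => ?_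
    have ht : x < t := ht
    rw [norm_mul, Complex.norm_exp, Complex.norm_real, mul_comm]
    simp only [Complex.mul_re, Complex.neg_re, Complex.neg_im, Complex.ofReal_re,
      Complex.ofReal_im, mul_zero, sub_zero]
    refine mul_le_mul_of_nonneg_right ((hM t (hx.trans ht.le)).trans ?_) (Real.exp_pos _).le
    exact mul_le_mul_of_nonneg_left (Real.exp_le_exp.2 (by nlinarith)) hM0
  rw [MeasureTheory.integral_const_mul, integral_exp_mul_Ioi (by linarith)] at h1
  unfold backwardIntegral
  rw [norm_mul, Complex.norm_exp]
  simp only [Complex.mul_re, Complex.ofReal_re, Complex.ofReal_im, mul_zero, sub_zero]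
  calc Real.exp (a.re * x) * ‖∫ t : ℝ in Set.Ioi x, Complex.exp (-a * t) * (f t : ℂ)‖
      ≤ Real.exp (a.re * x) *
        (M * Real.exp (-η * x) * (-Real.exp (-a.re * x) / -a.re)) :=
        mul_le_mul_of_nonneg_left h1 (Real.exp_pos _).le
    _ = M / a.re * Real.exp (-η * x) * (Real.exp (a.re * x) * Real.exp (-a.re * x)) := by
        rw [neg_div_neg_eq]; ring
    _ = M / a.re * Real.exp (-η * x) := by rw [← Real.exp_add]; simp

end Integrals

/-- Bounded continuous real functions. -/
abbrev BddReal : Type := BoundedContinuousFunction ℝ ℝ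

/-- Bounded continuous complex functions. -/
abbrev BddComplex : Type := BoundedContinuousFunction ℝ ℂ

/-- A linear integral operator on functions on the half-line, as a bounded operator. -/
def halfLineOperator (Φ : (ℝ → ℝ) → ℝ → ℂ)
    (hadd : ∀ (f g : BddReal) x, Φ (f + g) x = Φ f x + Φ g x)
    (hsmul : ∀ (c : ℝ) (f : BddReal) x, Φ (c • ⇑f) x = c * Φ f x)
    (hcont : ∀ f : BddReal, Continuous (Φ f)) (C : ℝ)
    (hC : ∀ (f : BddReal) x, 0 ≤ x → ‖Φ f x‖ ≤ C * ‖f‖) : BddReal →L[ℝ] BddComplex :=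
  LinearMap.mkContinuous
    -- Evaluation at `max x 0` codes functions on the half-line as functions on ℝ that are constant
    -- for x ≤ 0.
    { toFun := fun f => BoundedContinuousFunction.ofNormedAddCommGroup (fun x => Φ f (max x 0))
        ((hcont f).comp (by fun_prop)) (C * ‖f‖) (fun x => hC f _ (le_max_right _ _))
      map_add' := fun f g => by ext x; exact hadd f g _
      map_smul' := fun c f => by ext x; exact hsmul c f _ } (|C|)
    (fun f => by
      rw [BoundedContinuousFunction.norm_le (by positivity)]
      intro x
      exact (hC f _ (le_max_right _ _)).trans
        (mul_le_mul_of_nonneg_right (le_abs_self C) (norm_nonneg _)))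

theorem abs_bdd_le (f : BddReal) (t : ℝ) : |f t| ≤ ‖f‖ := f.norm_coe_le_norm t

theorem abs_bdd_le_exp (f : BddReal) (t : ℝ) : |f t| ≤ ‖f‖ * Real.exp (-0 * t) := by
  simpa using abs_bdd_le f t

/-- `forwardIntegral` as a bounded operator. -/
def forwardOp (a : ℂ) (ha : 0 < a.re) : BddReal →L[ℝ] BddComplex :=
  halfLineOperator (forwardIntegral a)
    (fun f g x => by
      unfold forwardIntegral
      rw [← mul_add, ← intervalIntegral.integral_add
        ((continuous_kernel a f.continuous).intervalIntegrable _ _)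
        ((continuous_kernel a g.continuous).intervalIntegrable _ _)]
      congr 2; funext t; simp [mul_add])
    (fun c f x => by
      unfold forwardIntegral
      rw [mul_left_comm]
      congr 1
      rw [← intervalIntegral.integral_const_mul]
      congr 1; funext t; simp; ring)
    (fun f => continuous_iff_continuousAt.2 fun x =>
      (hasDerivAt_forwardIntegral f.continuous x).continuousAt)
    (1 / a.re)
    (fun f x hx => by
      have := norm_forwardIntegral_le (a := a) (η := 0) ha (fun t _ => abs_bdd_le_exp f t) hx
      simpa [div_eq_inv_mul] using this)

/-- `backwardIntegral` as a bounded operator. -/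
def backwardOp (a : ℂ) (ha : 0 < a.re) : BddReal →L[ℝ] BddComplex :=
  halfLineOperator (backwardIntegral a)
    (fun f g x => by
      unfold backwardIntegral
      rw [← mul_add, ← MeasureTheory.integral_add
        (integrableOn_kernel ha f.continuous (abs_bdd_le f) x)
        (integrableOn_kernel ha g.continuous (abs_bdd_le g) x)]
      congr 2; funext t; simp [mul_add])
    (fun c f x => by
      unfold backwardIntegral
      rw [mul_left_comm]
      congr 1
      rw [← MeasureTheory.integral_const_mul]
      congr 1; funext t; simp; ring)
    (fun f => continuous_iff_continuousAt.2 fun x =>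
      (hasDerivAt_backwardIntegral ha f.continuous (abs_bdd_le f) x).continuousAt)
    (1 / a.re)
    (fun f x hx => by
      have := norm_backwardIntegral_le (a := a) ha le_rfl (fun t _ => abs_bdd_le_exp f t) hx
      simpa [div_eq_inv_mul] using this)

section Operators

variable {a : ℂ} (ha : 0 < a.re)

theorem forwardOp_apply (f : BddReal) (x : ℝ) :
    forwardOp a ha f x = forwardIntegral a f (max x 0) := rfl

theorem backwardOp_apply (f : BddReal) (x : ℝ) :
    backwardOp a ha f x = backwardIntegral a f (max x 0) := rfl

theorem forwardOp_zero (f : BddReal) : forwardOp a ha f 0 = 0 := by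
  simp [forwardOp_apply, forwardIntegral]

theorem hasDeriv_forwardOp (f : BddReal) :
    HasDerivOnHalfLine (forwardOp a ha f) fun x => -a * forwardOp a ha f x + f x := by
  have h : HasDerivOnHalfLine (forwardIntegral a f) fun x => -a * forwardIntegral a f x + f x :=
    fun x _ => (hasDerivAt_forwardIntegral f.continuous x).hasDerivWithinAt
  refine (h.congr fun x hx => ?_).congr_deriv fun x hx => ?_ <;>
  simp [forwardOp_apply, max_eq_left hx]

theorem hasDeriv_backwardOp (f : BddReal) :
    HasDerivOnHalfLine (backwardOp a ha f) fun x => a * backwardOp a ha f x - f x := by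
  have h : HasDerivOnHalfLine (backwardIntegral a f) fun x => a * backwardIntegral a f x - f x :=
    fun x _ => (hasDerivAt_backwardIntegral ha f.continuous (abs_bdd_le f) x).hasDerivWithinAt
  refine (h.congr fun x hx => ?_).congr_deriv fun x hx => ?_ <;>
  simp [backwardOp_apply, max_eq_left hx]

theorem lipschitz_of_hasDerivOnHalfLine {u u' : ℝ → ℂ} {L : ℝ} (hu : HasDerivOnHalfLine u u')
    (hL : ∀ x, 0 ≤ x → ‖u' x‖ ≤ L) (x y : ℝ) :
    ‖u (max x 0) - u (max y 0)‖ ≤ L * |x - y| := by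
  have h := Convex.norm_image_sub_le_of_norm_hasDerivWithin_le (s := Set.Ici 0) (f := u)
    (f' := u') (x := max y 0) (y := max x 0) hu hL (convex_Ici 0)
    (Set.mem_Ici.2 (le_max_right y 0)) (Set.mem_Ici.2 (le_max_right x 0))
  have hL0 : 0 ≤ L := (norm_nonneg _).trans (hL 0 le_rfl)
  refine h.trans (mul_le_mul_of_nonneg_left ?_ hL0)
  rw [Real.norm_eq_abs]
  simpa using abs_max_sub_max_le_abs x y 0

/-- The composition of `forwardOp` with the multiplication by a decaying function is compact. -/
theorem isCompactOperator_forwardOp_mul (n : BddReal) {C η : ℝ} (hη : 0 < η) (hηa : η < a.re)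
    (hn : ∀ t, 0 ≤ t → |n t| ≤ C * Real.exp (-η * t)) :
    IsCompactOperator (forwardOp a ha ∘L ContinuousLinearMap.mul ℝ BddReal n) := by
  have hC : 0 ≤ C := by simpa using (abs_nonneg _).trans (hn 0 le_rfl)
  refine isCompactOperator_of_lipschitz_of_decay _ (η := η) (C := C / (a.re - η))
    (L := (‖a‖ * ‖forwardOp a ha‖ + 1) * ‖n‖)
    (div_nonneg hC (by linarith)) hη (fun f x y => ?_) (fun f x hx => ?_) (fun f x hx => ?_)
  · have := lipschitz_of_hasDerivOnHalfLine (hasDeriv_forwardOp ha (n * f))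
      (L := (‖a‖ * ‖forwardOp a ha‖ + 1) * ‖n‖ * ‖f‖) (fun t _ => ?_) x y
    · simpa [forwardOp_apply] using this
    · have h1 : ‖forwardOp a ha (n * f) t‖ ≤ ‖forwardOp a ha‖ * (‖n‖ * ‖f‖) :=
        (BoundedContinuousFunction.norm_coe_le_norm _ _).trans
          (((forwardOp a ha).le_opNorm _).trans
            (mul_le_mul_of_nonneg_left (norm_mul_le _ _) (norm_nonneg _)))
      have h2 : ‖(((n * f) t : ℝ) : ℂ)‖ ≤ ‖n‖ * ‖f‖ := by
        rw [Complex.norm_real]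
        exact ((n * f).norm_coe_le_norm t).trans (norm_mul_le _ _)
      calc ‖-a * forwardOp a ha (n * f) t + ((n * f) t : ℝ)‖
          ≤ ‖-a * forwardOp a ha (n * f) t‖ + ‖(((n * f) t : ℝ) : ℂ)‖ := norm_add_le _ _
        _ ≤ ‖a‖ * (‖forwardOp a ha‖ * (‖n‖ * ‖f‖)) + ‖n‖ * ‖f‖ := by
            refine add_le_add ?_ h2
            rw [norm_mul, norm_neg]
            exact mul_le_mul_of_nonneg_left h1 (norm_nonneg _)
        _ = (‖a‖ * ‖forwardOp a ha‖ + 1) * ‖n‖ * ‖f‖ := by ring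
  · have := norm_forwardIntegral_le (a := a) (f := n * f) (M := C * ‖f‖) hηa (fun t ht => by
      rw [Pi.mul_apply, abs_mul]
      calc |n t| * |f t| ≤ C * Real.exp (-η * t) * ‖f‖ :=
            mul_le_mul (hn t ht) (abs_bdd_le f t) (abs_nonneg _) (by positivity)
        _ = _ := by ring) hx
    rw [ContinuousLinearMap.comp_apply, forwardOp_apply, max_eq_left hx]
    calc _ ≤ _ := this
      _ = _ := by ring
  · rw [ContinuousLinearMap.comp_apply, forwardOp_apply, forwardOp_apply, max_eq_right hx,
      max_self]

/-- The composition of `backwardOp` with the multiplication by a decaying function is compact. -/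
theorem isCompactOperator_backwardOp_mul (n : BddReal) {C η : ℝ} (hη : 0 < η)
    (hn : ∀ t, 0 ≤ t → |n t| ≤ C * Real.exp (-η * t)) :
    IsCompactOperator (backwardOp a ha ∘L ContinuousLinearMap.mul ℝ BddReal n) := by
  have hC : 0 ≤ C := by simpa using (abs_nonneg _).trans (hn 0 le_rfl)
  refine isCompactOperator_of_lipschitz_of_decay _ (η := η) (C := C / a.re)
    (L := (‖a‖ * ‖backwardOp a ha‖ + 1) * ‖n‖)
    (div_nonneg hC ha.le) hη (fun f x y => ?_) (fun f x hx => ?_) (fun f x hx => ?_)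
  · have := lipschitz_of_hasDerivOnHalfLine (hasDeriv_backwardOp ha (n * f))
      (L := (‖a‖ * ‖backwardOp a ha‖ + 1) * ‖n‖ * ‖f‖) (fun t _ => ?_) x y
    · simpa [backwardOp_apply] using this
    · have h1 : ‖backwardOp a ha (n * f) t‖ ≤ ‖backwardOp a ha‖ * (‖n‖ * ‖f‖) :=
        (BoundedContinuousFunction.norm_coe_le_norm _ _).trans
          (((backwardOp a ha).le_opNorm _).trans
            (mul_le_mul_of_nonneg_left (norm_mul_le _ _) (norm_nonneg _)))
      have h2 : ‖(((n * f) t : ℝ) : ℂ)‖ ≤ ‖n‖ * ‖f‖ := by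
        rw [Complex.norm_real]
        exact ((n * f).norm_coe_le_norm t).trans (norm_mul_le _ _)
      calc ‖a * backwardOp a ha (n * f) t - ((n * f) t : ℝ)‖
          ≤ ‖a * backwardOp a ha (n * f) t‖ + ‖(((n * f) t : ℝ) : ℂ)‖ := norm_sub_le _ _
        _ ≤ ‖a‖ * (‖backwardOp a ha‖ * (‖n‖ * ‖f‖)) + ‖n‖ * ‖f‖ := by
            refine add_le_add ?_ h2
            rw [norm_mul]
            exact mul_le_mul_of_nonneg_left h1 (norm_nonneg _)
        _ = (‖a‖ * ‖backwardOp a ha‖ + 1) * ‖n‖ * ‖f‖ := by ring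
  · have := norm_backwardIntegral_le (a := a) (f := n * f) (M := C * ‖f‖) ha hη.le (fun t ht => by
      rw [Pi.mul_apply, abs_mul]
      calc |n t| * |f t| ≤ C * Real.exp (-η * t) * ‖f‖ :=
            mul_le_mul (hn t ht) (abs_bdd_le f t) (abs_nonneg _) (by positivity)
        _ = _ := by ring) hx
    rw [ContinuousLinearMap.comp_apply, backwardOp_apply, max_eq_left hx]
    calc _ ≤ _ := this
      _ = _ := by ring
  · rw [ContinuousLinearMap.comp_apply, backwardOp_apply, backwardOp_apply, max_eq_right hx,
      max_self]

end Operators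

end DomainWall

end

/-! ### The analytic implicit function theorem for compact perturbations of the identity. -/

open Filter Topology Asymptotics

noncomputable section

namespace DomainWall

open scoped ContDiff in
/-- Analytic implicit function theorem for an equation `y = e s + G (H (p, y))`, `Γ (p, s, y) = 0`
whose linearization is a compact perturbation of the identity with trivial kernel. -/
theorem exists_analytic_solution {P V W : Type*}
    [NormedAddCommGroup P] [NormedSpace ℝ P] [CompleteSpace P]
    [NormedAddCommGroup V] [NormedSpace ℝ V] [FiniteDimensional ℝ V]
    [NormedAddCommGroup W] [NormedSpace ℝ W] [CompleteSpace W]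
    {H : P × W → W} {e : V →L[ℝ] W} {G : W →L[ℝ] W} {Γ : P × (V × W) → V}
    {p₀ : P} {s₀ : V} {y₀ : W} (hH : ContDiffAt ℝ ω H (p₀, y₀))
    (hΓ : ContDiffAt ℝ ω Γ (p₀, (s₀, y₀)))
    (hy₀ : y₀ = e s₀ + G (H (p₀, y₀))) (hΓ₀ : Γ (p₀, (s₀, y₀)) = 0)
    {N : W →L[ℝ] W} (hN : HasFDerivAt (fun y => H (p₀, y)) N y₀)
    {γ : V × W →L[ℝ] V} (hγ : HasFDerivAt (fun u => Γ (p₀, u)) γ (s₀, y₀))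
    (hcomp : IsCompactOperator (G ∘L N))
    (hker : ∀ s y, γ (s, y) = 0 → y = e s + G (N y) → s = 0 ∧ y = 0) :
    ∃ φ : P → V × W, ContDiffAt ℝ ω φ p₀ ∧ φ p₀ = (s₀, y₀) ∧
      ∀ᶠ p in 𝓝 p₀, Γ (p, φ p) = 0 ∧ (φ p).2 = e (φ p).1 + G (H (p, (φ p).2)) := by
  have : CompleteSpace V := FiniteDimensional.complete ℝ V
  have : ProperSpace V := FiniteDimensional.proper_real V
  set F : P × (V × W) → V × W := fun u => (Γ u, u.2.2 - (e u.2.1 + G (H (u.1, u.2.2)))) with hF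
  have hFc : ContDiffAt ℝ ω F (p₀, (s₀, y₀)) := by
    have h1 : ContDiffAt ℝ ω (fun u : P × (V × W) => H (u.1, u.2.2)) (p₀, (s₀, y₀)) :=
      ContDiffAt.comp (p₀, (s₀, y₀)) (g := H) (f := fun u : P × (V × W) => (u.1, u.2.2)) hH
        (by fun_prop)
    have h2 : ContDiffAt ℝ ω (fun u : P × (V × W) => G (H (u.1, u.2.2))) (p₀, (s₀, y₀)) :=
      G.contDiff.contDiffAt.comp _ h1
    have h3 : ContDiffAt ℝ ω (fun u : P × (V × W) => e u.2.1) (p₀, (s₀, y₀)) := by fun_prop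
    have h4 : ContDiffAt ℝ ω (fun u : P × (V × W) => u.2.2) (p₀, (s₀, y₀)) := by fun_prop
    exact hΓ.prodMk (h4.sub (h3.add h2))
  -- The derivative of F in the unknowns is the identity minus T. The first summand and the one with
  -- e factor through the finite-dimensional V, the third is compact by hypothesis.
  set T : V × W →L[ℝ] V × W :=
    ContinuousLinearMap.inl ℝ V W ∘L (ContinuousLinearMap.fst ℝ V W - γ) +
      (ContinuousLinearMap.inr ℝ V W ∘L (e ∘L ContinuousLinearMap.fst ℝ V W) +
      ContinuousLinearMap.inr ℝ V W ∘L ((G ∘L N) ∘L ContinuousLinearMap.snd ℝ V W)) with hT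
  have hTc : IsCompactOperator T := by
    have h1 : IsCompactOperator
        (ContinuousLinearMap.inl ℝ V W ∘L (ContinuousLinearMap.fst ℝ V W - γ)) :=
      (isCompactOperator_of_locallyCompactSpace_dom
        (ContinuousLinearMap.fst ℝ V W - γ)).clm_comp (ContinuousLinearMap.inl ℝ V W)
    have h2 : IsCompactOperator
        (ContinuousLinearMap.inr ℝ V W ∘L (e ∘L ContinuousLinearMap.fst ℝ V W)) :=
      ((isCompactOperator_of_locallyCompactSpace_rng e).comp_clm
        (ContinuousLinearMap.fst ℝ V W)).clm_comp (ContinuousLinearMap.inr ℝ V W)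
    have h3 : IsCompactOperator
        (ContinuousLinearMap.inr ℝ V W ∘L ((G ∘L N) ∘L ContinuousLinearMap.snd ℝ V W)) :=
      (hcomp.comp_clm (ContinuousLinearMap.snd ℝ V W)).clm_comp (ContinuousLinearMap.inr ℝ V W)
    exact h1.add (h2.add h3)
  set L : V × W →L[ℝ] V × W := ContinuousLinearMap.id ℝ (V × W) - T with hL
  have hLapp : ∀ s y, L (s, y) = (γ (s, y), y - (e s + G (N y))) := by
    intro s y
    simp [hL, hT]
  have hFd : HasFDerivAt (fun u => F (p₀, u)) L (s₀, y₀) := by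
    have h1 : HasFDerivAt (fun u : V × W => H (p₀, u.2)) (N ∘L ContinuousLinearMap.snd ℝ V W)
        (s₀, y₀) := HasFDerivAt.comp (s₀, y₀) (f := fun u : V × W => u.2) hN hasFDerivAt_snd
    have h2 := G.hasFDerivAt.comp (s₀, y₀) h1
    have h3 : HasFDerivAt (fun u : V × W => e u.1) (e ∘L ContinuousLinearMap.fst ℝ V W) (s₀, y₀) :=
      (e ∘L ContinuousLinearMap.fst ℝ V W).hasFDerivAt
    have h4 : HasFDerivAt (fun u : V × W => u.2) (ContinuousLinearMap.snd ℝ V W) (s₀, y₀) :=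
      hasFDerivAt_snd
    have h5 := hγ.prodMk (h4.sub (h3.add h2))
    refine h5.congr_fderiv ?_
    ext u
    · simp [hLapp]
    · simp [hLapp]
    · simp [hLapp]
    · simp [hLapp]
  have hbij : Function.Bijective L := by
    -- Fredholm alternative at 1: an eigenvector of T would be a nonzero element of the kernel
    -- excluded by `hker`.
    rcases hTc.hasEigenvalue_or_mem_resolventSet (one_ne_zero (α := ℝ)) with h | h
    · exfalso
      obtain ⟨⟨s, y⟩, hv⟩ := h.exists_hasEigenvector
      have hv1 : T (s, y) = (s, y) := by simpa using hv.apply_eq_smul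
      have hL0 : L (s, y) = 0 := by simp [hL, hv1]
      rw [hLapp, Prod.mk_eq_zero] at hL0
      obtain ⟨h1, h2⟩ := hker s y hL0.1 (sub_eq_zero.1 hL0.2)
      exact hv.2 (by simp [h1, h2])
    · rw [spectrum.mem_resolventSet_iff, map_one, ContinuousLinearMap.isUnit_iff_bijective] at h
      exact h
  have hinv : (fderiv ℝ F (p₀, (s₀, y₀)) ∘L ContinuousLinearMap.inr ℝ P (V × W)).IsInvertible := by
    have h1 : HasFDerivAt (fun u => F (p₀, u))
        (fderiv ℝ F (p₀, (s₀, y₀)) ∘L ContinuousLinearMap.inr ℝ P (V × W)) (s₀, y₀) :=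
      HasFDerivAt.comp (s₀, y₀) (g := F) (f := fun u => (p₀, u))
        (hFc.differentiableAt (by simp)).hasFDerivAt (hasFDerivAt_prodMk_right p₀ (s₀, y₀))
    rw [h1.unique hFd]
    exact ⟨ContinuousLinearEquiv.ofBijective L (LinearMap.ker_eq_bot.2 hbij.1)
      (LinearMap.range_eq_top.2 hbij.2), rfl⟩
  refine ⟨hFc.implicitFunction (by simp) hinv, hFc.contDiffAt_implicitFunction (by simp) hinv,
    hFc.implicitFunction_apply_self (by simp) hinv, ?_⟩
  have hF0 : F (p₀, (s₀, y₀)) = 0 := by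
    simp only [hF, hΓ₀, Prod.mk_eq_zero, true_and]
    exact sub_eq_zero.2 hy₀
  filter_upwards [hFc.eventually_apply_implicitFunction (by simp) hinv] with p hp
  rw [hF0, Prod.mk_eq_zero] at hp
  exact ⟨hp.1, sub_eq_zero.1 hp.2⟩

end DomainWall

end

/-! ### Linear problems in exponentially weighted spaces. -/

open Filter Topology Asymptotics

noncomputable section

namespace DomainWall

/-- Data of the linear problem `ξ' = -a ξ + c e^{-η x} h`, `ζ' = a ζ - c e^{-η x} h` on the
half-line, in the space of functions that are `O(e^{-η x})`. -/
structure Channel where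
  a : ℂ
  c : ℂ
  η : ℝ
  η_pos : 0 < η
  η_lt : η < a.re

namespace Channel

variable (K : Channel)

theorem sub_re_pos : 0 < (K.a - K.η).re := by simpa using K.η_lt

theorem add_re_pos : 0 < (K.a + K.η).re := by
  have := K.η_lt; have := K.η_pos
  simp only [Complex.add_re, Complex.ofReal_re]
  linarith

/-- The stable component with initial value `s`, up to the factor `e^{-η x}`. -/
def stable (s : ℂ) (h : BddReal) (x : ℝ) : ℂ :=
  s * Complex.exp (-(K.a - K.η) * x) + K.c * forwardOp (K.a - K.η) K.sub_re_pos h x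

/-- The unstable component, up to the factor `e^{-η x}`. -/
def unstable (h : BddReal) (x : ℝ) : ℂ :=
  K.c * backwardOp (K.a + K.η) K.add_re_pos h x

/-- The successive derivatives of the solution. -/
def jet (j : ℕ) (s : ℂ) (h : BddReal) (x : ℝ) : ℝ :=
  Real.exp (-K.η * x) * ((-K.a) ^ j * K.stable s h x + K.a ^ j * K.unstable h x).re

theorem hasDeriv_stable (s : ℂ) (h : BddReal) :
    HasDerivOnHalfLine (K.stable s h)
      fun x => -(K.a - K.η) * K.stable s h x + K.c * h x := by
  intro x hx
  have h1 := ((hasDerivAt_cexp (-(K.a - K.η)) x).const_mul s).hasDerivWithinAt (s := Set.Ici 0)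
  have h2 := ((hasDeriv_forwardOp (ha := K.sub_re_pos) h) x hx).const_mul K.c
  refine (h1.add h2).congr_deriv ?_
  unfold stable
  ring

theorem hasDeriv_unstable (h : BddReal) :
    HasDerivOnHalfLine (K.unstable h)
      fun x => (K.a + K.η) * K.unstable h x - K.c * h x := by
  intro x hx
  have h2 := ((hasDeriv_backwardOp (ha := K.add_re_pos) h) x hx).const_mul K.c
  refine h2.congr_deriv ?_
  unfold unstable
  ring

/-- The forcing enters the stable and unstable components with opposite signs, so it survives in the
derivative of order j only through Re(c((-a)^j - a^j)). The constant c of each channel makes this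
zero below the top order and one at the top order. -/
theorem hasDeriv_jet (j : ℕ) (s : ℂ) (h : BddReal) :
    HasDerivOnHalfLine (K.jet j s h) fun x =>
      K.jet (j + 1) s h x + (K.c * ((-K.a) ^ j - K.a ^ j)).re * (Real.exp (-K.η * x) * h x) := by
  intro x hx
  have h1 := (K.hasDeriv_stable s h x hx).const_mul ((-K.a) ^ j)
  have h2 := (K.hasDeriv_unstable h x hx).const_mul (K.a ^ j)
  have h3 := (Complex.reCLM.hasFDerivAt.comp_hasDerivWithinAt x (h1.add h2))
  have h4 := (HasDerivOnHalfLine.exp_mul (-K.η) x hx).mul h3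
  refine h4.congr_deriv ?_
  simp only [jet, Complex.reCLM_apply, Function.comp, Pi.add_apply]
  have e : (-K.a) ^ j * (-(K.a - K.η) * K.stable s h x + K.c * h x)
      + K.a ^ j * ((K.a + K.η) * K.unstable h x - K.c * h x) =
      ((-K.a) ^ (j + 1) * K.stable s h x + K.a ^ (j + 1) * K.unstable h x)
      + (K.η : ℂ) * ((-K.a) ^ j * K.stable s h x + K.a ^ j * K.unstable h x)
      + K.c * ((-K.a) ^ j - K.a ^ j) * ((h x : ℝ) : ℂ) := by ring
  rw [e]
  simp only [Complex.add_re, Complex.re_ofReal_mul, Complex.re_mul_ofReal]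
  ring

theorem norm_cexp_le_one {a : ℂ} (ha : 0 < a.re) {x : ℝ} (hx : 0 ≤ x) :
    ‖Complex.exp (-a * x)‖ ≤ 1 := by
  rw [Complex.norm_exp]
  refine Real.exp_le_one_iff.2 ?_
  simp only [Complex.re_mul_ofReal, Complex.neg_re]
  nlinarith

theorem tendsto_jet (j : ℕ) (s : ℂ) (h : BddReal) :
    Tendsto (K.jet j s h) atTop (𝓝 0) := by
  set C : ℝ := ‖(-K.a) ^ j‖ * (‖s‖ + ‖K.c‖ * ‖forwardOp (K.a - K.η) K.sub_re_pos h‖) +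
    ‖K.a ^ j‖ * (‖K.c‖ * ‖backwardOp (K.a + K.η) K.add_re_pos h‖) with hC
  have hb : ∀ᶠ x in atTop, ‖K.jet j s h x‖ ≤ Real.exp (-K.η * x) * C := by
    filter_upwards [eventually_ge_atTop 0] with x hx
    unfold jet
    rw [norm_mul, Real.norm_of_nonneg (Real.exp_pos _).le]
    refine mul_le_mul_of_nonneg_left ?_ (Real.exp_pos _).le
    refine (Complex.abs_re_le_norm _).trans ((norm_add_le _ _).trans ?_)
    rw [norm_mul, norm_mul]
    have h1 : ‖K.stable s h x‖ ≤ ‖s‖ + ‖K.c‖ * ‖forwardOp (K.a - K.η) K.sub_re_pos h‖ := by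
      unfold stable
      refine (norm_add_le _ _).trans ?_
      rw [norm_mul, norm_mul]
      refine add_le_add (mul_le_of_le_one_right (norm_nonneg _)
        (norm_cexp_le_one K.sub_re_pos hx)) ?_
      exact mul_le_mul_of_nonneg_left (BoundedContinuousFunction.norm_coe_le_norm _ _)
        (norm_nonneg _)
    have h2 : ‖K.unstable h x‖ ≤ ‖K.c‖ * ‖backwardOp (K.a + K.η) K.add_re_pos h‖ := by
      unfold unstable
      rw [norm_mul]
      exact mul_le_mul_of_nonneg_left (BoundedContinuousFunction.norm_coe_le_norm _ _)
        (norm_nonneg _)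
    exact add_le_add (mul_le_mul_of_nonneg_left h1 (norm_nonneg _))
      (mul_le_mul_of_nonneg_left h2 (norm_nonneg _))
  refine squeeze_zero_norm' hb ?_
  have h1 : Tendsto (fun x : ℝ => Real.exp (-K.η * x)) atTop (𝓝 0) :=
    Real.tendsto_exp_comp_nhds_zero.2 (tendsto_id.const_mul_atTop_of_neg (by simpa using K.η_pos))
  simpa using h1.mul_const C

/-- Real parts of bounded functions. -/
def reOp : BddComplex →L[ℝ] BddReal :=
  Complex.reCLM.compLeftContinuousBounded ℝ

/-- The bounded function `e^{-(a - η) x}`. -/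
def decay : BddComplex :=
  BoundedContinuousFunction.ofNormedAddCommGroup
    (fun x => Complex.exp (-(K.a - K.η) * (max x 0 : ℝ))) (by fun_prop) 1
    fun x => norm_cexp_le_one K.sub_re_pos (le_max_right x 0)

/-- The solutions of the homogeneous problem. -/
def freeOp : ℂ →L[ℝ] BddReal :=
  reOp ∘L (ContinuousLinearMap.id ℝ ℂ).smulRight K.decay

/-- The particular solution of the inhomogeneous problem. -/
def integralOp : BddReal →L[ℝ] BddReal :=
  reOp ∘L (K.c • (forwardOp (K.a - K.η) K.sub_re_pos + backwardOp (K.a + K.η) K.add_re_pos))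

theorem freeOp_apply (s : ℂ) (x : ℝ) :
    K.freeOp s x = (s * Complex.exp (-(K.a - K.η) * (max x 0 : ℝ))).re := rfl

theorem integralOp_apply (h : BddReal) (x : ℝ) :
    K.integralOp h x = (K.c * (forwardOp (K.a - K.η) K.sub_re_pos h x +
      backwardOp (K.a + K.η) K.add_re_pos h x)).re := rfl

theorem jet_zero (s : ℂ) (h : BddReal) {x : ℝ} (hx : 0 ≤ x) :
    K.jet 0 s h x = Real.exp (-K.η * x) * (K.freeOp s x + K.integralOp h x) := by
  rw [freeOp_apply, integralOp_apply, max_eq_left hx, ← Complex.add_re]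
  simp only [jet, stable, unstable, pow_zero, one_mul]
  congr 2
  ring

theorem free_add_integral_max (s : ℂ) (h : BddReal) (x : ℝ) :
    K.freeOp s x + K.integralOp h x =
      K.freeOp s (max x 0) + K.integralOp h (max x 0) := by
  simp [freeOp_apply, integralOp_apply, forwardOp_apply, backwardOp_apply]

/-- The value of `jet` at the origin. -/
def jetStart (j : ℕ) : ℂ × BddReal →L[ℝ] ℝ :=
  Complex.reCLM ∘L ((-K.a) ^ j • ContinuousLinearMap.fst ℝ ℂ BddReal +
    (K.a ^ j * K.c) • (BoundedContinuousFunction.evalCLM ℝ (0 : ℝ) ∘L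
      backwardOp (K.a + K.η) K.add_re_pos ∘L ContinuousLinearMap.snd ℝ ℂ BddReal))

theorem jetStart_apply (j : ℕ) (s : ℂ) (h : BddReal) :
    K.jetStart j (s, h) = ((-K.a) ^ j * s + K.a ^ j * K.unstable h 0).re := by
  simp [jetStart, unstable, mul_assoc]

theorem jet_at_zero (j : ℕ) (s : ℂ) (h : BddReal) : K.jet j s h 0 = K.jetStart j (s, h) := by
  rw [jetStart_apply]
  simp [jet, stable, forwardOp_zero]

theorem isCompactOperator_integralOp_mul (n : BddReal) {C η' : ℝ} (hη : 0 < η')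
    (hηa : η' < K.a.re - K.η) (hn : ∀ t, 0 ≤ t → |n t| ≤ C * Real.exp (-η' * t)) :
    IsCompactOperator (K.integralOp ∘L ContinuousLinearMap.mul ℝ BddReal n) := by
  have h1 := isCompactOperator_forwardOp_mul (ha := K.sub_re_pos) n hη (by simpa using hηa) hn
  have h2 := isCompactOperator_backwardOp_mul (ha := K.add_re_pos) n hη hn
  have h3 := ((h1.add h2).smul K.c).clm_comp reOp
  exact h3

end Channel

end DomainWall

end

/-! ### The channels of the fast and the slow equation. -/

open Filter Topology Asymptotics

noncomputable section

namespace DomainWall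

/-- The channel of the equation `A'''' + D⁴ A = h`. -/
def channelA (D ε : ℝ) (hε : 0 < ε) (h : ε ≤ D) : Channel where
  -- Here a⁴ = -D⁴ with Re a > 0, and c is fixed by -2 c a³ = 1; then -2 c a is purely imaginary, so
  -- the forcing does not enter the second derivative. One complex pair thus carries the four real
  -- modes.
  a := (D / √2 : ℝ) * (1 - Complex.I)
  c := (1 / (2 * √2 * D ^ 3) : ℝ) * (1 - Complex.I)
  η := ε / 4
  η_pos := by positivity
  η_lt := by
    have hs2 : √2 ^ 2 = 2 := Real.sq_sqrt (by norm_num)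
    have hs0 : 0 < √2 := by positivity
    rw [Complex.re_ofReal_mul]
    simp only [Complex.sub_re, Complex.one_re, Complex.I_re, sub_zero, mul_one]
    rw [lt_div_iff₀ hs0]
    nlinarith

/-- The channel of the equation `B'' - 2 ε² B = h`. -/
def channelB (ε : ℝ) (hε : 0 < ε) : Channel where
  a := (√2 * ε : ℝ)
  -- Fixed by -2 c a = 1, the normalization of a second order equation.
  c := (-(1 / (2 * √2 * ε)) : ℝ)
  η := ε / 4
  η_pos := by positivity
  η_lt := by
    have hs2 : √2 ^ 2 = 2 := Real.sq_sqrt (by norm_num)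
    have hs0 : 0 < √2 := by positivity
    rw [Complex.ofReal_re]
    nlinarith

section Channels

variable {D ε : ℝ} (hε : 0 < ε) (h : ε ≤ D)

/-- Room for a second factor e^{-εx/4}: the multipliers in the linearization decay at this rate on
top of the weight, and the sum ε/2 must stay below Re a. -/
theorem channelA_gap : ε / 4 < (channelA D ε hε h).a.re - (channelA D ε hε h).η := by
  have hs2 : √2 ^ 2 = 2 := Real.sq_sqrt (by norm_num)
  have hs0 : 0 < √2 := by positivity
  have h1 : ε / 2 < D / √2 := by
    rw [lt_div_iff₀ hs0]
    nlinarith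
  simp only [channelA, Complex.re_ofReal_mul, Complex.sub_re, Complex.one_re, Complex.I_re,
    sub_zero, mul_one]
  linarith

theorem channelB_gap : ε / 4 < (channelB ε hε).a.re - (channelB ε hε).η := by
  have hs2 : √2 ^ 2 = 2 := Real.sq_sqrt (by norm_num)
  have hs0 : 0 < √2 := by positivity
  simp only [channelB, Complex.ofReal_re]
  nlinarith

theorem channelA_a_sq : (channelA D ε hε h).a ^ 2 = -(D ^ 2 : ℝ) * Complex.I := by
  have hs2 : √2 ^ 2 = 2 := Real.sq_sqrt (by norm_num)
  have e : (D / √2) ^ 2 = D ^ 2 / 2 := by rw [div_pow, hs2]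
  simp only [channelA, mul_pow]
  rw [← Complex.ofReal_pow, e]
  have hI := Complex.I_sq
  push_cast
  linear_combination (D : ℂ) ^ 2 / 2 * hI

theorem channelA_mul : (channelA D ε hε h).c * (channelA D ε hε h).a =
    -(1 / (2 * D ^ 2) : ℝ) * Complex.I := by
  have hD : D ≠ 0 := (hε.trans_le h).ne'
  have hs2 : √2 ^ 2 = 2 := Real.sq_sqrt (by norm_num)
  have e : 1 / (2 * √2 * D ^ 3) * (D / √2) = 1 / (4 * D ^ 2) := by
    field_simp
    rw [hs2]; norm_num
  have e2 : (1 / (2 * D ^ 2) : ℝ) = 2 * (1 / (4 * D ^ 2)) := by field_simp; norm_num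
  rw [e2, ← e]
  simp only [channelA]
  have hI := Complex.I_sq
  push_cast
  linear_combination (1 / (2 * (√2 : ℂ) * D ^ 3) * (D / (√2 : ℂ))) * hI

theorem channelA_jet (s : ℂ) (f : BddReal) :
    HasDerivOnHalfLine ((channelA D ε hε h).jet 0 s f) ((channelA D ε hε h).jet 1 s f) ∧
    HasDerivOnHalfLine ((channelA D ε hε h).jet 1 s f) ((channelA D ε hε h).jet 2 s f) ∧
    HasDerivOnHalfLine ((channelA D ε hε h).jet 2 s f) ((channelA D ε hε h).jet 3 s f) ∧
    HasDerivOnHalfLine ((channelA D ε hε h).jet 3 s f) fun x =>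
      -D ^ 4 * (channelA D ε hε h).jet 0 s f x + Real.exp (-(ε / 4) * x) * f x := by
  have hD : (D : ℂ) ≠ 0 := by exact_mod_cast (hε.trans_le h).ne'
  have hI := Complex.I_sq
  set K := channelA D ε hε h with hK
  have hsq : K.a ^ 2 = _ := channelA_a_sq hε h
  have hm : K.c * K.a = _ := channelA_mul hε h
  refine ⟨(K.hasDeriv_jet 0 s f).congr_deriv fun x _ => ?_,
    (K.hasDeriv_jet 1 s f).congr_deriv fun x _ => ?_,
    (K.hasDeriv_jet 2 s f).congr_deriv fun x _ => ?_,
    (K.hasDeriv_jet 3 s f).congr_deriv fun x _ => ?_⟩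
  · simp
  · have e : K.c * ((-K.a) ^ 1 - K.a ^ 1) = ((1 / D ^ 2 : ℝ) : ℂ) * Complex.I := by
      push_cast at hm ⊢
      linear_combination -2 * hm
    rw [e, Complex.re_ofReal_mul]
    simp
  · simp
  · have e : K.c * ((-K.a) ^ 3 - K.a ^ 3) = 1 := by
      have h1 : K.c * ((-K.a) ^ 3 - K.a ^ 3) = -2 * ((K.c * K.a) * K.a ^ 2) := by ring
      rw [h1, hm, hsq]
      push_cast
      field_simp
      linear_combination - hI
    have e4 : K.a ^ 4 = -(D ^ 4 : ℝ) := by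
      have h1 : K.a ^ 4 = (K.a ^ 2) ^ 2 := by ring
      rw [h1, hsq]
      push_cast
      linear_combination (D : ℂ) ^ 4 * hI
    have e4' : (-K.a) ^ 4 = -(D ^ 4 : ℝ) := by rw [← e4]; ring
    rw [e, Complex.one_re, one_mul]
    congr 1
    simp only [Channel.jet, Nat.reduceAdd, e4, e4', pow_zero, one_mul]
    rw [← mul_add, ← Complex.ofReal_neg, Complex.re_ofReal_mul]
    ring

theorem channelB_jet (s : ℂ) (f : BddReal) :
    HasDerivOnHalfLine ((channelB ε hε).jet 0 s f) ((channelB ε hε).jet 1 s f) ∧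
    HasDerivOnHalfLine ((channelB ε hε).jet 1 s f) fun x =>
      2 * ε ^ 2 * (channelB ε hε).jet 0 s f x + Real.exp (-(ε / 4) * x) * f x := by
  have hs2 : √2 ^ 2 = 2 := Real.sq_sqrt (by norm_num)
  have hs0 : √2 ≠ 0 := by positivity
  set K := channelB ε hε with hK
  refine ⟨(K.hasDeriv_jet 0 s f).congr_deriv fun x _ => by simp,
    (K.hasDeriv_jet 1 s f).congr_deriv fun x _ => ?_⟩
  have e : (K.c * ((-K.a) ^ 1 - K.a ^ 1)).re = 1 := by
    have h1 : K.c * ((-K.a) ^ 1 - K.a ^ 1) = ((2 * (1 / (2 * √2 * ε)) * (√2 * ε) : ℝ) : ℂ) := by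
      simp only [hK, channelB]
      push_cast
      ring
    rw [h1, Complex.ofReal_re]
    field_simp
  have e2 : K.a ^ 2 = (2 * ε ^ 2 : ℝ) := by
    simp only [hK, channelB]
    rw [← Complex.ofReal_pow, mul_pow, hs2]
  rw [e, one_mul]
  congr 1
  simp only [Channel.jet, Nat.reduceAdd, even_two, Even.neg_pow, e2, pow_zero, one_mul]
  rw [← mul_add, Complex.re_ofReal_mul]
  ring

/-- The forward integral vanishes at 0, so there the forcing contributes only to Y, and the complex
datum s is exactly x₁ + i x₂ in the frame D. -/
theorem channelA_coords (s : ℂ) (f : BddReal) :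
    coordX₁ D ((channelA D ε hε h).jet 0 s f 0) ((channelA D ε hε h).jet 1 s f 0)
      ((channelA D ε hε h).jet 3 s f 0) = s.re ∧
    coordX₂ D ((channelA D ε hε h).jet 1 s f 0) ((channelA D ε hε h).jet 2 s f 0)
      ((channelA D ε hε h).jet 3 s f 0) = s.im := by
  have hD : 0 < D := hε.trans_le h
  set K := channelA D ε hε h with hK
  have hsq : K.a ^ 2 = _ := channelA_a_sq hε h
  set ζ := K.unstable f 0
  have ha : K.a = (D / √2 : ℝ) * (1 - Complex.I) := rfl
  have h0 : K.jet 0 s f 0 = s.re + ζ.re := by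
    simp [Channel.jet_at_zero, Channel.jetStart_apply, ζ]
  have h1 : K.jet 1 s f 0 = -(D / √2) * (s.re - ζ.re + s.im - ζ.im) := by
    rw [Channel.jet_at_zero, Channel.jetStart_apply]
    have : (-K.a) ^ 1 * s + K.a ^ 1 * ζ = ((D / √2 : ℝ) : ℂ) * ((1 - Complex.I) * (ζ - s)) := by
      rw [ha]; ring
    rw [this, Complex.re_ofReal_mul]
    simp only [Complex.mul_re, Complex.sub_re, Complex.sub_im, Complex.one_re, Complex.one_im,
      Complex.I_re, Complex.I_im]
    ring
  have h2 : K.jet 2 s f 0 = D ^ 2 * (s.im + ζ.im) := by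
    rw [Channel.jet_at_zero, Channel.jetStart_apply]
    have : (-K.a) ^ 2 * s + K.a ^ 2 * ζ = ((D ^ 2 : ℝ) : ℂ) * (-Complex.I * (ζ + s)) := by
      rw [neg_sq, hsq]; ring
    rw [this, Complex.re_ofReal_mul]
    simp only [Complex.mul_re, Complex.add_re, Complex.add_im, Complex.neg_re, Complex.neg_im,
      Complex.I_re, Complex.I_im]
    ring
  have h3 : K.jet 3 s f 0 = D ^ 3 / √2 * (s.re - ζ.re - s.im + ζ.im) := by
    rw [Channel.jet_at_zero, Channel.jetStart_apply]
    have : (-K.a) ^ 3 * s + K.a ^ 3 * ζ =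
        ((D ^ 2 * (D / √2) : ℝ) : ℂ) * (-Complex.I * (1 - Complex.I) * (ζ - s)) := by
      have : (-K.a) ^ 3 * s + K.a ^ 3 * ζ = K.a ^ 2 * (K.a * (ζ - s)) := by ring
      rw [this, hsq, ha]; push_cast; ring
    rw [this, Complex.re_ofReal_mul]
    simp only [Complex.mul_re, Complex.mul_im, Complex.sub_re, Complex.sub_im, Complex.one_re,
      Complex.one_im, Complex.neg_re, Complex.neg_im, Complex.I_re, Complex.I_im]
    ring
  obtain ⟨k1, k2, -, -⟩ := coords_ofCoords hD h0 h1 h2 h3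
  exact ⟨k1, k2⟩

end Channels

end DomainWall

end

/-! ### The nonlinearity in weighted variables and compactness of its linearization. -/

open Filter Topology Asymptotics

noncomputable section

namespace DomainWall

/-- The parameters `(ε, δ, X, b)`. -/
abbrev Params : Type := ℝ × ℝ × Plane × ℝ

/-- The weight `e^{-ε x / 4}`. -/
def weight (ε : ℝ) (hε : 0 < ε) : BddReal :=
  BoundedContinuousFunction.ofNormedAddCommGroup
    (fun x => Real.exp (-(ε / 4) * max x 0)) (by fun_prop) 1 fun x => by
      rw [Real.norm_of_nonneg (Real.exp_pos _).le]
      refine Real.exp_le_one_iff.2 ?_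
      have := le_max_right x 0
      nlinarith

theorem weight_apply {ε : ℝ} (hε : 0 < ε) (x : ℝ) :
    weight ε hε x = Real.exp (-(ε / 4) * max x 0) := rfl

theorem weight_apply_of_nonneg {ε : ℝ} (hε : 0 < ε) {x : ℝ} (hx : 0 ≤ x) :
    weight ε hε x = Real.exp (-(ε / 4) * x) := by rw [weight_apply, max_eq_left hx]

/-- The right hand side of `A'''' + μ A = …`, with `A = E v`, `B = 1 + E w`, divided by `E`. -/
def fieldA (E : BddReal) (μ δ : ℝ) (y : BddReal × BddReal) : BddReal :=
  -- The first term vanishes at the base parameter μ = δ²; every other term keeps a factor E. At the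
  -- base point the derivative is therefore multiplication by decaying functions, the source of
  -- compactness. The same holds for `fieldB` with μ = 2ε².
  (μ - δ ^ 2) • y.1 - E * E * (y.1 * y.1 * y.1) - (2 * (1 + δ ^ 2)) • (E * (y.1 * y.2))
    - (1 + δ ^ 2) • (E * E * (y.1 * y.2 * y.2))

/-- The right hand side of `B'' - μ (B - 1) = …`, with `A = E v`, `B = 1 + E w`, divided by `E`. -/
def fieldB (E : BddReal) (μ ε δ : ℝ) (y : BddReal × BddReal) : BddReal :=
  ε ^ 2 • ((1 + E * y.2) * ((1 + δ ^ 2) • (E * (y.1 * y.1)) + (2 : ℝ) • y.2 + E * (y.2 * y.2)))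
    - μ • y.2

theorem mul_fieldA_apply (E : BddReal) (μ δ : ℝ) (y : BddReal × BddReal) (x : ℝ) :
    E x * fieldA E μ δ y x = μ * (E x * y.1 x) + E x * y.1 x *
      (1 - (E x * y.1 x) ^ 2 - (1 + δ ^ 2) * (1 + E x * y.2 x) ^ 2) := by
  simp [fieldA]
  ring

theorem mul_fieldB_apply (E : BddReal) (μ ε δ : ℝ) (y : BddReal × BddReal) (x : ℝ) :
    E x * fieldB E μ ε δ y x = ε ^ 2 * (1 + E x * y.2 x) *
      (-1 + (1 + δ ^ 2) * (E x * y.1 x) ^ 2 + (1 + E x * y.2 x) ^ 2) - μ * (E x * y.2 x) := by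
  simp [fieldB]
  ring

/-- The nonlinearity at all parameters, for the base point `(ε₀, δ₀)`. -/
def field (E : BddReal) (ε₀ δ₀ : ℝ) (u : Params × (BddReal × BddReal)) : BddReal × BddReal :=
  -- The weight and the linear part are frozen at the base point. The integral operators thus do not
  -- move with (ε, δ), and all dependence on parameters and unknowns is polynomial.
  (fieldA E (δ₀ ^ 2) u.1.2.1 u.2, fieldB E (2 * ε₀ ^ 2) u.1.1 u.1.2.1 u.2)

open scoped ContDiff in
theorem contDiff_field (E : BddReal) (ε₀ δ₀ : ℝ) : ContDiff ℝ ω (field E ε₀ δ₀) := by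
  unfold field fieldA fieldB
  fun_prop

/-- The partial derivatives of the nonlinearity at the base point, up to a factor `E`. -/
def slopeAA (E : BddReal) (δ : ℝ) (y : BddReal × BddReal) : BddReal :=
  -((3 : ℝ) • (E * (y.1 * y.1))) - (2 * (1 + δ ^ 2)) • y.2 - (1 + δ ^ 2) • (E * (y.2 * y.2))

/-- See `slopeAA`. -/
def slopeAB (E : BddReal) (δ : ℝ) (y : BddReal × BddReal) : BddReal :=
  -((2 * (1 + δ ^ 2)) • y.1) - (2 * (1 + δ ^ 2)) • (E * (y.1 * y.2))

/-- See `slopeAA`. -/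
def slopeBA (E : BddReal) (ε δ : ℝ) (y : BddReal × BddReal) : BddReal :=
  (2 * (1 + δ ^ 2) * ε ^ 2) • ((1 + E * y.2) * y.1)

/-- See `slopeAA`. -/
def slopeBB (E : BddReal) (ε δ : ℝ) (y : BddReal × BddReal) : BddReal :=
  ε ^ 2 • ((1 + δ ^ 2) • (E * (y.1 * y.1)) + (6 : ℝ) • y.2 + (3 : ℝ) • (E * (y.2 * y.2)))

/-- Multiplication by a bounded function. -/
abbrev mulOp (n : BddReal) : BddReal →L[ℝ] BddReal := ContinuousLinearMap.mul ℝ BddReal n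

/-- The derivative of the nonlinearity at the base point. -/
def fieldDeriv (E : BddReal) (ε δ : ℝ) (y : BddReal × BddReal) :
    BddReal × BddReal →L[ℝ] BddReal × BddReal :=
  (mulOp (E * slopeAA E δ y) ∘L ContinuousLinearMap.fst ℝ BddReal BddReal +
    mulOp (E * slopeAB E δ y) ∘L ContinuousLinearMap.snd ℝ BddReal BddReal).prod
  (mulOp (E * slopeBA E ε δ y) ∘L ContinuousLinearMap.fst ℝ BddReal BddReal +
    mulOp (E * slopeBB E ε δ y) ∘L ContinuousLinearMap.snd ℝ BddReal BddReal)

theorem hasFDerivAt_field (E : BddReal) (ε δ b : ℝ) (X : Plane) (y : BddReal × BddReal) :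
    HasFDerivAt (fun y => field E ε δ ((ε, δ, X, b), y)) (fieldDeriv E ε δ y) y := by
  have hv : HasFDerivAt (fun y : BddReal × BddReal => y.1)
    (ContinuousLinearMap.fst ℝ BddReal BddReal) y := hasFDerivAt_fst
  have hw : HasFDerivAt (fun y : BddReal × BddReal => y.2)
    (ContinuousLinearMap.snd ℝ BddReal BddReal) y := hasFDerivAt_snd
  have hA := ((((hv.const_smul (δ ^ 2 - δ ^ 2)).sub (((hv.mul hv).mul hv).const_mul (E * E))).sub
    (((hv.mul hw).const_mul E).const_smul (2 * (1 + δ ^ 2)))).sub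
    (((((hv.mul hw).mul hw).const_mul (E * E))).const_smul (1 + δ ^ 2)))
  have hB := ((((hw.const_mul E).const_add 1).mul
    (((((hv.mul hv).const_mul E).const_smul (1 + δ ^ 2)).add (hw.const_smul (2 : ℝ))).add
      ((hw.mul hw).const_mul E))).const_smul (ε ^ 2)).sub (hw.const_smul (2 * ε ^ 2))
  refine (hA.prodMk hB).congr_fderiv ?_
  refine ContinuousLinearMap.ext fun u => ?_
  refine Prod.ext ?_ ?_
  · ext x
    simp [fieldDeriv, slopeAA, slopeAB]
    ring
  · ext x
    simp [fieldDeriv, slopeBA, slopeBB]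
    ring

section Linearized

variable {ε δ : ℝ} (hε : 0 < ε) (h : ε ≤ √δ)

/-- The homogeneous solutions. -/
def freePart : ℂ × ℝ →L[ℝ] BddReal × BddReal :=
  ((channelA (√δ) ε hε h).freeOp ∘L ContinuousLinearMap.fst ℝ ℂ ℝ).prod
    ((channelB ε hε).freeOp ∘L (Complex.ofRealCLM ∘L ContinuousLinearMap.snd ℝ ℂ ℝ))

/-- The particular solutions. -/
def integralPart : BddReal × BddReal →L[ℝ] BddReal × BddReal :=
  ((channelA (√δ) ε hε h).integralOp ∘L ContinuousLinearMap.fst ℝ BddReal BddReal).prod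
    ((channelB ε hε).integralOp ∘L ContinuousLinearMap.snd ℝ BddReal BddReal)

theorem abs_weight_mul_le (m : BddReal) (t : ℝ) (ht : 0 ≤ t) :
    |(weight ε hε * m) t| ≤ ‖m‖ * Real.exp (-(ε / 4) * t) := by
  rw [BoundedContinuousFunction.mul_apply, weight_apply_of_nonneg hε ht, abs_mul,
    abs_of_pos (Real.exp_pos _), mul_comm]
  exact mul_le_mul_of_nonneg_right (m.norm_coe_le_norm t) (Real.exp_pos _).le

/-- Each of the four entries is an integral operator after multiplication by the weight times a
bounded function, and the two gap estimates make each of them compact. -/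
theorem isCompactOperator_linearized (y : BddReal × BddReal) :
    IsCompactOperator (integralPart hε h ∘L fieldDeriv (weight ε hε) ε δ y) := by
  have hA : ∀ m, IsCompactOperator
      ((channelA (√δ) ε hε h).integralOp ∘L mulOp (weight ε hε * m)) := fun m =>
    Channel.isCompactOperator_integralOp_mul _ _ (by positivity) (channelA_gap hε h)
      (abs_weight_mul_le hε m)
  have hB : ∀ m, IsCompactOperator ((channelB ε hε).integralOp ∘L mulOp (weight ε hε * m)) :=
    fun m => Channel.isCompactOperator_integralOp_mul _ _ (by positivity) (channelB_gap hε)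
      (abs_weight_mul_le hε m)
  have k1 := (((hA (slopeAA (weight ε hε) δ y)).comp_clm
    (ContinuousLinearMap.fst ℝ BddReal BddReal)).add ((hA (slopeAB (weight ε hε) δ y)).comp_clm
    (ContinuousLinearMap.snd ℝ BddReal BddReal))).clm_comp
    (ContinuousLinearMap.inl ℝ BddReal BddReal)
  have k2 := (((hB (slopeBA (weight ε hε) ε δ y)).comp_clm
    (ContinuousLinearMap.fst ℝ BddReal BddReal)).add ((hB (slopeBB (weight ε hε) ε δ y)).comp_clm
    (ContinuousLinearMap.snd ℝ BddReal BddReal))).clm_comp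
    (ContinuousLinearMap.inr ℝ BddReal BddReal)
  have k := k1.add k2
  have e : ∀ f g : BddReal × BddReal → BddReal × BddReal, (∀ u, f u = g u) →
      IsCompactOperator g → IsCompactOperator f := fun f g hfg hg => funext hfg ▸ hg
  refine e _ _ (fun u => ?_) k
  refine Prod.ext ?_ ?_ <;>
  simp [integralPart, fieldDeriv]

end Linearized

end DomainWall

end

/-! ### Boundary conditions and the curves of the integral equations. -/

open Filter Topology Asymptotics

noncomputable section

namespace DomainWall

/-- The stable coordinates `X`, as a linear map into `ℂ`. -/
def coordXL (d : ℝ) : (Fin 4 → ℝ) →L[ℝ] ℂ :=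
  LinearMap.toContinuousLinearMap
    { toFun := fun A => ⟨coordX₁ d (A 0) (A 1) (A 3), coordX₂ d (A 1) (A 2) (A 3)⟩
      map_add' := fun A A' => by
        refine Complex.ext ?_ ?_ <;> simp [coordX₁, coordX₂] <;> ring
      map_smul' := fun c A => by
        refine Complex.ext ?_ ?_ <;> simp [coordX₁, coordX₂] <;> ring }

theorem coordXL_apply (d : ℝ) (A : Fin 4 → ℝ) :
    coordXL d A = ⟨coordX₁ d (A 0) (A 1) (A 3), coordX₂ d (A 1) (A 2) (A 3)⟩ := rfl

section Branch

variable {ε δ : ℝ} (hε : 0 < ε) (h : ε ≤ √δ)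

/-- The values at `0` of `A` and its derivatives. -/
def startA : ℂ × BddReal →L[ℝ] (Fin 4 → ℝ) :=
  ContinuousLinearMap.pi fun k => (channelA (√δ) ε hε h).jetStart k

/-- The boundary conditions `X(0) = X` and `B(0) = b`. -/
def boundary (u : Params × ((ℂ × ℝ) × (BddReal × BddReal))) : ℂ × ℝ :=
  -- X is measured in the frame at B = b, whereas s refers to the frame √δ at B = 1. So X(0) = X is
  -- an equation for s, not its value; this is why s is an unknown next to y.
  (coordXL (deltaTilde u.1.2.1 u.1.2.2.2)
      (startA hε h (u.2.1.1, (field (weight ε hε) ε δ (u.1, u.2.2)).1)) -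
      ⟨u.1.2.2.1 0, u.1.2.2.1 1⟩,
    1 + (channelB ε hε).jetStart 0 (u.2.1.2, (field (weight ε hε) ε δ (u.1, u.2.2)).2) - u.1.2.2.2)

/-- The derivative of the boundary conditions. -/
def boundaryDeriv (b : ℝ) (y : BddReal × BddReal) :
    (ℂ × ℝ) × (BddReal × BddReal) →L[ℝ] ℂ × ℝ :=
  ((coordXL (deltaTilde δ b) ∘L startA hε h) ∘L
    ((ContinuousLinearMap.fst ℝ ℂ ℝ ∘L ContinuousLinearMap.fst ℝ (ℂ × ℝ) (BddReal × BddReal)).prod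
      ((ContinuousLinearMap.fst ℝ BddReal BddReal ∘L fieldDeriv (weight ε hε) ε δ y) ∘L
        ContinuousLinearMap.snd ℝ (ℂ × ℝ) (BddReal × BddReal)))).prod
  ((channelB ε hε).jetStart 0 ∘L
    ((Complex.ofRealCLM ∘L ContinuousLinearMap.snd ℝ ℂ ℝ ∘L
        ContinuousLinearMap.fst ℝ (ℂ × ℝ) (BddReal × BddReal)).prod
      ((ContinuousLinearMap.snd ℝ BddReal BddReal ∘L fieldDeriv (weight ε hε) ε δ y) ∘L
        ContinuousLinearMap.snd ℝ (ℂ × ℝ) (BddReal × BddReal))))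

theorem boundaryDeriv_apply (b : ℝ) (y : BddReal × BddReal) (s : ℂ) (r : ℝ)
    (u : BddReal × BddReal) :
    boundaryDeriv hε h b y ((s, r), u) =
      (coordXL (deltaTilde δ b) (startA hε h (s, (fieldDeriv (weight ε hε) ε δ y u).1)),
        (channelB ε hε).jetStart 0 ((r : ℂ), (fieldDeriv (weight ε hε) ε δ y u).2)) := rfl

theorem hasFDerivAt_boundary (b : ℝ) (X : Plane) (s : ℂ × ℝ) (y : BddReal × BddReal) :
    HasFDerivAt (fun u => boundary hε h ((ε, δ, X, b), u)) (boundaryDeriv hε h b y) (s, y) := by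
  have hF : HasFDerivAt
      (fun u : (ℂ × ℝ) × (BddReal × BddReal) => field (weight ε hε) ε δ ((ε, δ, X, b), u.2))
      (fieldDeriv (weight ε hε) ε δ y ∘L ContinuousLinearMap.snd ℝ (ℂ × ℝ) (BddReal × BddReal))
      (s, y) :=
    HasFDerivAt.comp (s, y) (f := fun u : (ℂ × ℝ) × (BddReal × BddReal) => u.2)
      (hasFDerivAt_field (weight ε hε) ε δ b X y) hasFDerivAt_snd
  have hs : HasFDerivAt (fun u : (ℂ × ℝ) × (BddReal × BddReal) => u.1.1)
      (ContinuousLinearMap.fst ℝ ℂ ℝ ∘L ContinuousLinearMap.fst ℝ (ℂ × ℝ) (BddReal × BddReal))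
      (s, y) := (ContinuousLinearMap.fst ℝ ℂ ℝ ∘L
        ContinuousLinearMap.fst ℝ (ℂ × ℝ) (BddReal × BddReal)).hasFDerivAt
  have hr : HasFDerivAt (fun u : (ℂ × ℝ) × (BddReal × BddReal) => (u.1.2 : ℂ))
      (Complex.ofRealCLM ∘L ContinuousLinearMap.snd ℝ ℂ ℝ ∘L
        ContinuousLinearMap.fst ℝ (ℂ × ℝ) (BddReal × BddReal))
      (s, y) := (Complex.ofRealCLM ∘L ContinuousLinearMap.snd ℝ ℂ ℝ ∘L
        ContinuousLinearMap.fst ℝ (ℂ × ℝ) (BddReal × BddReal)).hasFDerivAt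
  have hA := (((coordXL (deltaTilde δ b) ∘L startA hε h).hasFDerivAt).comp (s, y)
    (hs.prodMk hF.fst)).sub_const (⟨X 0, X 1⟩ : ℂ)
  have hB := ((((channelB ε hε).jetStart 0).hasFDerivAt.comp (s, y)
    (hr.prodMk hF.snd)).const_add 1).sub_const b
  exact hA.prodMk hB

open scoped ContDiff in
theorem contDiffAt_deltaTilde {E : Type*} [NormedAddCommGroup E] [NormedSpace ℝ E] {f g : E → ℝ}
    {x : E} (hf : ContDiffAt ℝ ω f x) (hg : ContDiffAt ℝ ω g x)
    (hx : 1 < (1 + f x ^ 2) * g x ^ 2) :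
    ContDiffAt ℝ ω (fun x => deltaTilde (f x) (g x)) x := by
  unfold deltaTilde
  refine ContDiffAt.rpow_const_of_ne (by fun_prop) ?_
  linarith

open scoped ContDiff in
theorem contDiffAt_coords {E : Type*} [NormedAddCommGroup E] [NormedSpace ℝ E]
    {d A₀ A₁ A₂ A₃ : E → ℝ} {x : E} (hd : ContDiffAt ℝ ω d x) (h₀ : ContDiffAt ℝ ω A₀ x)
    (h₁ : ContDiffAt ℝ ω A₁ x) (h₂ : ContDiffAt ℝ ω A₂ x) (h₃ : ContDiffAt ℝ ω A₃ x)
    (hx : d x ≠ 0) :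
    ContDiffAt ℝ ω (fun x => coordX₁ (d x) (A₀ x) (A₁ x) (A₃ x)) x ∧
    ContDiffAt ℝ ω (fun x => coordX₂ (d x) (A₁ x) (A₂ x) (A₃ x)) x ∧
    ContDiffAt ℝ ω (fun x => coordY₁ (d x) (A₀ x) (A₁ x) (A₃ x)) x ∧
    ContDiffAt ℝ ω (fun x => coordY₂ (d x) (A₁ x) (A₂ x) (A₃ x)) x := by
  have e3 : ContDiffAt ℝ ω (fun x => A₃ x / d x ^ 3) x := h₃.div (hd.pow 3) (pow_ne_zero 3 hx)
  have e2 : ContDiffAt ℝ ω (fun x => A₂ x / d x ^ 2) x := h₂.div (hd.pow 2) (pow_ne_zero 2 hx)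
  have e1 : ContDiffAt ℝ ω (fun x => A₁ x / d x) x := h₁.div hd hx
  unfold coordX₁ coordX₂ coordY₁ coordY₂
  exact ⟨(h₀.add ((e3.sub e1).div_const _)).div_const _,
    (e2.sub ((e1.add e3).div_const _)).div_const _,
    (h₀.sub ((e3.sub e1).div_const _)).div_const _,
    (e2.add ((e1.add e3).div_const _)).div_const _⟩

-- The only ingredient that is not polynomial is the frame `deltaTilde`, which is analytic and
-- nonzero where (1 + δ²)b² > 1.
open scoped ContDiff in
theorem contDiffAt_boundary {p : Params} (hp : 1 < (1 + p.2.1 ^ 2) * p.2.2.2 ^ 2)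
    (u : (ℂ × ℝ) × (BddReal × BddReal)) : ContDiffAt ℝ ω (boundary hε h) (p, u) := by
  have hF : ContDiff ℝ ω (fun u : Params × ((ℂ × ℝ) × (BddReal × BddReal)) =>
      field (weight ε hε) ε δ (u.1, u.2.2)) :=
    (contDiff_field (weight ε hε) ε δ).comp (by fun_prop)
  have hF1 := hF.fst
  have hF2 := hF.snd
  have hs : ContDiff ℝ ω (fun u : Params × ((ℂ × ℝ) × (BddReal × BddReal)) => u.2.1.1) := by
    fun_prop
  have hr : ContDiff ℝ ω (fun u : Params × ((ℂ × ℝ) × (BddReal × BddReal)) => u.2.1.2) := by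
    fun_prop
  have hd : ContDiffAt ℝ ω (fun u : Params × ((ℂ × ℝ) × (BddReal × BddReal)) =>
      deltaTilde u.1.2.1 u.1.2.2.2) (p, u) :=
    contDiffAt_deltaTilde (by fun_prop) (by fun_prop) hp
  have hA : ∀ k, ContDiffAt ℝ ω (fun u : Params × ((ℂ × ℝ) × (BddReal × BddReal)) =>
      (channelA (√δ) ε hε h).jetStart k
        (u.2.1.1, (field (weight ε hε) ε δ (u.1, u.2.2)).1)) (p, u) := fun k =>
    (((channelA (√δ) ε hε h).jetStart k).contDiff.comp (hs.prodMk hF1)).contDiffAt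
  have hB : ContDiffAt ℝ ω (fun u : Params × ((ℂ × ℝ) × (BddReal × BddReal)) =>
      (channelB ε hε).jetStart 0
        (Complex.ofRealCLM u.2.1.2, (field (weight ε hε) ε δ (u.1, u.2.2)).2)) (p, u) :=
    (((channelB ε hε).jetStart 0).contDiff.comp
      ((Complex.ofRealCLM.contDiff.comp hr).prodMk hF2)).contDiffAt
  obtain ⟨c1, c2, -, -⟩ := contDiffAt_coords hd (hA 0) (hA 1) (hA 2) (hA 3)
    (deltaTilde_pos hp).ne'
  have k1 : ContDiffAt ℝ ω (fun u : Params × ((ℂ × ℝ) × (BddReal × BddReal)) =>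
      u.1.2.2.1 0) (p, u) := by fun_prop
  have k2 : ContDiffAt ℝ ω (fun u : Params × ((ℂ × ℝ) × (BddReal × BddReal)) =>
      u.1.2.2.1 1) (p, u) := by fun_prop
  have k3 : ContDiffAt ℝ ω (fun u : Params × ((ℂ × ℝ) × (BddReal × BddReal)) =>
      u.1.2.2.2) (p, u) := by fun_prop
  have hX := Complex.equivRealProdCLM.symm.contDiff.contDiffAt.comp (p, u)
    ((c1.sub k1).prodMk (c2.sub k2))
  refine (hX.prodMk ((contDiffAt_const (c := (1 : ℝ))).add hB |>.sub k3)).congr_of_eventuallyEq ?_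
  refine Eventually.of_forall fun v => ?_
  refine Prod.ext (Complex.ext ?_ ?_) ?_ <;>
  simp [boundary, coordXL_apply, startA]

/-- The phase curve that belongs to a solution of the integral equations. -/
def curve (s : ℂ × ℝ) (f : BddReal × BddReal) (x : ℝ) : Phase :=
  ![(channelA (√δ) ε hε h).jet 0 s.1 f.1 x, (channelA (√δ) ε hε h).jet 1 s.1 f.1 x,
    (channelA (√δ) ε hε h).jet 2 s.1 f.1 x, (channelA (√δ) ε hε h).jet 3 s.1 f.1 x,
    1 + (channelB ε hε).jet 0 s.2 f.2 x, (channelB ε hε).jet 1 s.2 f.2 x]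

theorem tendsto_curve (s : ℂ × ℝ) (f : BddReal × BddReal) :
    Tendsto (curve hε h s f) atTop (𝓝 Mplus) := by
  refine tendsto_pi_nhds.2 fun j => ?_
  fin_cases j
  · exact Channel.tendsto_jet _ _ _ _
  · exact Channel.tendsto_jet _ _ _ _
  · exact Channel.tendsto_jet _ _ _ _
  · exact Channel.tendsto_jet _ _ _ _
  · simpa [curve, Mplus] using (Channel.tendsto_jet (channelB ε hε) 0 s.2 f.2).const_add 1
  · exact Channel.tendsto_jet _ _ _ _

theorem weight_mul_eq {s : ℂ × ℝ} {y f : BddReal × BddReal}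
    (hy : y = freePart hε h s + integralPart hε h f) {x : ℝ} (hx : 0 ≤ x) :
    weight ε hε x * y.1 x = (channelA (√δ) ε hε h).jet 0 s.1 f.1 x ∧
    weight ε hε x * y.2 x = (channelB ε hε).jet 0 s.2 f.2 x := by
  rw [Channel.jet_zero _ _ _ hx, Channel.jet_zero _ _ _ hx, hy, weight_apply_of_nonneg hε hx]
  exact ⟨rfl, rfl⟩

/-- The weight times the field is the true right hand side minus the frozen linear part, and the
jets add the latter back. The curve therefore solves the system at the moving parameters p, not at
the base point. -/
theorem isSolution_curve {p : Params} {s : ℂ × ℝ} {y : BddReal × BddReal}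
    (hy : y = freePart hε h s + integralPart hε h (field (weight ε hε) ε δ (p, y))) :
    IsSolutionFrom p.1 p.2.1 0 (curve hε h s (field (weight ε hε) ε δ (p, y))) := by
  set f := field (weight ε hε) ε δ (p, y) with hf
  have δ0 : 0 ≤ δ := by
    by_contra hneg
    rw [Real.sqrt_eq_zero_of_nonpos (by linarith)] at h
    linarith
  have hD4 : √δ ^ 4 = δ ^ 2 := by
    calc √δ ^ 4 = (√δ ^ 2) ^ 2 := by ring
      _ = δ ^ 2 := by rw [Real.sq_sqrt δ0]
  obtain ⟨a0, a1, a2, a3⟩ := channelA_jet hε h s.1 f.1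
  obtain ⟨b0, b1⟩ := channelB_jet hε s.2 f.2
  intro x hx
  obtain ⟨e1, e2⟩ := weight_mul_eq hε h hy hx
  refine hasDerivWithinAt_pi.2 fun j => ?_
  fin_cases j
  · exact a0 x hx
  · exact a1 x hx
  · exact a2 x hx
  · refine (a3 x hx).congr_deriv ?_
    have : weight ε hε x * f.1 x = _ := mul_fieldA_apply (weight ε hε) (δ ^ 2) p.2.1 y x
    rw [e1, e2, weight_apply_of_nonneg hε hx] at this
    beta_reduce
    rw [this, hD4]
    simp [vectorField, curve]
  · simpa [curve, vectorField] using (b0 x hx).const_add 1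
  · refine (b1 x hx).congr_deriv ?_
    have : weight ε hε x * f.2 x = _ :=
      mul_fieldB_apply (weight ε hε) (2 * ε ^ 2) p.1 p.2.1 y x
    rw [e1, e2, weight_apply_of_nonneg hε hx] at this
    beta_reduce
    rw [this]
    simp [vectorField, curve]

end Branch

end DomainWall

end

/-! ### Good orbits solve the integral equations. -/

open Filter Topology Asymptotics

noncomputable section

namespace DomainWall

theorem form_nonpos_of_coordX {d A₀ A₁ A₂ A₃ : ℝ} (hd : 0 < d)
    (h₁ : coordX₁ d A₀ A₁ A₃ = 0) (h₂ : coordX₂ d A₁ A₂ A₃ = 0) : A₀ * A₃ - A₁ * A₂ ≤ 0 := by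
  obtain ⟨e0, e1, e2, e3⟩ := coords_spec hd A₀ A₁ A₂ A₃
  rw [h₁, h₂] at *
  exact boundary_form_nonpos (y₁ := coordY₁ d A₀ A₁ A₃) (y₂ := coordY₂ d A₁ A₂ A₃) hd
    (by linarith) (by linarith) (by linarith) (by linarith)

variable {ε δ b : ℝ} {X : Plane} {Z : ℝ → Phase}

theorem Regime.sqrt_δ_pos (R : Regime ε δ X b) : 0 < √δ :=
  Real.sqrt_pos.2 (by linarith [R.δ_ge])

theorem Regime.ε_le_sqrt (R : Regime ε δ X b) : ε ≤ √δ := by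
  have h1 := R.ε_le
  have h2 := R.d_le
  have h3 := R.δ_ge
  refine Real.le_sqrt_of_sq_le ?_
  have h4 := R.ε_pos
  nlinarith

theorem GoodOrbit.continuous_max (G : GoodOrbit ε δ X b Z) (j : Fin 6) :
    Continuous fun x => Z (max x 0) j :=
  (G.sol.component j).continuousOn.comp_continuous (by fun_prop) fun x => le_max_right x 0

/-- A bounded function of the form `e^{ε x / 4} u(x)`, constant for `x ≤ 0`. -/
theorem exists_bddReal {u : ℝ → ℝ} (hu : Continuous fun x => u (max x 0)) {C : ℝ} (hε : 0 < ε)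
    (h : ∀ x, 0 ≤ x → |u x| ≤ C * Real.exp (-(ε / 4 * x))) :
    ∃ v : BddReal, (∀ x, v x = v (max x 0)) ∧ ∀ x, 0 ≤ x → weight ε hε x * v x = u x := by
  refine ⟨BoundedContinuousFunction.ofNormedAddCommGroup
    (fun x => Real.exp (ε / 4 * max x 0) * u (max x 0))
    ((by fun_prop : Continuous fun x : ℝ => Real.exp (ε / 4 * max x 0)).mul hu) C fun x => ?_, fun x => ?_,
    fun x hx => ?_⟩
  · rw [norm_mul, Real.norm_of_nonneg (Real.exp_pos _).le, Real.norm_eq_abs]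
    have h1 := h (max x 0) (le_max_right x 0)
    rw [Real.exp_neg, ← div_eq_mul_inv, le_div_iff₀ (Real.exp_pos _)] at h1
    linarith
  · simp
  · rw [weight_apply_of_nonneg hε hx]
    simp only [BoundedContinuousFunction.coe_ofNormedAddCommGroup, max_eq_left hx]
    rw [← mul_assoc, ← Real.exp_add]
    simp

theorem Regime.exp_le (R : Regime ε δ X b) {x : ℝ} (hx : 0 ≤ x) :
    Real.exp (-(deltaTilde δ b / 4 * x)) ≤ Real.exp (-(ε / 4 * x)) ∧
    Real.exp (-(√2 * ε * x)) ≤ Real.exp (-(ε / 4 * x)) := by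
  have h1 := R.ε_le
  have h2 := R.ε_pos
  have hs2 : √2 ^ 2 = 2 := Real.sq_sqrt (by norm_num)
  have hs0 : 0 < √2 := by positivity
  refine ⟨Real.exp_le_exp.2 (neg_le_neg (mul_le_mul_of_nonneg_right (by linarith) hx)),
    Real.exp_le_exp.2 (neg_le_neg (mul_le_mul_of_nonneg_right (by nlinarith) hx))⟩

theorem freePart_add_integralPart_max (hε : 0 < ε) (h : ε ≤ √δ) (s : ℂ × ℝ)
    (f : BddReal × BddReal) (x : ℝ) :
    (freePart hε h s + integralPart hε h f).1 x =
      (freePart hε h s + integralPart hε h f).1 (max x 0) ∧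
    (freePart hε h s + integralPart hε h f).2 x =
      (freePart hε h s + integralPart hε h f).2 (max x 0) :=
  ⟨Channel.free_add_integral_max _ _ _ _, Channel.free_add_integral_max _ _ _ _⟩

theorem eq_of_weight_mul_eq (hε : 0 < ε) {u v : BddReal} (hu : ∀ x, u x = u (max x 0))
    (hv : ∀ x, v x = v (max x 0))
    (h : ∀ x, 0 ≤ x → weight ε hε x * u x = weight ε hε x * v x) : u = v := by
  ext x
  rw [hu, hv]
  have := h (max x 0) (le_max_right x 0)
  rw [weight_apply] at this
  exact mul_left_cancel₀ (Real.exp_pos _).ne' this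

/-- Every orbit under consideration solves the integral equations. -/
theorem GoodOrbit.exists_integral_form (R : Regime ε δ X b) (G : GoodOrbit ε δ X b Z)
    (h : ε ≤ √δ) :
    ∃ (s : ℂ × ℝ) (y : BddReal × BddReal),
      y = freePart R.ε_pos h s +
        integralPart R.ε_pos h (field (weight ε R.ε_pos) ε δ ((ε, δ, X, b), y)) ∧
      ∀ x, 0 ≤ x →
        curve R.ε_pos h s (field (weight ε R.ε_pos) ε δ ((ε, δ, X, b), y)) x = Z x := by
  have hε := R.ε_pos
  have hb : 0 < 1 - b := by linarith [R.b_lt]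
  have δ0 : 0 ≤ δ := by linarith [R.δ_ge]
  have hD4 : √δ ^ 4 = δ ^ 2 := by
    calc √δ ^ 4 = (√δ ^ 2) ^ 2 := by ring
      _ = δ ^ 2 := by rw [Real.sq_sqrt δ0]
  obtain ⟨v, hv, hv'⟩ := exists_bddReal (u := fun x => Z x 0) (C := 16 * ‖X‖)
    (G.continuous_max 0) hε fun x hx => by
      refine (G.A_bounds R hx).1.trans ?_
      rw [mul_assoc]
      have := (R.exp_le hx).1
      gcongr
  obtain ⟨w, hw, hw'⟩ := exists_bddReal (u := fun x => Z x 4 - 1) (C := 4 * (1 - b))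
    ((G.continuous_max 4).sub continuous_const) hε fun x hx => by
      obtain ⟨⟨-, h2⟩, -⟩ := G.bounds R hx
      rw [abs_sub_comm, abs_of_nonneg (by linarith [G.B_le hx])]
      exact h2.trans (mul_le_mul_of_nonneg_left (R.exp_le hx).2 (by positivity))
  set f := field (weight ε hε) ε δ ((ε, δ, X, b), (v, w)) with hf
  set K := channelA (√δ) ε hε h with hK
  set L := channelB ε hε with hL
  set s : ℂ := ⟨coordX₁ (√δ) (Z 0 0) (Z 0 1) (Z 0 3), coordX₂ (√δ) (Z 0 1) (Z 0 2) (Z 0 3)⟩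
  -- s is read off in the frame √δ, and r corrects B(0) - 1 by the value at 0 of the integral part.
  -- With these choices the difference below has X = 0 and vanishing slow part at the start.
  set r : ℝ := Z 0 4 - 1 - L.jetStart 0 (0, f.2) with hr
  obtain ⟨a0, a1, a2, a3⟩ := channelA_jet hε h s f.1
  obtain ⟨b0, b1⟩ := channelB_jet hε r f.2
  obtain ⟨t0, t1, t2, t3⟩ := tendsto_A G.tends
  obtain ⟨t4, t5⟩ := tendsto_B G.tends
  have hfA : ∀ x, 0 ≤ x → Real.exp (-(ε / 4) * x) * f.1 x = δ ^ 2 * Z x 0 + Z x 0 *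
      (1 - Z x 0 ^ 2 - (1 + δ ^ 2) * Z x 4 ^ 2) := fun x hx => by
    have k : weight ε hε x * f.1 x = _ := mul_fieldA_apply (weight ε hε) (δ ^ 2) δ (v, w) x
    rw [hv' x hx, hw' x hx, weight_apply_of_nonneg hε hx] at k
    rw [k]; ring
  have hfB : ∀ x, 0 ≤ x → Real.exp (-(ε / 4) * x) * f.2 x = ε ^ 2 * Z x 4 *
      (-1 + (1 + δ ^ 2) * Z x 0 ^ 2 + Z x 4 ^ 2) - 2 * ε ^ 2 * (Z x 4 - 1) := fun x hx => by
    have k : weight ε hε x * f.2 x = _ := mul_fieldB_apply (weight ε hε) (2 * ε ^ 2) ε δ (v, w) x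
    rw [hv' x hx, hw' x hx, weight_apply_of_nonneg hε hx] at k
    rw [k]; ring
  have hone : HasDerivOnHalfLine (fun _ : ℝ => (1 : ℝ)) fun _ => 0 :=
    fun x _ => hasDerivWithinAt_const x _ _
  obtain ⟨c1, c2⟩ := channelA_coords hε h s f.1
  -- The orbit and the curve have the same forcing, so their difference solves the frozen, uncoupled
  -- equations A'''' = -δ²A and B'' = 2ε²B. The uniqueness lemma with zero coupling and M = 0 shows
  -- that it vanishes.
  have main := eq_zero_of_weakly_coupled (w₀ := fun x => Z x 0 - K.jet 0 s f.1 x)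
    (w₁ := fun x => Z x 1 - K.jet 1 s f.1 x) (w₂ := fun x => Z x 2 - K.jet 2 s f.1 x)
    (w₃ := fun x => Z x 3 - K.jet 3 s f.1 x) (z₀ := fun x => Z x 4 - 1 - L.jet 0 r f.2 x)
    (z₁ := fun x => Z x 5 - L.jet 1 r f.2 x)
    (a := fun _ => δ ^ 2) (p := fun _ => 0) (p' := fun _ => 0) (e := fun _ => 2)
    (ε := ε) (m := δ ^ 2) (M := 0) (κ := 1)
    hε (by have := R.δ_ge; positivity) one_pos le_rfl (by simp)
    (G.sol.deriv_zero.sub a0) (G.sol.deriv_one.sub a1)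
    (G.sol.deriv_two.sub a2)
    ((G.sol.deriv_three.sub a3).congr_deriv fun x hx => by rw [hfA x hx, hD4]; ring)
    (((G.sol.deriv_four.sub hone).sub b0).congr_deriv fun x hx => by ring)
    ((G.sol.deriv_five.sub b1).congr_deriv fun x hx => by rw [hfB x hx]; ring)
    (by simpa using t0.sub (K.tendsto_jet 0 s f.1)) (by simpa using t1.sub (K.tendsto_jet 1 s f.1))
    (by simpa using t2.sub (K.tendsto_jet 2 s f.1)) (by simpa using t3.sub (K.tendsto_jet 3 s f.1))
    (by simpa using (t4.sub_const 1).sub (L.tendsto_jet 0 r f.2))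
    (by simpa using t5.sub (L.tendsto_jet 1 r f.2))
    (fun _ _ => le_rfl) (fun _ _ => by norm_num) (fun _ _ => by simp)
    (form_nonpos_of_coordX R.sqrt_δ_pos (by
        have : s.re = coordX₁ (√δ) (Z 0 0) (Z 0 1) (Z 0 3) := rfl
        rw [this] at c1
        unfold coordX₁ at c1 ⊢
        linear_combination -c1) (by
        have : s.im = coordX₂ (√δ) (Z 0 1) (Z 0 2) (Z 0 3) := rfl
        rw [this] at c2
        unfold coordX₂ at c2 ⊢
        linear_combination -c2))
    (by
      simp only [Channel.jet_at_zero, Channel.jetStart_apply, hr]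
      simp)
  have hcurve : ∀ x, 0 ≤ x → curve hε h (s, r) f x = Z x := fun x hx => by
    obtain ⟨m0, m1, m2, m3, m4, m5⟩ := main x hx
    ext j
    fin_cases j
    · exact (sub_eq_zero.1 m0).symm
    · exact (sub_eq_zero.1 m1).symm
    · exact (sub_eq_zero.1 m2).symm
    · exact (sub_eq_zero.1 m3).symm
    · simp only [curve]
      have : 1 + L.jet 0 r f.2 x = Z x 4 := by linarith
      exact this
    · exact (sub_eq_zero.1 m5).symm
  refine ⟨(s, r), (v, w), ?_, hcurve⟩
  have hmul := fun x hx => weight_mul_eq (x := x) hε h (s := (s, r)) (f := f) rfl hx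
  have hmax := freePart_add_integralPart_max hε h (s, r) f
  refine Prod.ext (eq_of_weight_mul_eq hε hv (fun x => (hmax x).1) fun x hx => ?_)
    (eq_of_weight_mul_eq hε hw (fun x => (hmax x).2) fun x hx => ?_)
  · rw [hv' x hx, (hmul x hx).1]
    exact sub_eq_zero.1 (main x hx).1
  · rw [hw' x hx, (hmul x hx).2]
    exact sub_eq_zero.1 (main x hx).2.2.2.2.1

end DomainWall

end

/-! ### Nondegeneracy and local analytic branches. -/

open Filter Topology Asymptotics

noncomputable section

namespace DomainWall

variable {ε δ b : ℝ} {X : Plane} {Z : ℝ → Phase}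

/-- The problem linearized at an orbit has only the trivial solution. -/
theorem GoodOrbit.linearized_trivial (R : Regime ε δ X b) (G : GoodOrbit ε δ X b Z) (h : ε ≤ √δ)
    {y : BddReal × BddReal} (hyA : ∀ x, 0 ≤ x → weight ε R.ε_pos x * y.1 x = Z x 0)
    (hyB : ∀ x, 0 ≤ x → 1 + weight ε R.ε_pos x * y.2 x = Z x 4)
    {s : ℂ × ℝ} {u : BddReal × BddReal} (hb : boundaryDeriv R.ε_pos h b y (s, u) = 0)
    (hu : u = freePart R.ε_pos h s +
      integralPart R.ε_pos h (fieldDeriv (weight ε R.ε_pos) ε δ y u)) :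
    s = 0 ∧ u = 0 := by
  have hε := R.ε_pos
  have δ0 : 0 ≤ δ := by linarith [R.δ_ge]
  have hD4 : √δ ^ 4 = δ ^ 2 := by
    calc √δ ^ 4 = (√δ ^ 2) ^ 2 := by ring
      _ = δ ^ 2 := by rw [Real.sq_sqrt δ0]
  have hg := R.δ_sq_le
  have d0 := R.d_pos
  obtain ⟨s, r⟩ := s
  set f := fieldDeriv (weight ε hε) ε δ y u with hf
  set K := channelA (√δ) ε hε h with hK
  set L := channelB ε hε with hL
  obtain ⟨a0, a1, a2, a3⟩ := channelA_jet hε h s f.1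
  obtain ⟨b0, b1⟩ := channelB_jet hε r f.2
  have hmul := fun x hx => weight_mul_eq (x := x) hε h hu hx
  have hfA : ∀ x, 0 ≤ x → Real.exp (-(ε / 4) * x) * f.1 x =
      (δ ^ 2 - ((1 + δ ^ 2) * Z x 4 ^ 2 - 1 + 3 * Z x 0 ^ 2)) * K.jet 0 s f.1 x -
        2 * (1 + δ ^ 2) * Z x 0 * Z x 4 * L.jet 0 r f.2 x := fun x hx => by
    rw [← (hmul x hx).1, ← (hmul x hx).2, ← weight_apply_of_nonneg hε hx, ← hyA x hx, ← hyB x hx]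
    have k : f.1 x = (weight ε hε * slopeAA (weight ε hε) δ y) x * u.1 x +
      (weight ε hε * slopeAB (weight ε hε) δ y) x * u.2 x := rfl
    rw [k]
    simp [slopeAA, slopeAB]
    ring
  have hfB : ∀ x, 0 ≤ x → Real.exp (-(ε / 4) * x) * f.2 x =
      ε ^ 2 * ((3 * Z x 4 ^ 2 - 1 + (1 + δ ^ 2) * Z x 0 ^ 2 - 2) * L.jet 0 r f.2 x +
        2 * (1 + δ ^ 2) * Z x 0 * Z x 4 * K.jet 0 s f.1 x) := fun x hx => by
    rw [← (hmul x hx).1, ← (hmul x hx).2, ← weight_apply_of_nonneg hε hx, ← hyA x hx, ← hyB x hx]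
    have k : f.2 x = (weight ε hε * slopeBA (weight ε hε) ε δ y) x * u.1 x +
      (weight ε hε * slopeBB (weight ε hε) ε δ y) x * u.2 x := rfl
    rw [k]
    simp [slopeBA, slopeBB]
    ring
  rw [boundaryDeriv_apply, Prod.mk_eq_zero] at hb
  obtain ⟨hb1, hb2⟩ := hb
  have hx1 := congrArg Complex.re hb1
  have hx2 := congrArg Complex.im hb1
  -- An element of the kernel solves the variational equation along Z, with symmetric coupling p =
  -- p' = 2(1 + δ²)AB. The coupling bound is again 64 u + 64 u, so the constants of the uniqueness
  -- proof apply.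
  have main := eq_zero_of_weakly_coupled (w₀ := K.jet 0 s f.1)
    (w₁ := K.jet 1 s f.1) (w₂ := K.jet 2 s f.1)
    (w₃ := K.jet 3 s f.1) (z₀ := L.jet 0 r f.2)
    (z₁ := L.jet 1 r f.2)
    (a := fun x => (1 + δ ^ 2) * Z x 4 ^ 2 - 1 + 3 * Z x 0 ^ 2)
    (p := fun x => 2 * (1 + δ ^ 2) * Z x 0 * Z x 4)
    (p' := fun x => 2 * (1 + δ ^ 2) * Z x 0 * Z x 4)
    (e := fun x => 3 * Z x 4 ^ 2 - 1 + (1 + δ ^ 2) * Z x 0 ^ 2)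
    (ε := ε) (m := deltaTilde δ b ^ 4) (M := 16384) (κ := deltaTilde δ b / 2)
    hε (by positivity) (by positivity) (by norm_num) R.coupling_small
    a0 a1 a2 (a3.congr_deriv fun x hx => by rw [hfA x hx, hD4]; ring)
    b0 (b1.congr_deriv fun x hx => by rw [hfB x hx]; ring)
    (K.tendsto_jet 0 s f.1) (K.tendsto_jet 1 s f.1) (K.tendsto_jet 2 s f.1) (K.tendsto_jet 3 s f.1)
    (L.tendsto_jet 0 r f.2) (L.tendsto_jet 1 r f.2)
    (fun x hx => by
      have := G.coeff_ge R hx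
      nlinarith [sq_nonneg (Z x 0)])
    (fun x hx => by
      have h1 := G.le_B hx
      have h3 := R.half_le_b_sq
      have h5 : b ^ 2 ≤ Z x 4 ^ 2 := pow_le_pow_left₀ R.b_pos.le h1 2
      have h8 : 0 ≤ (1 + δ ^ 2) * Z x 0 ^ 2 := by positivity
      linarith)
    (fun x hx => by
      refine coupling_sq_le R ?_
      have a1 := (G.A_bounds R hx).1
      set u := ‖X‖ * Real.exp (-(deltaTilde δ b / 4 * x))
      have b1 := G.B_le hx
      have b3 := R.b_pos.trans_le (G.le_B hx)
      have k1 : |2 * (1 + δ ^ 2) * Z x 0 * Z x 4| ≤ 2 * 2 * (16 * u) * 1 := by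
        rw [abs_mul, abs_mul, abs_of_pos (show 0 < 2 * (1 + δ ^ 2) by positivity), abs_of_pos b3]
        exact mul_le_mul (mul_le_mul (by linarith) a1 (abs_nonneg _) (by norm_num))
          b1 b3.le (by positivity)
      exact (abs_add_le _ _).trans (by linarith))
    (form_nonpos_of_coordX d0
      (by simpa [coordXL_apply, startA, Channel.jet_at_zero] using hx1)
      (by simpa [coordXL_apply, startA, Channel.jet_at_zero] using hx2))
    (by rw [Channel.jet_at_zero]; exact hb2)
  have hu0 : u = 0 := by
    have hmax := freePart_add_integralPart_max hε h (s, r) f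
    rw [← hu] at hmax
    refine Prod.ext (eq_of_weight_mul_eq hε (fun x => (hmax x).1) (fun _ => rfl) fun x hx => ?_)
      (eq_of_weight_mul_eq hε (fun x => (hmax x).2) (fun _ => rfl) fun x hx => ?_)
    · rw [(hmul x hx).1, (main x hx).1]; simp
    · rw [(hmul x hx).2, (main x hx).2.2.2.2.1]; simp
  have hf0 : f = 0 := by rw [hf, hu0, map_zero]
  obtain ⟨m0, m1, m2, m3, m4, -⟩ := main 0 le_rfl
  obtain ⟨c1, c2⟩ := channelA_coords hε h s f.1
  refine ⟨Prod.ext (Complex.ext ?_ ?_) ?_, hu0⟩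
  · rw [← c1, m0, m1, m3]; simp [coordX₁]
  · rw [← c2, m1, m2, m3]; simp [coordX₂]
  · rw [Channel.jet_at_zero, Channel.jetStart_apply, hf0] at m4
    simpa [Channel.unstable] using m4

open scoped ContDiff in
/-- Near an orbit of the stable manifold in `𝒲_{ε,δ}`, the stable manifold is an analytic graph. -/
theorem GoodOrbit.exists_branch (R : Regime ε δ X b) (G : GoodOrbit ε δ X b Z) {ρ : ℝ}
    (hρ : 0 < ρ) :
    ∃ (Yf : Params → Plane) (Bf : Params → ℝ), ContDiffAt ℝ ω Yf (ε, δ, X, b) ∧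
      ContDiffAt ℝ ω Bf (ε, δ, X, b) ∧ Bf (ε, δ, X, b) = Z 0 5 ∧
      ∀ᶠ q : Params in 𝓝 (ε, δ, X, b), ∃ Z' : ℝ → Phase, IsSolutionFrom q.1 q.2.1 0 Z' ∧
        Z' 0 = ofCoords q.2.1 q.2.2.1 (Yf q) q.2.2.2 (Bf q) ∧ Tendsto Z' atTop (𝓝 Mplus) ∧
        ∀ x, 0 ≤ x → |Z' x 4 - Z x 4| ≤ ρ := by
  have hε := R.ε_pos
  have h := R.ε_le_sqrt
  obtain ⟨s, y, hy, hcurve⟩ := G.exists_integral_form R h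
  set p₀ : Params := (ε, δ, X, b) with hp₀
  set E := weight ε hε with hE
  have hone : 1 < (1 + p₀.2.1 ^ 2) * p₀.2.2.2 ^ 2 := R.one_lt
  have hyw := fun x hx => weight_mul_eq (x := x) hε h hy hx
  have hA : ∀ x, 0 ≤ x → E x * y.1 x = Z x 0 := fun x hx => by
    rw [← hcurve x hx]; exact (hyw x hx).1
  have hB : ∀ x, 0 ≤ x → 1 + E x * y.2 x = Z x 4 := fun x hx => by
    rw [← hcurve x hx, (hyw x hx).2]; rfl
  have hc0 := hcurve 0 le_rfl
  obtain ⟨Y, b₁, hst⟩ := G.start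
  obtain ⟨e0, e1, e2, e3, e4, -⟩ := ofCoords_components hst
  have hΓ₀ : boundary hε h (p₀, (s, y)) = 0 := by
    obtain ⟨k1, k2, -, -⟩ := coords_ofCoords R.d_pos e0 e1 e2 e3
    rw [← hc0] at k1 k2 e4
    simp only [curve, Channel.jet_at_zero] at k1 k2 e4
    refine Prod.ext (Complex.ext ?_ ?_) ?_
    · have : (boundary hε h (p₀, (s, y))).1.re = _ - X 0 := rfl
      rw [this]
      exact sub_eq_zero.2 k1
    · have : (boundary hε h (p₀, (s, y))).1.im = _ - X 1 := rfl
      rw [this]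
      exact sub_eq_zero.2 k2
    · exact sub_eq_zero.2 e4
  obtain ⟨φ, hφ, hφ₀, hφ'⟩ := exists_analytic_solution
    ((contDiff_field E ε δ).contDiffAt) (contDiffAt_boundary hε h hone (s, y)) hy hΓ₀
    (hasFDerivAt_field E ε δ b X y) (hasFDerivAt_boundary hε h b X s y)
    (isCompactOperator_linearized hε h y)
    (fun s' u h1 h2 => G.linearized_trivial R h hA hB h1 h2)
  set f : Params → BddReal × BddReal := fun p => field E ε δ (p, (φ p).2) with hf
  have hfc : ContDiffAt ℝ ω f p₀ :=
    (contDiff_field E ε δ).contDiffAt.comp p₀ (contDiffAt_id.prodMk hφ.snd)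
  have jA : ∀ k, ContDiffAt ℝ ω (fun p =>
      (channelA (√δ) ε hε h).jetStart k ((φ p).1.1, (f p).1)) p₀ := fun k =>
    ((channelA (√δ) ε hε h).jetStart k).contDiff.contDiffAt.comp p₀ (hφ.fst.fst.prodMk hfc.fst)
  have jB : ∀ k, ContDiffAt ℝ ω (fun p =>
      (channelB ε hε).jetStart k (((φ p).1.2 : ℂ), (f p).2)) p₀ := fun k =>
    ((channelB ε hε).jetStart k).contDiff.contDiffAt.comp p₀
      ((Complex.ofRealCLM.contDiff.contDiffAt.comp p₀ hφ.fst.snd).prodMk hfc.snd)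
  have hd : ContDiffAt ℝ ω (fun p : Params => deltaTilde p.2.1 p.2.2.2) p₀ :=
    contDiffAt_deltaTilde (by fun_prop) (by fun_prop) hone
  obtain ⟨-, -, y1, y2⟩ := contDiffAt_coords hd (jA 0) (jA 1) (jA 2) (jA 3) R.d_pos.ne'
  have hfp₀ : f p₀ = field E ε δ (p₀, y) := by simp only [hf, hφ₀]
  refine ⟨fun p => !₂[coordY₁ (deltaTilde p.2.1 p.2.2.2)
      ((channelA (√δ) ε hε h).jetStart 0 ((φ p).1.1, (f p).1))
      ((channelA (√δ) ε hε h).jetStart 1 ((φ p).1.1, (f p).1))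
      ((channelA (√δ) ε hε h).jetStart 3 ((φ p).1.1, (f p).1)),
      coordY₂ (deltaTilde p.2.1 p.2.2.2)
      ((channelA (√δ) ε hε h).jetStart 1 ((φ p).1.1, (f p).1))
      ((channelA (√δ) ε hε h).jetStart 2 ((φ p).1.1, (f p).1))
      ((channelA (√δ) ε hε h).jetStart 3 ((φ p).1.1, (f p).1))],
    fun p => (channelB ε hε).jetStart 1 (((φ p).1.2 : ℂ), (f p).2), ?_, jB 1, ?_, ?_⟩
  · rw [contDiffAt_piLp]
    intro i
    fin_cases i
    · exact y1
    · exact y2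
  · beta_reduce
    rw [hfp₀, hφ₀, ← hc0, ← Channel.jet_at_zero]
    rfl
  · have hone' : ∀ᶠ p : Params in 𝓝 p₀, 1 < (1 + p.2.1 ^ 2) * p.2.2.2 ^ 2 := by
      have hcont : Continuous fun p : Params => (1 + p.2.1 ^ 2) * p.2.2.2 ^ 2 := by fun_prop
      exact hcont.continuousAt.eventually_const_lt hone
    -- Closeness in the supremum norm of (v, w), with a weight at most 1, makes B close on the whole
    -- half-line, as needed to establish `Confined`.
    have hnear : ∀ᶠ p : Params in 𝓝 p₀, dist (φ p) (φ p₀) < ρ :=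
      hφ.continuousAt.eventually (Metric.ball_mem_nhds (φ p₀) hρ)
    filter_upwards [hφ', hone', hnear] with p ⟨hp1, hp2⟩ hp3 hp4
    have hd0 := deltaTilde_pos hp3
    refine ⟨curve hε h (φ p).1 (f p), isSolution_curve hε h hp2, ?_, tendsto_curve hε h _ _,
      fun x hx => ?_⟩
    · have r1 := congrArg (fun z : ℂ × ℝ => z.1.re) hp1
      have r2 := congrArg (fun z : ℂ × ℝ => z.1.im) hp1
      have r3 := congrArg (fun z : ℂ × ℝ => z.2) hp1
      have q1 : coordX₁ (deltaTilde p.2.1 p.2.2.2)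
        ((channelA (√δ) ε hε h).jetStart 0 ((φ p).1.1, (f p).1))
        ((channelA (√δ) ε hε h).jetStart 1 ((φ p).1.1, (f p).1))
        ((channelA (√δ) ε hε h).jetStart 3 ((φ p).1.1, (f p).1)) = p.2.2.1 0 := sub_eq_zero.1 r1
      have q2 : coordX₂ (deltaTilde p.2.1 p.2.2.2)
        ((channelA (√δ) ε hε h).jetStart 1 ((φ p).1.1, (f p).1))
        ((channelA (√δ) ε hε h).jetStart 2 ((φ p).1.1, (f p).1))
        ((channelA (√δ) ε hε h).jetStart 3 ((φ p).1.1, (f p).1)) = p.2.2.1 1 := sub_eq_zero.1 r2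
      have q3 : 1 + (channelB ε hε).jetStart 0 (((φ p).1.2 : ℂ), (f p).2) = p.2.2.2 :=
        sub_eq_zero.1 r3
      obtain ⟨u0, u1, u2, u3⟩ := coords_spec hd0
        ((channelA (√δ) ε hε h).jetStart 0 ((φ p).1.1, (f p).1))
        ((channelA (√δ) ε hε h).jetStart 1 ((φ p).1.1, (f p).1))
        ((channelA (√δ) ε hε h).jetStart 2 ((φ p).1.1, (f p).1))
        ((channelA (√δ) ε hε h).jetStart 3 ((φ p).1.1, (f p).1))
      rw [q1] at u0
      rw [q1, q2] at u1 u3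
      rw [q2] at u2
      simp only [curve, Channel.jet_at_zero]
      ext j
      fin_cases j
      · exact u0
      · exact u1
      · exact u2
      · exact u3
      · exact q3
      · rfl
    · have hB' : 1 + E x * (φ p).2.2 x = curve hε h (φ p).1 (f p) x 4 := by
        rw [(weight_mul_eq hε h hp2 hx).2]; rfl
      have e : curve hε h (φ p).1 (f p) x 4 - Z x 4 = E x * ((φ p).2.2 - y.2) x := by
        rw [← hB', ← hB x hx, BoundedContinuousFunction.sub_apply]; ring
      rw [e, abs_mul, hE, weight_apply_of_nonneg hε hx, abs_of_pos (Real.exp_pos _)]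
      have k1 : Real.exp (-(ε / 4) * x) ≤ 1 := Real.exp_le_one_iff.2 (by nlinarith)
      have k2 : |((φ p).2.2 - y.2) x| ≤ ρ := by
        rw [← Real.norm_eq_abs]
        refine (BoundedContinuousFunction.norm_coe_le_norm _ x).trans ?_
        rw [← dist_eq_norm]
        rw [hφ₀] at hp4
        have : dist (φ p).2.2 y.2 ≤ dist (φ p) (s, y) :=
          (le_max_right _ _).trans (le_max_right _ _)
        linarith
      exact (mul_le_of_le_one_left (abs_nonneg _) k1).trans k2

end DomainWall

end

/-! ### Limits of orbits: closedness in the continuation parameter. -/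

open Filter Topology Asymptotics

noncomputable section

namespace DomainWall

theorem contDiff_vectorField (ε δ : ℝ) : ContDiff ℝ 1 (vectorField ε δ) := by
  unfold vectorField
  refine contDiff_pi.2 fun j => ?_
  fin_cases j
  · exact contDiff_apply ℝ ℝ (1 : Fin 6)
  · exact contDiff_apply ℝ ℝ (2 : Fin 6)
  · exact contDiff_apply ℝ ℝ (3 : Fin 6)
  · show ContDiff ℝ 1 fun Z : Phase => Z 0 * (1 - Z 0 ^ 2 - (1 + δ ^ 2) * Z 4 ^ 2)
    fun_prop
  · exact contDiff_apply ℝ ℝ (5 : Fin 6)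
  · show ContDiff ℝ 1 fun Z : Phase => ε ^ 2 * Z 4 * (-1 + (1 + δ ^ 2) * Z 0 ^ 2 + Z 4 ^ 2)
    fun_prop

/-- First order Taylor estimate, uniform over the solutions in a ball. -/
theorem exists_taylor_bound (ε δ M : ℝ) :
    ∃ K : ℝ, ∀ Z : ℝ → Phase, IsSolutionFrom ε δ 0 Z → (∀ x, 0 ≤ x → ‖Z x‖ ≤ M) →
      ∀ x y, 0 ≤ x → 0 ≤ y →
        ‖Z y - Z x - (y - x) • vectorField ε δ (Z x)‖ ≤ K * (|y - x| * |y - x|) := by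
  have hcomp : IsCompact (Metric.closedBall (0 : Phase) M) := isCompact_closedBall 0 M
  obtain ⟨Λ, hΛ⟩ := (contDiff_vectorField ε δ).contDiffOn.exists_lipschitzOnWith one_ne_zero
    (convex_closedBall 0 M) hcomp
  obtain ⟨C, hC⟩ := hcomp.exists_bound_of_continuousOn (contDiff_vectorField ε δ).continuous.continuousOn
  -- On the ball the vector field has Lipschitz constant Λ and is bounded by C, so along an orbit it
  -- varies by at most ΛC|s - x|.
  refine ⟨Λ * C, fun Z hZ hM x y hx hy => ?_⟩
  have hmem : ∀ s, 0 ≤ s → Z s ∈ Metric.closedBall (0 : Phase) M := fun s hs => by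
    simpa using hM s hs
  have hlip : ∀ s, 0 ≤ s → ‖Z s - Z x‖ ≤ C * |s - x| := fun s hs => by
    have := Convex.norm_image_sub_le_of_norm_hasDerivWithin_le (s := Set.Ici 0) (f := Z)
      (f' := fun s => vectorField ε δ (Z s)) hZ (fun s hs => hC _ (hmem s hs)) (convex_Ici 0)
      (Set.mem_Ici.2 hx) (Set.mem_Ici.2 hs)
    simpa using this
  have hsub : Set.uIcc x y ⊆ Set.Ici 0 := fun s hs => by
    rcases Set.mem_uIcc.1 hs with h | h
    · exact hx.trans h.1
    · exact hy.trans h.1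
  have hg : ∀ s ∈ Set.uIcc x y, HasDerivWithinAt
      (fun s => Z s - (s - x) • vectorField ε δ (Z x))
      (vectorField ε δ (Z s) - vectorField ε δ (Z x)) (Set.uIcc x y) s := fun s hs => by
    have h1 := (hZ s (hsub hs)).mono hsub
    have h2 : HasDerivWithinAt (fun s => (s - x) • vectorField ε δ (Z x))
        ((1 : ℝ) • vectorField ε δ (Z x)) (Set.uIcc x y) s :=
      ((hasDerivWithinAt_id s _).sub_const x).smul_const _
    rw [one_smul] at h2
    exact h1.sub h2
  have key := Convex.norm_image_sub_le_of_norm_hasDerivWithin_le (C := Λ * C * |y - x|) hg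
    (fun s hs => ?_) (convex_uIcc x y) Set.left_mem_uIcc Set.right_mem_uIcc
  · have e : Z y - (y - x) • vectorField ε δ (Z x) - (Z x - (x - x) • vectorField ε δ (Z x)) =
        Z y - Z x - (y - x) • vectorField ε δ (Z x) := by
      rw [sub_self, zero_smul, sub_zero]; abel
    rw [e, Real.norm_eq_abs, mul_assoc] at key
    exact key
  · have h1 := hΛ.norm_sub_le (hmem s (hsub hs)) (hmem x hx)
    have h2 := hlip s (hsub hs)
    have h3 : |s - x| ≤ |y - x| := Set.abs_sub_left_of_mem_uIcc hs
    have hC0 : 0 ≤ C := (norm_nonneg _).trans (hC _ (hmem x hx))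
    calc _ ≤ Λ * ‖Z s - Z x‖ := h1
      _ ≤ Λ * (C * |y - x|) := by gcongr; exact h2.trans (by gcongr)
      _ = Λ * C * |y - x| := by ring

/-- A pointwise limit of uniformly bounded solutions is a solution. -/
theorem isSolutionFrom_of_tendsto {ι : Type*} {u : Filter ι} [u.NeBot] {ε δ M : ℝ}
    {Zs : ι → ℝ → Phase} {Z : ℝ → Phase}
    (hs : ∀ᶠ i in u, IsSolutionFrom ε δ 0 (Zs i) ∧ ∀ x, 0 ≤ x → ‖Zs i x‖ ≤ M)
    (hZ : ∀ x, 0 ≤ x → Tendsto (fun i => Zs i x) u (𝓝 (Z x))) : IsSolutionFrom ε δ 0 Z := by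
  obtain ⟨K, hK⟩ := exists_taylor_bound ε δ M
  have hF := (contDiff_vectorField ε δ).continuous
  intro x hx
  -- The uniform Taylor inequality survives pointwise limits and by itself implies differentiability
  -- with the right derivative; no convergence of derivatives is needed.
  have hb : ∀ y, 0 ≤ y →
      ‖Z y - Z x - (y - x) • vectorField ε δ (Z x)‖ ≤ K * (|y - x| * |y - x|) := fun y hy => by
    refine le_of_tendsto (((hZ y hy).sub (hZ x hx)).sub
      (((hF.tendsto _).comp (hZ x hx)).const_smul (y - x))).norm ?_
    filter_upwards [hs] with i hi
    exact hK _ hi.1 hi.2 x y hx hy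
  rw [hasDerivWithinAt_iff_isLittleO]
  refine IsBigO.trans_isLittleO (g := fun y => |y - x| * |y - x|) ?_ ?_
  · refine IsBigO.of_bound K ?_
    filter_upwards [self_mem_nhdsWithin] with y hy
    rw [Real.norm_of_nonneg (by positivity)]
    exact hb y hy
  · have h1 : Tendsto (fun y => |y - x|) (𝓝[Set.Ici 0] x) (𝓝 0) := by
      have : Continuous fun y : ℝ => |y - x| := by fun_prop
      simpa using (this.tendsto x).mono_left nhdsWithin_le_nhds
    have h2 : (fun y => |y - x|) =O[𝓝[Set.Ici 0] x] fun y => y - x :=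
      (isBigO_refl _ _).abs_left
    simpa using ((isLittleO_one_iff ℝ).2 h1).mul_isBigO h2

variable {ε δ b : ℝ} {X : Plane} {Z : ℝ → Phase}

theorem GoodOrbit.norm_le (R : Regime ε δ X b) (G : GoodOrbit ε δ X b Z) {x : ℝ} (hx : 0 ≤ x) :
    (∀ j : Fin 6, (j : ℕ) < 4 → |Z x j| ≤ 30000 * (‖X‖ * Real.exp (-(deltaTilde δ b / 4 * x)))) ∧
      |1 - Z x 4| ≤ 4 * Real.exp (-(√2 * ε * x)) ∧ |Z x 5| ≤ 9 * Real.exp (-(√2 * ε * x)) := by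
  obtain ⟨a0, a1, a2, a3⟩ := G.A_bounds R hx
  obtain ⟨⟨h1, h2⟩, h3, h4⟩ := G.bounds R hx
  have e := Real.exp_pos (-(√2 * ε * x))
  have e' := Real.exp_pos (-(deltaTilde δ b / 4 * x))
  have hb := R.b_lt
  have hb0 := R.b_pos
  have hε := R.ε_pos
  have hε1 : ε ≤ 1 := by have := R.ε_le; have := R.d_le; linarith
  refine ⟨fun j hj => ?_, ?_, ?_⟩
  · have hu : 0 ≤ ‖X‖ * Real.exp (-(deltaTilde δ b / 4 * x)) := by positivity
    fin_cases j
    · exact a0.trans (by linarith)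
    · exact a1.trans (by linarith)
    · exact a2
    · exact a3
    all_goals simp at hj
  · rw [abs_of_nonneg (by linarith [G.B_le hx])]
    refine h2.trans (mul_le_mul_of_nonneg_right (by linarith) e.le)
  · rw [abs_of_nonneg (G.nonneg x hx)]
    refine h4.trans ?_
    rw [← mul_assoc]
    exact mul_le_mul_of_nonneg_right (by nlinarith) e.le

/-- The set of those `t` for which the orbit over `(t X, b)` exists is closed. -/
theorem isClosed_setOf_goodOrbit (R : Regime ε δ X b) :
    IsClosed {t : ℝ | t ∈ Set.Icc (0 : ℝ) 1 ∧ ∃ Z, GoodOrbit ε δ (t • X) b Z} := by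
  rw [isClosed_iff_ultrafilter]
  intro t u hu hS
  have ht : t ∈ Set.Icc (0 : ℝ) 1 :=
    isClosed_iff_ultrafilter.1 isClosed_Icc t u hu (mem_of_superset hS fun s hs => hs.1)
  refine ⟨ht, ?_⟩
  have hex : ∀ s ∈ {t : ℝ | t ∈ Set.Icc (0 : ℝ) 1 ∧ ∃ Z, GoodOrbit ε δ (t • X) b Z},
      ∃ Z, GoodOrbit ε δ (s • X) b Z := fun s hs => hs.2
  choose! Zs hZs using hex
  have hX1 : ‖X‖ ≤ 1 := R.X_le.trans (pow_le_one₀ R.d_pos.le R.d_le)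
  have hbd : ∀ᶠ s in (u : Filter ℝ), ∀ x, 0 ≤ x →
      (∀ j : Fin 6, (j : ℕ) < 4 →
        |Zs s x j| ≤ 30000 * (‖X‖ * Real.exp (-(deltaTilde δ b / 4 * x)))) ∧
      |1 - Zs s x 4| ≤ 4 * Real.exp (-(√2 * ε * x)) ∧
      |Zs s x 5| ≤ 9 * Real.exp (-(√2 * ε * x)) := by
    filter_upwards [hS] with s hs x hx
    obtain ⟨h1, h2, h3⟩ := (hZs s hs).norm_le (R.smul hs.1.1 hs.1.2) hx
    refine ⟨fun j hj => (h1 j hj).trans ?_, h2, h3⟩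
    have : ‖s • X‖ ≤ ‖X‖ := by
      rw [norm_smul, Real.norm_of_nonneg hs.1.1]
      exact mul_le_of_le_one_left (norm_nonneg _) hs.1.2
    gcongr
  have hnorm : ∀ᶠ s in (u : Filter ℝ), IsSolutionFrom ε δ 0 (Zs s) ∧
      ∀ x, 0 ≤ x → ‖Zs s x‖ ≤ 30000 := by
    filter_upwards [hS, hbd] with s hs hb
    refine ⟨(hZs s hs).sol, fun x hx => ?_⟩
    obtain ⟨h1, h2, h3⟩ := hb x hx
    have e1 : Real.exp (-(deltaTilde δ b / 4 * x)) ≤ 1 :=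
      Real.exp_le_one_iff.2 (by have := R.d_pos; nlinarith [mul_nonneg R.d_pos.le hx])
    have e2 : Real.exp (-(√2 * ε * x)) ≤ 1 :=
      Real.exp_le_one_iff.2 (by have := R.ε_pos; have : 0 ≤ √2 * ε * x := by positivity
                                linarith)
    have e3 : ‖X‖ * Real.exp (-(deltaTilde δ b / 4 * x)) ≤ 1 :=
      mul_le_one₀ hX1 (Real.exp_pos _).le e1
    refine (pi_norm_le_iff_of_nonneg (by norm_num)).2 fun j => ?_
    rw [Real.norm_eq_abs]
    have hj := h1 j
    have h4 : |Zs s x 4| ≤ 5 := by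
      have := abs_sub_abs_le_abs_sub (Zs s x 4) 1
      rw [abs_sub_comm, abs_one] at this
      linarith
    fin_cases j
    · exact (hj (by simp)).trans (by linarith)
    · exact (hj (by simp)).trans (by linarith)
    · exact (hj (by simp)).trans (by linarith)
    · exact (hj (by simp)).trans (by linarith)
    · exact h4.trans (by norm_num)
    · exact h3.trans (by linarith)
  -- Along an ultrafilter the compact ball gives a limit at each x, for all x at once, with no
  -- choice of subsequence.
  have hlim : ∀ x, 0 ≤ x → ∃ z, Tendsto (fun s => Zs s x) u (𝓝 z) := fun x hx => by
    obtain ⟨z, -, hz⟩ := (isCompact_closedBall (0 : Phase) 30000).ultrafilter_le_nhds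
      (u.map fun s => Zs s x) (by
        rw [le_principal_iff, Ultrafilter.coe_map, mem_map]
        filter_upwards [hnorm] with s hs
        simpa using hs.2 x hx)
    exact ⟨z, hz⟩
  choose! Z hZ using hlim
  have hZj : ∀ x, 0 ≤ x → ∀ j, Tendsto (fun s => Zs s x j) u (𝓝 (Z x j)) :=
    fun x hx j => (tendsto_pi_nhds.1 (hZ x hx)) j
  refine ⟨Z, isSolutionFrom_of_tendsto hnorm hZ, ?_, fun x hx => ?_, ?_⟩
  -- The exponential bounds do not depend on the family parameter, so they pass to the limit and
  -- force it to tend to M₊.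
  · have tA : Tendsto (fun x => 30000 * (‖X‖ * Real.exp (-(deltaTilde δ b / 4 * x)))) atTop
        (𝓝 0) := by
      have h1 : Tendsto (fun x : ℝ => Real.exp (-(deltaTilde δ b / 4 * x))) atTop (𝓝 0) :=
        Real.tendsto_exp_comp_nhds_zero.2 (tendsto_neg_atTop_atBot.comp
          (tendsto_id.const_mul_atTop (by have := R.d_pos; positivity)))
      simpa using (h1.const_mul ‖X‖).const_mul 30000
    have tB : ∀ c : ℝ, Tendsto (fun x => c * Real.exp (-(√2 * ε * x))) atTop (𝓝 0) := fun c => by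
      have h1 : Tendsto (fun x : ℝ => Real.exp (-(√2 * ε * x))) atTop (𝓝 0) :=
        Real.tendsto_exp_comp_nhds_zero.2 (tendsto_neg_atTop_atBot.comp
          (tendsto_id.const_mul_atTop (by have := R.ε_pos; positivity)))
      simpa using h1.const_mul c
    have hA : ∀ j : Fin 6, (j : ℕ) < 4 → Tendsto (fun x => Z x j) atTop (𝓝 0) := fun j hj => by
      refine squeeze_zero_norm' ?_ tA
      filter_upwards [eventually_ge_atTop 0] with x hx
      refine le_of_tendsto (hZj x hx j).norm ?_
      filter_upwards [hbd] with s hs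
      exact (hs x hx).1 j hj
    refine tendsto_pi_nhds.2 fun j => ?_
    fin_cases j
    · exact hA 0 (by simp)
    · exact hA 1 (by simp)
    · exact hA 2 (by simp)
    · exact hA 3 (by simp)
    · have h1 : Tendsto (fun x => 1 - Z x 4) atTop (𝓝 0) := by
        refine squeeze_zero_norm' ?_ (tB 4)
        filter_upwards [eventually_ge_atTop 0] with x hx
        refine le_of_tendsto ((hZj x hx 4).const_sub 1).norm ?_
        filter_upwards [hbd] with s hs
        exact (hs x hx).2.1
      simpa [Mplus] using h1.const_sub 1
    · have h1 : Tendsto (fun x => Z x 5) atTop (𝓝 0) := by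
        refine squeeze_zero_norm' ?_ (tB 9)
        filter_upwards [eventually_ge_atTop 0] with x hx
        refine le_of_tendsto (hZj x hx 5).norm ?_
        filter_upwards [hbd] with s hs
        exact (hs x hx).2.2
      simpa [Mplus] using h1
  · refine ge_of_tendsto (hZj x hx 5) ?_
    filter_upwards [hS] with s hs
    exact (hZs s hs).nonneg x hx
  · have c0 := hZj 0 le_rfl 0
    have c1 := hZj 0 le_rfl 1
    have c2 := hZj 0 le_rfl 2
    have c3 := hZj 0 le_rfl 3
    have c4 := hZj 0 le_rfl 4
    set d := deltaTilde δ b with hd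
    have d0 : 0 < d := R.d_pos
    have hu' : Tendsto (fun s : ℝ => s) u (𝓝 t) := hu
    have hcoord : ∀ᶠ s in (u : Filter ℝ),
        coordX₁ d (Zs s 0 0) (Zs s 0 1) (Zs s 0 3) = s * X 0 ∧
        coordX₂ d (Zs s 0 1) (Zs s 0 2) (Zs s 0 3) = s * X 1 ∧ Zs s 0 4 = b := by
      filter_upwards [hS] with s hs
      obtain ⟨Y, b₁, hst⟩ := (hZs s hs).start
      obtain ⟨e0, e1, e2, e3, e4, -⟩ := ofCoords_components hst
      obtain ⟨k1, k2, -, -⟩ := coords_ofCoords d0 e0 e1 e2 e3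
      exact ⟨k1, k2, e4⟩
    have l1 : coordX₁ d (Z 0 0) (Z 0 1) (Z 0 3) = t * X 0 := by
      refine tendsto_nhds_unique_of_eventuallyEq (f := fun s => coordX₁ d (Zs s 0 0) (Zs s 0 1)
        (Zs s 0 3)) ?_ (hu'.mul_const (X 0)) (hcoord.mono fun s hs => hs.1)
      exact ((c0.add (((c3.div_const _).sub (c1.div_const _)).div_const _)).div_const _)
    have l2 : coordX₂ d (Z 0 1) (Z 0 2) (Z 0 3) = t * X 1 := by
      refine tendsto_nhds_unique_of_eventuallyEq (f := fun s => coordX₂ d (Zs s 0 1) (Zs s 0 2)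
        (Zs s 0 3)) ?_ (hu'.mul_const (X 1)) (hcoord.mono fun s hs => hs.2.1)
      exact (((c2.div_const _).sub (((c1.div_const _).add (c3.div_const _)).div_const _)).div_const _)
    have l4 : Z 0 4 = b :=
      tendsto_nhds_unique_of_eventuallyEq c4 tendsto_const_nhds (hcoord.mono fun s hs => hs.2.2)
    obtain ⟨u0, u1, u2, u3⟩ := coords_spec d0 (Z 0 0) (Z 0 1) (Z 0 2) (Z 0 3)
    rw [l1] at u0
    rw [l1, l2] at u1 u3
    rw [l2] at u2
    refine ⟨!₂[coordY₁ d (Z 0 0) (Z 0 1) (Z 0 3), coordY₂ d (Z 0 1) (Z 0 2) (Z 0 3)], Z 0 5, ?_⟩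
    ext j
    fin_cases j
    · exact u0
    · exact u1
    · exact u2
    · exact u3
    · exact l4
    · rfl

end DomainWall

end

/-! ### Existence by continuation, and the choice of constants. -/

open Filter Topology Asymptotics

noncomputable section

namespace DomainWall

variable {ε δ b : ℝ} {X : Plane} {Z : ℝ → Phase}

/-- The heteroclinic orbit in the plane `A = 0`. -/
theorem exists_goodOrbit_zero (hε : 0 < ε) (hb0 : 0 < b) (hb1 : b < 1) :
    ∃ Z, GoodOrbit ε δ 0 b Z := by
  have hs2 : √2 ^ 2 = 2 := Real.sq_sqrt (by norm_num)
  have hs0 : 0 < √2 := by positivity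
  -- k is the value at 0 of (1 - B)/(1 + B). The profile (1 - kE)/(1 + kE) with E = e^{-√2 ε x}
  -- solves B' = ε(1 - B²)/√2 and has B(0) = b.
  set k := (1 - b) / (1 + b) with hk
  have hk0 : 0 < k := div_pos (by linarith) (by linarith)
  set E : ℝ → ℝ := fun x => Real.exp (-(√2 * ε) * x) with hE
  have E0 : ∀ x, 0 < E x := fun x => Real.exp_pos _
  have hE0 : E 0 = 1 := by simp [hE]
  set B : ℝ → ℝ := fun x => 2 / (1 + k * E x) - 1 with hB
  have hp : ∀ x, 0 < 1 + k * E x := fun x => by have := E0 x; positivity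
  have dE : HasDerivOnHalfLine E fun x => -(√2 * ε) * E x := HasDerivOnHalfLine.exp_mul _
  have dB : HasDerivOnHalfLine B fun x => ε / √2 * (1 - B x ^ 2) := fun x hx => by
    have h1 := ((((dE x hx).const_mul k).const_add 1).fun_inv (hp x).ne').const_mul 2 |>.sub_const 1
    refine (h1.congr_deriv ?_).congr (fun y _ => by simp [hB, div_eq_mul_inv])
      (by simp [hB, div_eq_mul_inv])
    have := hp x
    simp only [hB]
    field_simp
    rw [hs2]
    ring
  have tE : Tendsto E atTop (𝓝 0) :=
    Real.tendsto_exp_comp_nhds_zero.2 (tendsto_id.const_mul_atTop_of_neg (by nlinarith))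
  have tB : Tendsto B atTop (𝓝 1) := by
    have h1 : Tendsto (fun x => 1 + k * E x) atTop (𝓝 1) := by
      simpa using (tE.const_mul k).const_add 1
    have := ((h1.inv₀ one_ne_zero).const_mul 2).sub_const 1
    norm_num at this
    simpa [hB, div_eq_mul_inv] using this
  refine ⟨fun x => ![0, 0, 0, 0, B x, ε / √2 * (1 - B x ^ 2)], fun x hx => ?_, ?_, fun x hx => ?_,
    0, ε / √2 * (1 - b ^ 2), ?_⟩
  · refine hasDerivWithinAt_pi.2 fun j => ?_
    fin_cases j
    · simpa [vectorField] using hasDerivWithinAt_const x (Set.Ici 0) (0 : ℝ)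
    · simpa [vectorField] using hasDerivWithinAt_const x (Set.Ici 0) (0 : ℝ)
    · simpa [vectorField] using hasDerivWithinAt_const x (Set.Ici 0) (0 : ℝ)
    · simpa [vectorField] using hasDerivWithinAt_const x (Set.Ici 0) (0 : ℝ)
    · exact dB x hx
    · refine (((dB.sq x hx).const_sub 1).const_mul (ε / √2)).congr_deriv ?_
      have e : ε / √2 * (ε / √2) = ε ^ 2 / 2 := by
        rw [div_mul_div_comm, ← sq √2, hs2]; ring
      simp [vectorField]
      linear_combination (-2 * B x * (1 - B x ^ 2)) * e
  · refine tendsto_pi_nhds.2 fun j => ?_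
    fin_cases j
    · exact tendsto_const_nhds
    · exact tendsto_const_nhds
    · exact tendsto_const_nhds
    · exact tendsto_const_nhds
    · exact tB
    · simpa [Mplus] using ((tB.pow 2).const_sub 1).const_mul (ε / √2)
  · have h1 : -1 ≤ B x := by
      have : 0 ≤ 2 / (1 + k * E x) := by have := hp x; positivity
      simp only [hB]; linarith
    have h2 : B x ≤ 1 := by
      have : 2 / (1 + k * E x) ≤ 2 := by
        rw [div_le_iff₀ (hp x)]
        have := mul_pos hk0 (E0 x)
        linarith
      simp only [hB]; linarith
    have h3 : 0 ≤ ε / √2 * (1 - B x ^ 2) := mul_nonneg (by positivity) (by nlinarith)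
    exact h3
  · have hB0 : B 0 = b := by
      simp only [hB, hE0, hk]
      have : (1 + b) ≠ 0 := by linarith
      field_simp
      ring
    ext j
    fin_cases j <;> simp [ofCoords, hB0]

/-- Near an orbit of the stable manifold in `𝒲_{ε,δ}` there are further such orbits, which form an
analytic graph. -/
theorem GoodOrbit.exists_analytic (R : Regime ε δ X b) (G : GoodOrbit ε δ X b Z) :
    ∃ (Yf : Params → Plane) (Bf : Params → ℝ), AnalyticAt ℝ Yf (ε, δ, X, b) ∧
      AnalyticAt ℝ Bf (ε, δ, X, b) ∧
      ∀ᶠ q : Params in 𝓝 (ε, δ, X, b), Regime q.1 q.2.1 q.2.2.1 q.2.2.2 →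
        ∃ Z', GoodOrbit q.1 q.2.1 q.2.2.1 q.2.2.2 Z' ∧
          Z' 0 = ofCoords q.2.1 q.2.2.1 (Yf q) q.2.2.2 (Bf q) := by
  have d0 := R.d_pos
  have hd1 : deltaTilde δ b ^ 4 ≤ 1 := pow_le_one₀ d0.le R.d_le
  have hd4 : 0 < deltaTilde δ b ^ 4 := by positivity
  -- A change of B by ρ lowers (1 + δ²)B² - 1 by at most 4ρ, a quarter of its lower bound; three
  -- quarters remain, strictly more than `Confined` requires, so this persists for nearby
  -- parameters.
  set ρ := deltaTilde δ b ^ 4 / 16 with hρ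
  have hρ0 : 0 < ρ := by positivity
  have hb := R.half_le_b_sq
  have hb0 := R.b_pos
  have hb1 := R.b_lt
  have hρb : ρ < b := by nlinarith
  obtain ⟨Yf, Bf, hY, hB, hB0, hev⟩ := G.exists_branch R hρ0
  refine ⟨Yf, Bf, hY.analyticAt, hB.analyticAt, ?_⟩
  have h1 : ∀ᶠ q : Params in 𝓝 (ε, δ, X, b), 0 < Bf q :=
    hB.continuousAt.eventually_const_lt (hB0 ▸ G.pos R)
  have h2 : ∀ᶠ q : Params in 𝓝 (ε, δ, X, b),
      ((1 + q.2.1 ^ 2) * q.2.2.2 ^ 2 - 1) / 4 < (1 + q.2.1 ^ 2) * (b - ρ) ^ 2 - 1 := by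
    have hc1 : Continuous fun q : Params => ((1 + q.2.1 ^ 2) * q.2.2.2 ^ 2 - 1) / 4 := by fun_prop
    have hc2 : Continuous fun q : Params => (1 + q.2.1 ^ 2) * (b - ρ) ^ 2 - 1 := by fun_prop
    refine hc1.continuousAt.eventually_lt hc2.continuousAt ?_
    show ((1 + δ ^ 2) * b ^ 2 - 1) / 4 < (1 + δ ^ 2) * (b - ρ) ^ 2 - 1
    have hd := R.d_pow
    have hg := R.δ_sq_le
    have h3 : (1 + δ ^ 2) * (b - ρ) ^ 2 - 1 ≥ (1 + δ ^ 2) * b ^ 2 - 1 - 4 * ρ := by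
      have : (1 + δ ^ 2) * (2 * b * ρ) ≤ 2 * (2 * 1 * ρ) := by gcongr; linarith
      nlinarith [mul_nonneg (show 0 ≤ 1 + δ ^ 2 by positivity) (sq_nonneg ρ)]
    linarith
  filter_upwards [h1, h2, hev] with q hq1 hq2 ⟨Z', hs, h0, ht, hcl⟩ R'
  have hconf : Confined q.2.1 q.2.2.2 Z' := fun x hx => by
    have k := abs_le.1 (hcl x hx)
    have l1 := G.le_B hx
    have l2 := G.B_le hx
    refine ⟨?_, by linarith, by linarith⟩
    rw [R'.d_pow]
    have : (b - ρ) ^ 2 ≤ Z' x 4 ^ 2 := pow_le_pow_left₀ (by linarith) (by linarith) 2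
    have : (1 + q.2.1 ^ 2) * (b - ρ) ^ 2 ≤ (1 + q.2.1 ^ 2) * Z' x 4 ^ 2 := by gcongr
    linarith
  exact ⟨Z', ⟨hs, ht, fun x hx => (DomainWall.B₁_pos R' hs ht hconf h0 hq1 hx).1.le, _, _, h0⟩, h0⟩

/-- Continuation in t along tX: the set of admissible t is closed, contains 0, and is open to the
right by the implicit function theorem. The bounds do not deteriorate because `Regime` holds for
every tX. -/
theorem Regime.exists_goodOrbit (R : Regime ε δ X b) : ∃ Z, GoodOrbit ε δ X b Z := by
  set S : Set ℝ := {t : ℝ | t ∈ Set.Icc (0 : ℝ) 1 ∧ ∃ Z, GoodOrbit ε δ (t • X) b Z} with hS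
  set S' : Set ℝ := {t : ℝ | ∃ Z, GoodOrbit ε δ (t • X) b Z} with hS'
  have hSS : S' ∩ Set.Icc 0 1 = S := by ext t; exact and_comm
  have key : Set.Icc (0 : ℝ) 1 ⊆ S' := by
    refine IsClosed.Icc_subset_of_forall_mem_nhdsWithin (hSS ▸ isClosed_setOf_goodOrbit R) ?_ ?_
    · simpa [hS'] using exists_goodOrbit_zero (δ := δ) R.ε_pos R.b_pos R.b_lt
    · rintro t ⟨⟨Z, G⟩, ht0, ht1⟩
      obtain ⟨Yf, Bf, -, -, hev⟩ := G.exists_analytic (R.smul ht0 ht1.le)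
      have hc : Continuous fun s : ℝ => ((ε, δ, s • X, b) : Params) := by fun_prop
      have h1 : ∀ᶠ s : ℝ in 𝓝[>] t, Regime ε δ (s • X) b → ∃ Z', GoodOrbit ε δ (s • X) b Z' := by
        refine ((hc.tendsto t).eventually hev).filter_mono nhdsWithin_le_nhds |>.mono ?_
        intro s hs hR
        obtain ⟨Z', G', -⟩ := hs hR
        exact ⟨Z', G'⟩
      filter_upwards [h1, self_mem_nhdsWithin,
        (eventually_lt_nhds ht1).filter_mono nhdsWithin_le_nhds] with s h1 h2 h3
      exact h1 (R.smul (ht0.trans (le_of_lt h2)) h3.le)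
  simpa [hS'] using key (Set.right_mem_Icc.2 zero_le_one)

theorem IsSolutionFrom.translate {x₀ : ℝ} (hZ : IsSolutionFrom ε δ x₀ Z) (c : ℝ) :
    IsSolutionFrom ε δ (x₀ - c) fun x => Z (x + c) := fun x hx => by
  have h1 := (hZ (x + c) (by linarith)).scomp x
    (((hasDerivWithinAt_id x (Set.Ici (x₀ - c))).add_const c))
    (fun y hy => by simpa [sub_le_iff_le_add] using hy)
  rw [one_smul] at h1
  exact h1

/-- Everything is compared with α = `alphaPlus ν ε`, where α⁵ = (ε/ν)². The lower bound on b gives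
d⁴ ≥ α²δ², so d² ≥ αδ ≥ α/3. Taking ε₀ = ν gives α ≤ 1, hence ε² ≤ ν²α, and ν ≤ 1/2000 yields 1000 ε
≤ d. Moreover ε^{2/5} ≤ α ≤ 3d², so a rate of at most ε^{1/5}/10 lies below d/4. -/
theorem regime_of_mem_paramDomain {k₁ ν ε δ b : ℝ} {X : Plane} (hk₁' : k₁ < 1 / √2)
    (hν0 : 0 < ν) (hν : ν ≤ 1 / 2000)
    (h : (ε, δ, X, b) ∈ paramDomain k₁ (1 / 100000000) ν ν) :
    Regime ε δ X b ∧ deltaStar δ * ε ^ (1 / 5 : ℝ) ≤ deltaTilde δ b / 4 := by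
  obtain ⟨⟨hε0, hε1⟩, ⟨hδ0, hδ1⟩, ⟨hX1, hX2⟩, hb0, hb1⟩ := h
  have hk1 : k₁ ≤ 1 := by
    have : 1 / √2 ≤ 1 := by
      rw [div_le_one (by positivity)]
      exact Real.one_le_sqrt.2 (by norm_num)
    linarith
  have hq0 : 0 < ε / ν := by positivity
  have hq1 : ε / ν ≤ 1 := (div_le_one hν0).2 hε1
  set α := alphaPlus ν ε with hα
  have α0 : 0 < α := Real.rpow_pos_of_pos hq0 _
  have α1 : α ≤ 1 := Real.rpow_le_one hq0.le hq1 (by norm_num)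
  have α5 : α ^ 5 = (ε / ν) ^ 2 := by
    rw [hα, alphaPlus, ← Real.rpow_natCast, ← Real.rpow_mul hq0.le, ← Real.rpow_natCast]
    norm_num
  have hg : 0 < 1 + δ ^ 2 := by positivity
  have hlow : lowerB ν ε δ = √((1 + α ^ 2 * δ ^ 2) / (1 + δ ^ 2)) := rfl
  have hbpos : 0 < b := by
    refine lt_of_lt_of_le ?_ hb0
    rw [hlow]
    exact Real.sqrt_pos.2 (by positivity)
  have hgb : 1 + α ^ 2 * δ ^ 2 ≤ (1 + δ ^ 2) * b ^ 2 := by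
    have := (Real.sqrt_le_left hbpos.le).1 (hlow ▸ hb0)
    rw [div_le_iff₀ hg] at this
    linarith
  have hαδ : 0 < α * δ := by have : 0 < δ := by linarith
                             positivity
  have hone : 1 < (1 + δ ^ 2) * b ^ 2 := by
    have : 0 < α ^ 2 * δ ^ 2 := by rw [← mul_pow]; positivity
    linarith
  have d0 := deltaTilde_pos hone
  have d4 := deltaTilde_pow_four hone
  set d := deltaTilde δ b with hd
  have hd2 : α * δ ≤ d ^ 2 := by
    refine le_of_sq_le_sq ?_ (by positivity)
    have : (d ^ 2) ^ 2 = d ^ 4 := by ring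
    rw [this, d4, mul_pow]
    linarith
  have hα3 : α / 3 ≤ d ^ 2 := by
    have : α * (1 / 3) ≤ α * δ := mul_le_mul_of_nonneg_left hδ0 α0.le
    linarith
  have hεd : 1000 * ε ≤ d := by
    refine le_of_sq_le_sq ?_ d0.le
    have h1 : ε = ν * (ε / ν) := by field_simp
    have h2 : ε ^ 2 ≤ ν ^ 2 * α := by
      have h3 : α ^ 5 ≤ α := pow_le_of_le_one α0.le α1 (by norm_num)
      calc ε ^ 2 = ν ^ 2 * (ε / ν) ^ 2 := by rw [← mul_pow, ← h1]
        _ ≤ ν ^ 2 * α := by rw [← α5]; gcongr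
    have h4 : ν ^ 2 ≤ (1 / 2000) ^ 2 := pow_le_pow_left₀ hν0.le hν 2
    have h5 : ν ^ 2 * α ≤ (1 / 2000) ^ 2 * α := mul_le_mul_of_nonneg_right h4 α0.le
    rw [mul_pow]
    linarith
  refine ⟨⟨hε0, hδ0, hδ1, hbpos, hb1, hone, hεd, ?_, by linarith⟩, ?_⟩
  · refine hX1.trans (le_trans ?_ hd2)
    rw [mul_assoc]
    exact mul_le_of_le_one_left hαδ.le hk1
  · have hs1 : δ ^ (2 / 5 : ℝ) ≤ 1 := Real.rpow_le_one (by linarith) hδ1 (by norm_num)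
    have hs0 : 0 ≤ δ ^ (2 / 5 : ℝ) := Real.rpow_nonneg (by linarith) _
    set e := ε ^ (1 / 5 : ℝ) with he
    have e0 : 0 ≤ e := Real.rpow_nonneg hε0.le _
    have he2 : e ^ 2 ≤ α := by
      have h1 : e ^ 2 = ε ^ (2 / 5 : ℝ) := by
        rw [he, ← Real.rpow_natCast, ← Real.rpow_mul hε0.le]; norm_num
      rw [h1, hα, alphaPlus]
      refine Real.rpow_le_rpow hε0.le ?_ (by norm_num)
      rw [le_div_iff₀ hν0]
      exact mul_le_of_le_one_right hε0.le (by linarith)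
    have h2 : e ≤ 5 / 2 * d := by
      refine le_of_sq_le_sq ?_ (by positivity)
      rw [mul_pow]
      linarith [sq_nonneg d]
    have h3 : deltaStar δ ≤ 1 / 10 := by unfold deltaStar; linarith
    calc deltaStar δ * e ≤ 1 / 10 * (5 / 2 * d) := mul_le_mul h3 h2 e0 (by norm_num)
      _ = d / 4 := by ring

end DomainWall

end

/-! ### Translation, analyticity of the graph and assembly. -/

open Filter Topology Asymptotics

noncomputable section

namespace DomainWall

variable {ε δ b : ℝ} {X : Plane} {Z : ℝ → Phase}

theorem isTheta_exp_translate (c x₀ : ℝ) :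
    (fun x : ℝ => Real.exp (-(c * (x - x₀)))) =Θ[atTop] fun x => Real.exp (-(c * x)) := by
  have h : (fun x : ℝ => Real.exp (-(c * (x - x₀)))) =
      fun x => Real.exp (c * x₀) * Real.exp (-(c * x)) := by
    funext x
    rw [← Real.exp_add]
    congr 1; ring
  rw [h]
  exact (isTheta_const_mul_left (Real.exp_pos _).ne').2 (isTheta_refl _ _)

theorem isTheta_translate {f : ℝ → ℝ} {c : ℝ} (x₀ : ℝ)
    (h : f =Θ[atTop] fun x => Real.exp (-(c * x))) :
    (fun x => f (x - x₀)) =Θ[atTop] fun x => Real.exp (-(c * x)) := by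
  have hsub : Tendsto (fun x : ℝ => x - x₀) atTop atTop :=
    tendsto_atTop_add_const_right _ _ tendsto_id
  have h' : (fun x => f (x - x₀)) =Θ[atTop] fun x => Real.exp (-(c * (x - x₀))) :=
    ⟨h.1.comp_tendsto hsub, h.2.comp_tendsto hsub⟩
  exact h'.trans (isTheta_exp_translate c x₀)

/-- The starting points of the orbits of the stable manifold in `𝒲_{ε,δ}` depend analytically on
the parameters. -/
theorem analyticOn_of_regime {D : Set Params} {Yₛ : Params → Plane} {Bₛ : Params → ℝ}
    (hD : ∀ q ∈ D, Regime q.1 q.2.1 q.2.2.1 q.2.2.2)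
    (h : ∀ q ∈ D, ∃ Z, GoodOrbit q.1 q.2.1 q.2.2.1 q.2.2.2 Z ∧
      Z 0 = ofCoords q.2.1 q.2.2.1 (Yₛ q) q.2.2.2 (Bₛ q)) :
    AnalyticOn ℝ Yₛ D ∧ AnalyticOn ℝ Bₛ D := by
  have key : ∀ q ∈ D, ∃ (Yf : Params → Plane) (Bf : Params → ℝ), AnalyticAt ℝ Yf q ∧
      AnalyticAt ℝ Bf q ∧ ∀ᶠ q' in 𝓝 q, q' ∈ D → Yₛ q' = Yf q' ∧ Bₛ q' = Bf q' := by
    intro q hq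
    obtain ⟨Z, G, -⟩ := h q hq
    obtain ⟨Yf, Bf, hY, hB, hev⟩ := G.exists_analytic (hD q hq)
    refine ⟨Yf, Bf, hY, hB, hev.mono fun q' hq' hmem => ?_⟩
    obtain ⟨Z', G', h0'⟩ := hq' (hD q' hmem)
    obtain ⟨Z'', G'', h0''⟩ := h q' hmem
    -- Uniqueness identifies the globally chosen values with the local analytic branch, so their
    -- arbitrary choice does no harm. The identity is available only inside D, hence analyticity
    -- within D.
    have := G''.unique (hD q' hmem) G' le_rfl
    rw [h0', h0''] at this
    exact ofCoords_injective (hD q' hmem).d_pos this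
  refine ⟨fun q hq => ?_, fun q hq => ?_⟩
  · obtain ⟨Yf, Bf, hY, -, hev⟩ := key q hq
    refine hY.analyticWithinAt.congr_of_eventuallyEq ?_ (hev.self_of_nhds hq).1
    filter_upwards [self_mem_nhdsWithin, hev.filter_mono nhdsWithin_le_nhds] with q' h1 h2
    exact (h2 h1).1
  · obtain ⟨Yf, Bf, -, hB, hev⟩ := key q hq
    refine hB.analyticWithinAt.congr_of_eventuallyEq ?_ (hev.self_of_nhds hq).2
    filter_upwards [self_mem_nhdsWithin, hev.filter_mono nhdsWithin_le_nhds] with q' h1 h2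
    exact (h2 h1).2

end DomainWall

end

open DomainWall in
theorem mainTheorem6 (k₁ : ℝ) (hk₁ : 0 < k₁) (hk₁' : k₁ < 1 / √2) :
    ∃ ν₀ > (0 : ℝ), ∃ C > (0 : ℝ), ∃ c₁ > (0 : ℝ), ∀ ν : ℝ, 0 < ν → ν ≤ ν₀ →
    ∃ ε₀ > (0 : ℝ), ∃ (Yₛ : ℝ × ℝ × Plane × ℝ → Plane) (Bₛ : ℝ × ℝ × Plane × ℝ → ℝ),
      -- the manifold is an analytic graph over `(X₀, b)`, analytic also in `(ε, δ)`
      AnalyticOn ℝ Yₛ (paramDomain k₁ c₁ ν ε₀) ∧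
      AnalyticOn ℝ Bₛ (paramDomain k₁ c₁ ν ε₀) ∧
      ∀ (ε δ : ℝ) (X₀ : Plane) (b : ℝ), (ε, δ, X₀, b) ∈ paramDomain k₁ c₁ ν ε₀ →
        -- the graph consists of points of the stable manifold of `M₊`
        ofCoords δ X₀ (Yₛ (ε, δ, X₀, b)) b (Bₛ (ε, δ, X₀, b)) ∈ stableManifold ε δ ∧
        ∀ x₀ : ℝ,
          -- the orbit that starts at the point of the graph at `x = x₀`
          (∃ Z : ℝ → Phase, IsSolutionFrom ε δ x₀ Z ∧
            Z x₀ = ofCoords δ X₀ (Yₛ (ε, δ, X₀, b)) b (Bₛ (ε, δ, X₀, b)) ∧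
            Tendsto Z atTop (𝓝 Mplus) ∧
            (∀ x, x₀ ≤ x →
              Z x ∈ energyManifold ε δ ∧
              lowerB ν ε δ ≤ Z x₀ 4 ∧ Z x₀ 4 ≤ Z x 4 ∧ Z x 4 ≤ 1 ∧ 0 < Z x 5 ∧
              ∀ j : Fin 6, (j : ℕ) < 4 →
                |Z x j| ≤ C * Real.exp (deltaStar δ * ε ^ (1 / 5 : ℝ) * x₀) *
                  (‖X₀‖ * Real.exp (-(deltaStar δ * ε ^ (1 / 5 : ℝ) * x)))) ∧
            (∀ j : Fin 6, (j : ℕ) < 4 →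
              (fun x => Z x j) =O[atTop] fun x => Real.exp (-(√(δ / 2) * x))) ∧
            ((fun x => 1 - Z x 4) =Θ[atTop] fun x => Real.exp (-(√2 * ε * x))) ∧
            ((fun x => Z x 5) =Θ[atTop] fun x => Real.exp (-(√2 * ε * x)))) ∧
          -- the graph contains every orbit of the stable manifold in `𝒲_{ε,δ}` over `(X₀, b)`
          (∀ (Z : ℝ → Phase) (Y : Plane) (b₁ : ℝ), IsSolutionFrom ε δ x₀ Z →
            Z x₀ = ofCoords δ X₀ Y b b₁ → (∀ x, x₀ ≤ x → Z x ∈ energyManifold ε δ) →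
            Tendsto Z atTop (𝓝 Mplus) →
            Y = Yₛ (ε, δ, X₀, b) ∧ b₁ = Bₛ (ε, δ, X₀, b)) := by
  refine ⟨1 / 2000, by norm_num, 30000, by norm_num, 1 / 100000000, by norm_num, fun ν hν0 hν => ?_⟩
  have hR : ∀ q : Params, q ∈ paramDomain k₁ (1 / 100000000) ν ν →
      Regime q.1 q.2.1 q.2.2.1 q.2.2.2 := fun q hq =>
    (regime_of_mem_paramDomain hk₁' hν0 hν hq).1
  have hex : ∀ q : Params, ∃ (Y : Plane) (b₁ : ℝ), q ∈ paramDomain k₁ (1 / 100000000) ν ν →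
      ∃ Z, GoodOrbit q.1 q.2.1 q.2.2.1 q.2.2.2 Z ∧
        Z 0 = ofCoords q.2.1 q.2.2.1 Y q.2.2.2 b₁ := fun q => by
    by_cases hq : q ∈ paramDomain k₁ (1 / 100000000) ν ν
    · obtain ⟨Z, G⟩ := (hR q hq).exists_goodOrbit
      obtain ⟨Y, b₁, h0⟩ := G.start
      exact ⟨Y, b₁, fun _ => ⟨Z, G, h0⟩⟩
    -- Outside the parameter domain the values are irrelevant.
    · exact ⟨0, 0, fun h => absurd h hq⟩
  choose Yₛ Bₛ hYB using hex
  obtain ⟨hYan, hBan⟩ := analyticOn_of_regime hR hYB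
  refine ⟨ν, hν0, Yₛ, Bₛ, hYan, hBan, fun ε δ X₀ b hq => ?_⟩
  obtain ⟨R, hrate⟩ := regime_of_mem_paramDomain hk₁' hν0 hν hq
  obtain ⟨Z, G, h0⟩ := hYB _ hq
  simp only at G h0
  refine ⟨⟨Z, G.sol, h0, G.tends⟩, fun x₀ => ⟨?_, ?_⟩⟩
  · have hsub : Tendsto (fun x : ℝ => x - x₀) atTop atTop := tendsto_atTop_add_const_right _ _ tendsto_id
    refine ⟨fun x => Z (x - x₀), ?_, by simpa using h0, G.tends.comp hsub, fun x hx => ?_,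
      fun j hj => ?_, ?_, ?_⟩
    · simpa [sub_eq_add_neg] using G.sol.translate (-x₀)
    · have hx' : 0 ≤ x - x₀ := by linarith
      refine ⟨G.mem_energyManifold hx', ?_, ?_, G.B_le hx', G.B₁_pos R hx', fun j hj => ?_⟩
      · beta_reduce
        rw [sub_self, G.start_four]
        exact hq.2.2.2.1
      · beta_reduce
        rw [sub_self, G.start_four]
        exact G.le_B hx'
      · refine ((G.norm_le R hx').1 j hj).trans ?_
        rw [mul_assoc, mul_left_comm (Real.exp _), ← Real.exp_add]
        refine mul_le_mul_of_nonneg_left (mul_le_mul_of_nonneg_left (Real.exp_le_exp.2 ?_)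
          (norm_nonneg _)) (by norm_num)
        -- The stated rate is weaker than `deltaTilde δ b / 4`; the factor with x₀ turns decay in x
        -- - x₀ into decay in x.
        have := mul_le_mul_of_nonneg_right hrate hx'
        linarith
    · exact ((G.isBigO_A R j hj).comp_tendsto hsub).trans (isTheta_exp_translate _ x₀).1
    · exact isTheta_translate x₀ (G.isTheta_B R)
    · exact isTheta_translate x₀ (G.isTheta_B₁ R)
  · intro Z' Y b₁ hZ' h0' hE ht
    have G' : GoodOrbit ε δ X₀ b fun x => Z' (x + x₀) := by
      refine ⟨by simpa using hZ'.translate x₀, ht.comp (tendsto_atTop_add_const_right _ _ tendsto_id),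
        fun x hx => (hE (x + x₀) (by linarith)).2, Y, b₁, by simpa using h0'⟩
    have := G'.unique R G le_rfl
    rw [h0, zero_add, h0'] at this
    exact ofCoords_injective R.d_pos this
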